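/- Let $k\ge 0$ and let $\mathcal U_k$ be the finite monoid of uniform block permutations: set partitions $d$ of $[k]\cup[\bar k]$ each of whose blocks $d_i$ satisfies $|d_i\cap[k]|=|d_i\cap[\bar k]|$, where the product $dd'$ is obtained by stacking the diagram of $d$ on top of that of $d'$, taking connected components and deleting the middle row. Write $\mathrm{top}(d)$ (resp. $\mathrm{bot}(d)$) for the set partition of $[k]$ induced by $d$ on the top (resp. bottom) row, $e_\pi=\{A\cup\bar A:A\in\pi\}$ for a set partition $\pi$ of $[k]$, $s_i\in\mathcal U_k$ for the transposition of $i$ and $i+1$, and $b_i=e_\pi$ where $\pi$ has the block $\{i,i+1\}$ and otherwise singletons ($1\le i<k$). Let $\vec\lambda=(\lambda^{(1)},\dots,\lambda^{(k)})$ be partitions with $\sum_i i|\lambda^{(i)}|=k$, let $\lambda=(1^{a_1}\cdots k^{a_k})$ with $a_i=|\lambda^{(i)}|$, and let $\pi=\pi_\lambda$ be the set partition of $[k]$ into consecutive intervals, first $a_1$ of size $1$, then $a_2$ of size $2$, and so on. Let $G_\lambda=\{d:\mathrm{top}(d)=\mathrm{bot}(d)=\pi\}$, a group with identity $e_\pi$,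 and $L_\lambda=\{d:\mathrm{bot}(d)=\pi\}$. The space $\mathbb CL_\lambda$ is a $(\mathcal U_k,G_\lambda)$-bimodule, where $d\odot\ell=d\ell$ if $d\ell\in L_\lambda$ and $d\odot\ell=0$ otherwise, and $G_\lambda$ acts by right multiplication. Let $V^{\vec\lambda}$ be the tensor product over $i$ of the Specht modules indexed by $\lambda^{(i)}$ of the symmetric groups on the blocks of $\pi$ of size $i$. The group $G_\lambda$ acts on it by permuting blocks: $g$ acts by the permutation of the blocks of $\pi$ sending $\overline{g_j}\cap[k]$ to $g_j\cap[k]$ for every block $g_j$ of $g$. Put $W^{\vec\lambda}=\mathbb CL_\lambda\otimes_{\mathbb CG_\lambda}V^{\vec\lambda}$. Order blocks of set partitions by the graded last letter order (first by size, then by maximum). A $\pi$-tableau $\mathbf T=(T^{(1)},\dots,T^{(k)})$ of shape $\vec\lambda$ consists of standard tableaux $T^{(i)}$ of shape $\lambda^{(i)}$ filled with the blocks of $\pi$ of size $i$, each used once; it is identified with the tensor product of the corresponding polytabloids in $V^{\vec\lambda}$. For a set partition $\gamma$ of $[k]$ of type $\lambda$, let $\ell_\pi^\gamma\in L_\lambda$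 be the element matching the $j$-th block of $\gamma$ (top row) with the $j$-th block of $\pi$ (bottom row) for all $j$. A uniform tableau of shape $\vec\lambda$ is a sequence $\mathbf S=(S^{(1)},\dots,S^{(k)})$ of tableaux, $S^{(i)}$ of shape $\lambda^{(i)}$ filled with subsets of $[k]$ of size $i$, such that the entries of all cells together form a set partition of $[k]$ and the maxima of the entries increase along the rows and columns of each $S^{(i)}$. Let $\mathcal T_{\vec\lambda}$ be the set of uniform tableaux. Garnir straightening rewrites a not necessarily standard sequence of tableaux of this kind as a linear combination of uniform tableaux, modulo the column relations (permuting the entries within the columns of one $S^{(i)}$ multiplies by the sign) and the Garnir relations (if $A$, $B$ are sets of cells in columns $j$, $j+1$ of one $S^{(i)}$ and $|A\cup B|$ exceeds the length of column $j$, then the signed sum over a transversal of $\mathfrak S_{A\cup B}/(\mathfrak S_A\times\mathfrak S_B)$ is $0$). Theorem. (a) $W^{\vec\lambda}$ is an irreducible representation of $\mathcal U_k$, and the elements $\ell_\pi^\gamma\otimes\mathbf T$, with $\gamma$ a set partition of $[k]$ of type $\lambda$ and $\mathbf T$ a $\pi$-tableau of shape $\vec\lambda$, form a basis of it. (b) Every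 such sequence of tableaux has exactly one Garnir straightening, and there is exactly one representation of $\mathcal U_k$ on the space $\mathbb C\mathcal T_{\vec\lambda}$ of formal linear combinations of uniform tableaux such that, for $1\le i<k$, $b_i\mathbf S=\mathbf S$ if $i$ and $i+1$ lie in the same cell of $\mathbf S$ and $b_i\mathbf S=0$ otherwise, and $s_i\mathbf S$ is the Garnir straightening of the sequence obtained from $\mathbf S$ by interchanging $i$ and $i+1$. (c) Let $\rho(\ell_\pi^\gamma\otimes\mathbf T)$ be obtained from $\mathbf T$ by replacing, for every $j$, the $j$-th block of $\pi$ by the $j$-th block of $\gamma$. This is a uniform tableau, and $\rho$ extends linearly to an isomorphism of representations $\rho\colon W^{\vec\lambda}\to\mathbb C\mathcal T_{\vec\lambda}$. -/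

import Mathlib

open scoped TensorProduct BigOperators

namespace UBP

variable {k : ℕ}

/-! ### Uniform block permutations

`[k]` is `Fin k`, the top row `[k]` of a diagram is the left summand of `Fin k ⊕ Fin k` and the
bottom row `[k̄]` is the right summand.  Set partitions are given by their equivalence relations
("lie in the same block"). -/

/-- A uniform block permutation: a set partition of `[k] ∪ [k̄]` each of whose blocks contains as
many elements of the top row as of the bottom row. -/
@[ext]
structure U (k : ℕ) where
  rel : Setoid (Fin k ⊕ Fin k)
  uniform : ∀ x, {a | rel x (Sum.inl a)}.ncard = {b | rel x (Sum.inr b)}.ncard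

/-- The embedding of the first two rows in the three-row diagram. -/
def upper : Fin k ⊕ Fin k → Fin k ⊕ Fin k ⊕ Fin k :=
  Sum.elim Sum.inl (fun b => Sum.inr (Sum.inl b))

/-- The embedding of the last two rows in the three-row diagram. -/
def lower : Fin k ⊕ Fin k → Fin k ⊕ Fin k ⊕ Fin k := Sum.inr

/-- The embedding of the first and last row in the three-row diagram. -/
def outer : Fin k ⊕ Fin k → Fin k ⊕ Fin k ⊕ Fin k :=
  Sum.elim Sum.inl (fun b => Sum.inr (Sum.inr b))

/-- Connected components of the three-row diagram obtained by stacking `d` on top of `d'`. -/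
def stack (d d' : Setoid (Fin k ⊕ Fin k)) : Setoid (Fin k ⊕ Fin k ⊕ Fin k) :=
  Relation.EqvGen.setoid fun x y =>
    (∃ a b, d a b ∧ upper a = x ∧ upper b = y) ∨ (∃ a b, d' a b ∧ lower a = x ∧ lower b = y)

theorem stack_upper {d d' : Setoid (Fin k ⊕ Fin k)} {a b} (h : d a b) :
    stack d d' (upper a) (upper b) :=
  Relation.EqvGen.rel _ _ (Or.inl ⟨a, b, h, rfl, rfl⟩)

theorem stack_lower {d d' : Setoid (Fin k ⊕ Fin k)} {a b} (h : d' a b) :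
    stack d d' (lower a) (lower b) :=
  Relation.EqvGen.rel _ _ (Or.inr ⟨a, b, h, rfl, rfl⟩)

theorem stack_lift {d d' : Setoid (Fin k ⊕ Fin k)} {Z : Type*}
    (f : Fin k ⊕ Fin k ⊕ Fin k → Z)
    (h1 : ∀ a b, d a b → f (upper a) = f (upper b))
    (h2 : ∀ a b, d' a b → f (lower a) = f (lower b)) {x y} (h : stack d d' x y) : f x = f y := by
  have : stack d d' ≤ Setoid.ker f := by
    apply Setoid.eqvGen_le
    rintro x y (⟨a, b, h, rfl, rfl⟩ | ⟨a, b, h, rfl, rfl⟩)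
    · exact h1 a b h
    · exact h2 a b h
  exact this h

namespace U

theorem exists_bot (d : U k) (x : Fin k ⊕ Fin k) : ∃ b, d.rel x (Sum.inr b) := by
  rcases x with a | b
  · have h : ({a' | d.rel (Sum.inl a) (Sum.inl a')}).ncard ≠ 0 :=
      (Set.ncard_ne_zero_of_mem (a := a) (d.rel.refl' _))
    rw [d.uniform] at h
    exact Set.nonempty_of_ncard_ne_zero h
  · exact ⟨b, d.rel.refl' _⟩

theorem exists_top (d : U k) (x : Fin k ⊕ Fin k) : ∃ a, d.rel x (Sum.inl a) := by
  rcases x with a | b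
  · exact ⟨a, d.rel.refl' _⟩
  · have h : ({b' | d.rel (Sum.inr b) (Sum.inr b')}).ncard ≠ 0 :=
      (Set.ncard_ne_zero_of_mem (a := b) (d.rel.refl' _))
    rw [← d.uniform] at h
    exact Set.nonempty_of_ncard_ne_zero h

/-- The lower partner in the same block. -/
noncomputable def dn (d : U k) (x : Fin k ⊕ Fin k) : Fin k := (d.exists_bot x).choose

theorem dn_spec (d : U k) (x : Fin k ⊕ Fin k) : d.rel x (Sum.inr (d.dn x)) :=
  (d.exists_bot x).choose_spec

theorem ncard_fiber (d : U k) {Z : Type*} (f : Fin k ⊕ Fin k → Z)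
    (hf : ∀ x y, d.rel x y → f x = f y) (z : Z) :
    {a | f (Sum.inl a) = z}.ncard = {b | f (Sum.inr b) = z}.ncard := by
  classical
  simp only [Set.ncard_eq_toFinset_card', Set.toFinset_ofPred]
  rw [Finset.card_eq_sum_card_fiberwise (f := fun a => (Quotient.mk d.rel (Sum.inl a)))
      (t := Finset.univ) (by intro a _; simp),
    Finset.card_eq_sum_card_fiberwise (f := fun a => (Quotient.mk d.rel (Sum.inr a)))
      (t := Finset.univ) (by intro a _; simp)]
  refine Finset.sum_congr rfl fun q _ => ?_
  induction q using Quotient.inductionOn with | _ x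
  by_cases hx : f x = z
  · have h := d.uniform x
    simp only [Set.ncard_eq_toFinset_card', Set.toFinset_ofPred] at h
    convert h using 2
    · ext a
      simp only [Finset.mem_filter, Finset.mem_univ, true_and, Quotient.eq]
      exact ⟨fun h => d.rel.symm' h.2, fun h => ⟨(hf _ _ h).symm.trans hx, d.rel.symm' h⟩⟩
    · ext a
      simp only [Finset.mem_filter, Finset.mem_univ, true_and, Quotient.eq]
      exact ⟨fun h => d.rel.symm' h.2, fun h => ⟨(hf _ _ h).symm.trans hx, d.rel.symm' h⟩⟩
  · rw [Finset.card_eq_zero.2, Finset.card_eq_zero.2]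
    · ext a
      simp only [Finset.mem_filter, Finset.mem_univ, true_and, Quotient.eq, Finset.notMem_empty,
        iff_false, not_and]
      exact fun h h' => hx ((hf _ _ h').symm.trans h)
    · ext a
      simp only [Finset.mem_filter, Finset.mem_univ, true_and, Quotient.eq, Finset.notMem_empty,
        iff_false, not_and]
      exact fun h h' => hx ((hf _ _ h').symm.trans h)

/-- The product of diagrams: stack, take connected components, forget the middle row. -/
instance : Mul (U k) where
  mul d d' :=
    { rel := Setoid.comap outer (stack d.rel d'.rel)
      uniform := fun x => by
        have h1 := d.ncard_fiber
          (fun y => Quotient.mk (stack d.rel d'.rel) (upper y))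
          (fun a b h => Quotient.sound (stack_upper h)) (Quotient.mk _ (outer x))
        have h2 := d'.ncard_fiber
          (fun y => Quotient.mk (stack d.rel d'.rel) (lower y))
          (fun a b h => Quotient.sound (stack_lower h)) (Quotient.mk _ (outer x))
        have h3 := h1.trans h2
        simp only [Quotient.eq] at h3
        simp only [Setoid.comap_rel]
        convert h3 using 2
        · ext a
          simp only [Set.mem_ofPred_eq]
          exact ⟨fun h => Setoid.symm' _ h, fun h => Setoid.symm' _ h⟩
        · ext a
          simp only [Set.mem_ofPred_eq]
          exact ⟨fun h => Setoid.symm' _ h, fun h => Setoid.symm' _ h⟩ }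

theorem mul_rel (d d' : U k) (x y) :
    (d * d').rel x y ↔ stack d.rel d'.rel (outer x) (outer y) := Iff.rfl

theorem mul_lift {d d' : U k} {Z : Type*} (f : Fin k → Z) (g : Fin k → Z) (h : Fin k → Z)
    (h1 : ∀ x y, d.rel x y → Sum.elim f g x = Sum.elim f g y)
    (h2 : ∀ x y, d'.rel x y → Sum.elim g h x = Sum.elim g h y) {x y}
    (hxy : (d * d').rel x y) : Sum.elim f h x = Sum.elim f h y := by
  have := stack_lift (d := d.rel) (d' := d'.rel) (Sum.elim f (Sum.elim g h))
    (by
      intro a b hab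
      have := h1 a b hab
      rcases a with a | a <;> rcases b with b | b <;> simpa [upper] using this)
    (by
      intro a b hab
      exact h2 a b hab) hxy
  rcases x with a | a <;> rcases y with b | b <;> simpa [outer] using this

theorem mul_top_bot {d d' : U k} {a b c} (h : d.rel (Sum.inl a) (Sum.inr b))
    (h' : d'.rel (Sum.inl b) (Sum.inr c)) : (d * d').rel (Sum.inl a) (Sum.inr c) :=
  (stack d.rel d'.rel).trans' (stack_upper h) (stack_lower h')

theorem mul_top_top {d d' : U k} {a a'} (h : d.rel (Sum.inl a) (Sum.inl a')) :
    (d * d').rel (Sum.inl a) (Sum.inl a') := stack_upper h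

theorem mul_bot_bot {d d' : U k} {c c'} (h : d'.rel (Sum.inr c) (Sum.inr c')) :
    (d * d').rel (Sum.inr c) (Sum.inr c') := stack_lower h

/-- Reflection of a diagram in a horizontal line. -/
def flip (d : U k) : U k where
  rel := Setoid.comap Sum.swap d.rel
  uniform := fun x => (d.uniform x.swap).symm

@[simp] theorem flip_flip (d : U k) : d.flip.flip = d := by
  apply U.ext
  apply Setoid.ext
  intro x y
  change d.rel x.swap.swap y.swap.swap ↔ _
  rw [Sum.swap_swap, Sum.swap_swap]

theorem flip_rel (d : U k) (x y) : d.flip.rel x y ↔ d.rel x.swap y.swap := Iff.rfl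

theorem rel_ext_of_le {d d' : U k} (h : ∀ x y, d.rel x y → d'.rel x y)
    (h' : ∀ x y, d'.rel x y → d.rel x y) : d = d' := by
  ext x y
  exact ⟨h x y, h' x y⟩

theorem flip_mul_le (d d' : U k) (x y) (h : (d * d').flip.rel x y) :
    (d'.flip * d.flip).rel x y := by
  have := mul_lift (d := d) (d' := d') (Z := Quotient (stack d'.flip.rel d.flip.rel))
    (fun a => Quotient.mk _ (Sum.inr (Sum.inr a))) (fun b => Quotient.mk _ (Sum.inr (Sum.inl b)))
    (fun c => Quotient.mk _ (Sum.inl c))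
    (by
      intro x y hxy
      have h2 : d.flip.rel x.swap y.swap := by simpa [flip_rel] using hxy
      have := Quotient.sound (stack_lower (d := d'.flip.rel) h2)
      rcases x with a | a <;> rcases y with b | b <;> exact this)
    (by
      intro x y hxy
      have h2 : d'.flip.rel x.swap y.swap := by simpa [flip_rel] using hxy
      have := Quotient.sound (stack_upper (d' := d.flip.rel) h2)
      rcases x with a | a <;> rcases y with b | b <;> exact this) h
  rw [mul_rel]
  rcases x with a | a <;> rcases y with b | b <;> exact Quotient.exact this

theorem flip_mul (d d' : U k) : (d * d').flip = d'.flip * d.flip := by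
  refine rel_ext_of_le (flip_mul_le d d') fun x y h => ?_
  have := flip_mul_le d'.flip d.flip x.swap y.swap (by simpa [flip_rel] using h)
  rw [flip_flip, flip_flip] at this
  exact this

theorem mul_assoc_le (d d' d'' : U k) (x y) (h : (d * d' * d'').rel x y) :
    (d * (d' * d'')).rel x y := by
  set E := (d * (d' * d'')).rel with hE
  have key : ∀ b, (d' * d'').rel (Sum.inl b) (Sum.inr (d''.dn (Sum.inl (d'.dn (Sum.inl b))))) :=
    fun b => mul_top_bot (d'.dn_spec _) (d''.dn_spec _)
  have keyc : ∀ c c', d'.rel (Sum.inr c) (Sum.inr c') →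
      E (Sum.inr (d''.dn (Sum.inl c))) (Sum.inr (d''.dn (Sum.inl c'))) := by
    intro c c' hcc
    apply mul_bot_bot
    exact (stack d'.rel d''.rel).trans' ((stack d'.rel d''.rel).trans'
      ((stack d'.rel d''.rel).symm' (stack_lower (d''.dn_spec _)))
      (stack_upper hcc)) (stack_lower (d''.dn_spec _))
  have hD : ∀ c c', d''.rel (Sum.inr c) (Sum.inr c') → E (Sum.inr c) (Sum.inr c') :=
    fun c c' h => mul_bot_bot (mul_bot_bot h)
  have hsound : ∀ {x y}, E x y → Quotient.mk E x = Quotient.mk E y := fun h => Quotient.sound h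
  have h1 := mul_lift (d := d * d') (d' := d'') (Z := Quotient E)
    (fun a => Quotient.mk _ (Sum.inl a))
    (fun c => Quotient.mk _ (Sum.inr (d''.dn (Sum.inl c))))
    (fun e => Quotient.mk _ (Sum.inr e))
    (by
      intro x y hxy
      refine mul_lift (d := d) (d' := d') (Z := Quotient E)
        (fun a => Quotient.mk _ (Sum.inl a))
        (fun b => Quotient.mk _ (Sum.inr (d''.dn (Sum.inl (d'.dn (Sum.inl b))))))
        (fun c => Quotient.mk _ (Sum.inr (d''.dn (Sum.inl c)))) ?_ ?_ hxy
      · intro x y hxy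
        rcases x with a | a <;> rcases y with b | b
        · exact hsound (mul_top_top hxy)
        · exact hsound (mul_top_bot hxy (key b))
        · exact (hsound (mul_top_bot (Setoid.symm' _ hxy) (key a))).symm
        · exact hsound ((stack d.rel (d' * d'').rel).trans'
            ((stack d.rel (d' * d'').rel).symm' (stack_lower (key a)))
            ((stack d.rel (d' * d'').rel).trans' (stack_upper hxy) (stack_lower (key b))))
      · intro x y hxy
        have hb := fun b => d'.dn_spec (Sum.inl b)
        rcases x with a | a <;> rcases y with b | b
        · exact hsound (keyc _ _
            (Setoid.trans' _ (Setoid.symm' _ (hb a)) (Setoid.trans' _ hxy (hb b))))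
        · exact hsound (keyc _ _ (Setoid.trans' _ (Setoid.symm' _ (hb a)) hxy))
        · exact hsound (keyc _ _ (Setoid.trans' _ hxy (hb b)))
        · exact hsound (keyc _ _ hxy))
    (by
      intro x y hxy
      have hb := fun b => d''.dn_spec (Sum.inl b)
      rcases x with a | a <;> rcases y with b | b
      · exact hsound (hD _ _
          (Setoid.trans' _ (Setoid.symm' _ (hb a)) (Setoid.trans' _ hxy (hb b))))
      · exact hsound (hD _ _ (Setoid.trans' _ (Setoid.symm' _ (hb a)) hxy))
      · exact hsound (hD _ _ (Setoid.trans' _ hxy (hb b)))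
      · exact hsound (hD _ _ hxy)) h
  rcases x with a | a <;> rcases y with b | b <;> exact Quotient.exact h1

theorem mul_assoc' (d d' d'' : U k) : d * d' * d'' = d * (d' * d'') := by
  refine rel_ext_of_le (mul_assoc_le d d' d'') fun x y h => ?_
  have h2 : (d''.flip * d'.flip * d.flip).rel x.swap y.swap := by
    rw [← flip_mul, ← flip_mul]
    simpa [flip_rel] using h
  have h3 := mul_assoc_le _ _ _ _ _ h2
  rw [← flip_mul, ← flip_mul] at h3
  simpa [flip_rel] using h3

/-- The set partition `top(d)` of `[k]`. -/
def top (d : U k) : Setoid (Fin k) := Setoid.comap Sum.inl d.rel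

/-- The set partition `bot(d)` of `[k]`. -/
def bot (d : U k) : Setoid (Fin k) := Setoid.comap Sum.inr d.rel

/-- The idempotent `e_π = {A ∪ Ā : A ∈ π}`. -/
def e (π : Setoid (Fin k)) : U k where
  rel := Setoid.ker (Sum.elim (Quotient.mk π) (Quotient.mk π))
  uniform := fun _ => rfl

theorem e_mul {π : Setoid (Fin k)} {d : U k} (h : π ≤ d.top) : e π * d = d := by
  have hl : ∀ a, stack (e π).rel d.rel (Sum.inl a) (Sum.inr (Sum.inl a)) := fun a =>
    stack_upper (a := Sum.inl a) (b := Sum.inr a) rfl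
  refine rel_ext_of_le (fun x y hxy => ?_) (fun x y hxy => ?_)
  · have := mul_lift (d := e π) (d' := d) (Z := Quotient d.rel)
      (fun a => Quotient.mk _ (Sum.inl a)) (fun a => Quotient.mk _ (Sum.inl a))
      (fun a => Quotient.mk _ (Sum.inr a))
      (by
        intro x y hxy
        rcases x with a | a <;> rcases y with b | b <;>
          exact Quotient.sound (h (Quotient.exact hxy)))
      (by
        intro x y hxy
        rcases x with a | a <;> rcases y with b | b <;> exact Quotient.sound hxy) hxy
    rcases x with a | a <;> rcases y with b | b <;> exact Quotient.exact this
  · have hm := stack_lower (d := (e π).rel) hxy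
    rw [mul_rel]
    rcases x with a | a <;> rcases y with b | b
    · exact Setoid.trans' _ (hl a) (Setoid.trans' _ hm (Setoid.symm' _ (hl b)))
    · exact Setoid.trans' _ (hl a) hm
    · exact Setoid.trans' _ hm (Setoid.symm' _ (hl b))
    · exact hm

theorem flip_e (π : Setoid (Fin k)) : (e π).flip = e π := by
  refine rel_ext_of_le (fun x y hxy => ?_) (fun x y hxy => ?_) <;>
  rcases x with a | a <;> rcases y with b | b <;> exact hxy

theorem mul_e {π : Setoid (Fin k)} {d : U k} (h : π ≤ d.bot) : d * e π = d := by
  rw [← flip_flip (d * e π), flip_mul, flip_e, e_mul (d := d.flip) h, flip_flip]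

/-- The monoid of uniform block permutations; its identity is `{{1, 1̄}, …, {k, k̄}}`. -/
instance : Monoid (U k) where
  mul_assoc := mul_assoc'
  one := e ⊥
  one_mul _ := e_mul bot_le
  mul_one _ := mul_e bot_le

/-- The permutation `σ`, as the uniform block permutation `{{1, σ(1)̄}, …, {k, σ(k)̄}}`. -/
def ofPerm (σ : Equiv.Perm (Fin k)) : U k where
  rel := Setoid.ker (Sum.elim σ id)
  uniform := fun x => by
    simp only [Setoid.ker_def, Sum.elim_inl, Sum.elim_inr, id]
    generalize Sum.elim (⇑σ) id x = z
    rw [← Set.ncard_image_of_injective _ σ.injective]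
    congr 1
    ext b
    constructor
    · rintro ⟨a, rfl, rfl⟩
      rfl
    · rintro rfl
      exact ⟨σ.symm z, by simp⟩

/-- The generator `s_i`, exchanging `i` and `i + 1`. -/
def s (i : ℕ) (hi : i + 1 < k) : U k := ofPerm (Equiv.swap ⟨i, by omega⟩ ⟨i + 1, hi⟩)

/-- The generator `b_i`, with the block `{i, i + 1, ī, (i+1)̄}` and all other blocks `{j, j̄}`. -/
def b (i : ℕ) (hi : i + 1 < k) : U k :=
  e (Setoid.ker fun a : Fin k => if a = ⟨i + 1, hi⟩ then (⟨i, by omega⟩ : Fin k) else a)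

/-! Composable products -/

theorem mul_rel_of_eq {d d' : U k} (h : d.bot = d'.top) :
    (∀ a a', (d * d').rel (Sum.inl a) (Sum.inl a') ↔ d.rel (Sum.inl a) (Sum.inl a')) ∧
    (∀ a c, (d * d').rel (Sum.inl a) (Sum.inr c) ↔
      ∃ b, d.rel (Sum.inl a) (Sum.inr b) ∧ d'.rel (Sum.inl b) (Sum.inr c)) := by
  have hbt : ∀ b b', d'.rel (Sum.inl b) (Sum.inl b') → d.rel (Sum.inr b) (Sum.inr b') := by
    intro b b' hb
    have : d'.top b b' := hb
    rw [← h] at this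
    exact this
  choose t ht using fun c => d'.exists_top (Sum.inr c)
  have key : ∀ x y, (d * d').rel x y → Sum.elim (fun a => Quotient.mk d.rel (Sum.inl a))
      (fun c => Quotient.mk d.rel (Sum.inr (t c))) x =
      Sum.elim (fun a => Quotient.mk d.rel (Sum.inl a))
      (fun c => Quotient.mk d.rel (Sum.inr (t c))) y := by
    intro x y hxy
    refine mul_lift _ (fun a => Quotient.mk d.rel (Sum.inr a)) _ ?_ ?_ hxy
    · intro x y hxy
      rcases x with a | a <;> rcases y with b | b <;> exact Quotient.sound hxy
    · intro x y hxy
      rcases x with a | a <;> rcases y with b | b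
      · exact Quotient.sound (hbt _ _ hxy)
      · exact Quotient.sound (hbt _ _ (Setoid.trans' _ hxy (ht b)))
      · exact Quotient.sound (hbt _ _ (Setoid.trans' _ (Setoid.symm' _ (ht a)) hxy))
      · exact Quotient.sound (hbt _ _
          (Setoid.trans' _ (Setoid.symm' _ (ht a)) (Setoid.trans' _ hxy (ht b))))
  refine ⟨fun a a' => ⟨fun h => Quotient.exact (key _ _ h), mul_top_top⟩,
    fun a c => ⟨fun h => ⟨t c, Quotient.exact (key _ _ h), Setoid.symm' _ (ht c)⟩, ?_⟩⟩
  rintro ⟨b, hb, hc⟩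
  exact mul_top_bot hb hc

theorem top_mul_of_eq {d d' : U k} (h : d.bot = d'.top) : (d * d').top = d.top := by
  ext a a'
  exact (mul_rel_of_eq h).1 a a'

theorem flip_top (d : U k) : d.flip.top = d.bot := rfl

theorem flip_bot (d : U k) : d.flip.bot = d.top := rfl

theorem bot_mul_of_eq {d d' : U k} (h : d.bot = d'.top) : (d * d').bot = d'.bot := by
  rw [← flip_top, flip_mul, top_mul_of_eq (by rw [flip_top, flip_bot, h]), flip_top]

theorem bot_le_mul (d d' : U k) : d'.bot ≤ (d * d').bot := fun _ _ h => mul_bot_bot h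

theorem e_top (π : Setoid (Fin k)) : (e π).top = π := by
  ext a a'
  exact Quotient.eq

theorem e_bot (π : Setoid (Fin k)) : (e π).bot = π := by
  ext a a'
  exact Quotient.eq

/-- A uniform block permutation is determined by its top set partition and the pairs `(a, b)`
with `a` and `b̄` in the same block. -/
theorem ext_top_bot {d d' : U k}
    (h : ∀ a b, d.rel (Sum.inl a) (Sum.inr b) ↔ d'.rel (Sum.inl a) (Sum.inr b)) : d = d' := by
  have aux : ∀ d d' : U k,
      (∀ a b, d.rel (Sum.inl a) (Sum.inr b) ↔ d'.rel (Sum.inl a) (Sum.inr b)) →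
      ∀ x y, d.rel x y → d'.rel x y := by
    intro d d' h x y hxy
    rcases x with a | a <;> rcases y with b | b
    · have h1 := (h a _).1 (d.dn_spec (Sum.inl a))
      have h2 := (h b _).1 (d.rel.trans' (d.rel.symm' hxy) (d.dn_spec (Sum.inl a)))
      exact d'.rel.trans' h1 (d'.rel.symm' h2)
    · exact (h a b).1 hxy
    · exact d'.rel.symm' ((h b a).1 (d.rel.symm' hxy))
    · obtain ⟨c, hc⟩ := d.exists_top (Sum.inr a)
      have h1 := (h c a).1 (d.rel.symm' hc)
      have h2 := (h c b).1 (d.rel.trans' (d.rel.symm' hc) hxy)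
      exact d'.rel.trans' (d'.rel.symm' h1) h2
  exact rel_ext_of_le (aux d d' h) (aux d' d fun a b => (h a b).symm)

theorem mul_flip (d : U k) : d * d.flip = e d.top := by
  apply ext_top_bot
  intro a c
  rw [(mul_rel_of_eq (flip_top d).symm).2]
  constructor
  · rintro ⟨b, hb, hc⟩
    exact Quotient.sound (d.rel.trans' hb hc)
  · intro h
    have h : d.rel (Sum.inl a) (Sum.inl c) := Quotient.exact (s := d.top) h
    exact ⟨d.dn (Sum.inl a), d.dn_spec _,
      d.rel.trans' (d.rel.symm' (d.dn_spec (Sum.inl a))) h⟩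

theorem flip_mul_self (d : U k) : d.flip * d = e d.bot := by
  have := mul_flip d.flip
  rwa [flip_flip] at this

end U

/-! ### Maximal subgroups and `L`-classes -/

/-- The maximal subgroup `G_{e_π}` of the monoid of uniform block permutations at `e_π`. -/
abbrev G (π : Setoid (Fin k)) : Type := {d : U k // d.top = π ∧ d.bot = π}

instance (π : Setoid (Fin k)) : Group (G π) where
  mul g h := ⟨g.1 * h.1, by rw [U.top_mul_of_eq (g.2.2.trans h.2.1.symm), g.2.1],
    by rw [U.bot_mul_of_eq (g.2.2.trans h.2.1.symm), h.2.2]⟩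
  one := ⟨U.e π, U.e_top π, U.e_bot π⟩
  inv g := ⟨g.1.flip, g.2.2, g.2.1⟩
  mul_assoc g h l := Subtype.ext (mul_assoc g.1 h.1 l.1)
  one_mul g := Subtype.ext (U.e_mul (le_of_eq g.2.1.symm))
  mul_one g := Subtype.ext (U.mul_e (le_of_eq g.2.2.symm))
  inv_mul_cancel g := Subtype.ext ((U.flip_mul_self g.1).trans (congrArg U.e g.2.2))

/-- The `L`-class `L_π` of `e_π`. -/
abbrev L (π : Setoid (Fin k)) : Type := {d : U k // d.bot = π}

/-- The vector space `ℂ L_π` with basis `L_π`. -/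
def CL (π : Setoid (Fin k)) : Type := L π →₀ ℂ

noncomputable instance (π : Setoid (Fin k)) : AddCommGroup (CL π) :=
  inferInstanceAs (AddCommGroup (L π →₀ ℂ))

noncomputable instance (π : Setoid (Fin k)) : Module ℂ (CL π) :=
  inferInstanceAs (Module ℂ (L π →₀ ℂ))

/-- The basis element of `ℂ L_π` given by an element of `L_π`. -/
noncomputable def CL.of {π : Setoid (Fin k)} (l : L π) : CL π :=
  (Finsupp.single l 1 : L π →₀ ℂ)

/-- The linear map out of `ℂ L_π` with given values on the basis `L_π`. -/
noncomputable def CL.lift {π : Setoid (Fin k)} {M : Type} [AddCommGroup M] [Module ℂ M]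
    (f : L π → M) : CL π →ₗ[ℂ] M :=
  (Finsupp.linearCombination ℂ f : (L π →₀ ℂ) →ₗ[ℂ] M)

theorem CL.lift_of {π : Setoid (Fin k)} {M : Type} [AddCommGroup M] [Module ℂ M] (f : L π → M)
    (l : L π) : CL.lift f (CL.of l) = f l :=
  (Finsupp.linearCombination_single ℂ (1 : ℂ) l).trans (one_smul ℂ (f l))

theorem CL.hom_ext {π : Setoid (Fin k)} {M : Type} [AddCommGroup M] [Module ℂ M]
    {f g : CL π →ₗ[ℂ] M} (h : ∀ l, f (CL.of l) = g (CL.of l)) : f = g :=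
  Finsupp.lhom_ext' (φ := (f : (L π →₀ ℂ) →ₗ[ℂ] M)) (ψ := (g : (L π →₀ ℂ) →ₗ[ℂ] M))
    fun l => LinearMap.ext_ring (h l)

/-- The right action of `G_{e_π}` on `L_π` by multiplication. -/
def L.mulRight {π : Setoid (Fin k)} (l : L π) (g : G π) : L π :=
  ⟨l.1 * g.1, by rw [U.bot_mul_of_eq (l.2.trans g.2.1.symm), g.2.2]⟩

theorem mul_mulRight_bot {π : Setoid (Fin k)} (m : U k) (l : L π) (g : G π) :
    (m * (l.mulRight g).1).bot = π ↔ (m * l.1).bot = π := by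
  have h0 : m * (l.mulRight g).1 = m * l.1 * g.1 := (mul_assoc m l.1 g.1).symm
  rw [h0]
  constructor
  · intro h
    have h1 : m * l.1 * g.1 * (g⁻¹ : G π).1 = m * l.1 := by
      have : g.1 * (g⁻¹ : G π).1 = U.e π := congrArg Subtype.val (mul_inv_cancel g)
      rw [mul_assoc (m * l.1), this, mul_assoc, U.mul_e (le_of_eq l.2.symm)]
    rw [← h1, U.bot_mul_of_eq (h.trans (g⁻¹).2.1.symm), (g⁻¹).2.2]
  · intro h
    rw [U.bot_mul_of_eq (h.trans g.2.1.symm), g.2.2]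

open Classical in
/-- `m ⊙ ℓ` in the left Schützenberger representation: the product `m ℓ` if it lies in `L_π`, and
zero otherwise. -/
noncomputable def odot {π : Setoid (Fin k)} (m : U k) (l : L π) : CL π :=
  if h : (m * l.1).bot = π then CL.of ⟨m * l.1, h⟩ else 0

/-- The left Schützenberger representation `ℂ L_π`. -/
noncomputable def schutzenberger (π : Setoid (Fin k)) : Representation ℂ (U k) (CL π) where
  toFun m := CL.lift (odot m)
  map_one' := by
    apply CL.hom_ext
    intro l
    have h : (1 * l.1).bot = π := by rw [one_mul, l.2]
    have h2 : (⟨1 * l.1, h⟩ : L π) = l := Subtype.ext (one_mul l.1)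
    rw [CL.lift_of, odot, dif_pos h, h2, Module.End.one_apply]
  map_mul' m m' := by
    apply CL.hom_ext
    intro l
    rw [CL.lift_of, Module.End.mul_apply, CL.lift_of]
    by_cases h : (m' * l.1).bot = π
    · by_cases h2 : (m * (m' * l.1)).bot = π
      · have h3 : (m * m' * l.1).bot = π := by rw [mul_assoc, h2]
        rw [odot, odot, dif_pos h, dif_pos h3, CL.lift_of, odot, dif_pos h2]
        congr 1
        exact Subtype.ext (mul_assoc m m' l.1)
      · have h3 : ¬ (m * m' * l.1).bot = π := by rwa [mul_assoc]
        rw [odot, odot, dif_pos h, dif_neg h3, CL.lift_of, odot, dif_neg h2]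
    · have h3 : ¬ (m * m' * l.1).bot = π := by
        intro h3
        apply h
        apply le_antisymm
        · rw [mul_assoc] at h3
          exact (U.bot_le_mul m (m' * l.1)).trans (le_of_eq h3)
        · exact (le_of_eq l.2.symm).trans (U.bot_le_mul m' l.1)
      rw [odot, odot, dif_neg h, dif_neg h3, map_zero]

/-- Right multiplication by `g` on `ℂ L_π`. -/
noncomputable def rightAct {π : Setoid (Fin k)} (g : G π) : CL π →ₗ[ℂ] CL π :=
  CL.lift fun l => CL.of (l.mulRight g)

theorem schutzenberger_rightAct {π : Setoid (Fin k)} (m : U k) (g : G π) (x : CL π) :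
    schutzenberger π m (rightAct g x) = rightAct g (schutzenberger π m x) := by
  have : schutzenberger π m ∘ₗ rightAct g = rightAct g ∘ₗ schutzenberger π m := by
    apply CL.hom_ext
    intro l
    change CL.lift (odot m) (CL.lift _ (CL.of l)) =
      CL.lift _ (CL.lift (odot m) (CL.of l))
    rw [CL.lift_of, CL.lift_of, CL.lift_of]
    by_cases h : (m * l.1).bot = π
    · have h2 := (mul_mulRight_bot m l g).2 h
      rw [odot, odot, dif_pos h, dif_pos h2, CL.lift_of]
      congr 1
      exact Subtype.ext (mul_assoc m l.1 g.1).symm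
    · have h2 := mt (mul_mulRight_bot m l g).1 h
      rw [odot, odot, dif_neg h, dif_neg h2, map_zero]
  exact LinearMap.congr_fun this x

/-! ### Blocks of set partitions -/

/-- The blocks of a set partition. -/
def Block (π : Setoid (Fin k)) : Type := Quotient π

noncomputable instance (π : Setoid (Fin k)) : DecidableEq (Block π) := Classical.decEq _

instance (π : Setoid (Fin k)) : Finite (Block π) := inferInstanceAs (Finite (Quotient π))

noncomputable instance (π : Setoid (Fin k)) : Fintype (Block π) := Fintype.ofFinite _

/-- The block of `π` containing `a`. -/
def Block.mk (π : Setoid (Fin k)) (a : Fin k) : Block π := Quotient.mk π a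

theorem Block.mk_eq {π : Setoid (Fin k)} {a b : Fin k} :
    Block.mk π a = Block.mk π b ↔ π a b := Quotient.eq

theorem Block.exists_mk {π : Setoid (Fin k)} (q : Block π) : ∃ a, Block.mk π a = q :=
  Quotient.exists_rep q

/-- A block as a subset of `[k]`. -/
noncomputable def Block.toFinset {π : Setoid (Fin k)} (q : Block π) : Finset (Fin k) :=
  Finset.univ.filter fun a => Block.mk π a = q

theorem Block.mem_toFinset {π : Setoid (Fin k)} {q : Block π} {a : Fin k} :
    a ∈ q.toFinset ↔ Block.mk π a = q := by simp [Block.toFinset]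

/-- The size of a block. -/
noncomputable def Block.size {π : Setoid (Fin k)} (q : Block π) : ℕ := q.toFinset.card

/-- The sort key of the graded last letter order on blocks: first the size, then the maximum. -/
noncomputable def Block.key {π : Setoid (Fin k)} (q : Block π) : ℕ ×ₗ WithBot (Fin k) :=
  toLex (q.size, q.toFinset.max)

theorem Block.eq_of_max {π : Setoid (Fin k)} {q q' : Block π}
    (h : q.toFinset.max = q'.toFinset.max) : q = q' := by
  obtain ⟨a, ha⟩ := q.exists_mk
  obtain ⟨m, hm⟩ := Finset.max_of_mem (Block.mem_toFinset.2 ha)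
  have h1 := Block.mem_toFinset.1 (Finset.mem_of_max hm)
  have h2 := Block.mem_toFinset.1 (Finset.mem_of_max (h ▸ hm))
  exact h1.symm.trans h2

theorem Block.key_injective {π : Setoid (Fin k)} : Function.Injective (Block.key (π := π)) :=
  fun _ _ h => Block.eq_of_max (congrArg (fun x => (ofLex x).2) h)

/-- The graded last letter order on the blocks of a set partition. -/
noncomputable instance (π : Setoid (Fin k)) : LinearOrder (Block π) :=
  LinearOrder.lift' Block.key Block.key_injective

/-- The type of a set partition: the multiset of the sizes of its blocks. -/
noncomputable def type (π : Setoid (Fin k)) : Multiset ℕ :=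
  (Finset.univ : Finset (Block π)).val.map Block.size

theorem card_block_eq {π γ : Setoid (Fin k)} (h : type γ = type π) :
    Fintype.card (Block γ) = Fintype.card (Block π) := by
  have := congrArg Multiset.card h
  simpa [type] using this

/-- The bijection sending the `j`-th block of `γ` to the `j`-th block of `π`, where the blocks are
listed in graded last letter order. -/
noncomputable def blockEquiv {γ π : Setoid (Fin k)} (h : type γ = type π) :
    Block γ ≃o Block π :=
  (monoEquivOfFin (Block γ) rfl).symm.trans (monoEquivOfFin (Block π) (card_block_eq h).symm)

theorem Block.size_mono {π : Setoid (Fin k)} : Monotone (Block.size (π := π)) := by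
  intro q q' h
  have h : q.key ≤ q'.key := h
  rcases (Prod.Lex.le_iff).1 h with h | h
  · exact h.le
  · exact h.1.le

theorem size_blockEquiv {γ π : Setoid (Fin k)} (h : type γ = type π) (q : Block γ) :
    (blockEquiv h q).size = q.size := by
  set f := monoEquivOfFin (Block γ) rfl with hf
  set g := monoEquivOfFin (Block π) (card_block_eq h).symm with hg
  have aux : ∀ (ρ : Setoid (Fin k)) (n : ℕ) (u : Fin n ≃o Block ρ),
      ((List.ofFn fun j => (u j).size : List ℕ) : Multiset ℕ) = type ρ := by
    intro ρ n u
    have h1 : (Finset.univ : Finset (Block ρ)).val =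
        (Finset.univ : Finset (Fin n)).val.map u := by
      rw [← Finset.map_univ_equiv u.toEquiv]
      rfl
    rw [type, h1, Multiset.map_map]
    simp [Fin.univ_def, List.ofFn_eq_map, Function.comp_def]
  have key : (List.ofFn fun j => (f j).size) = List.ofFn fun j => (g j).size := by
    apply List.Perm.eq_of_sortedLE
    · exact (Block.size_mono.comp f.monotone).sortedLE_ofFn
    · exact (Block.size_mono.comp g.monotone).sortedLE_ofFn
    · exact Multiset.coe_eq_coe.1 ((aux _ _ f).trans (h.trans (aux _ _ g).symm))
  have key2 := congrFun (List.ofFn_injective key) (f.symm q)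
  simpa [blockEquiv, hf, hg] using key2.symm

/-- The uniform block permutation given by a size preserving bijection from the blocks of `γ` to
the blocks of `π`. -/
def ofBlockEquiv {γ π : Setoid (Fin k)} (φ : Block γ ≃ Block π) (h : ∀ q, (φ q).size = q.size) :
    U k where
  rel := Setoid.ker (Sum.elim (fun a => φ (Block.mk γ a)) (Block.mk π))
  uniform := fun x => by
    simp only [Setoid.ker_def, Sum.elim_inl, Sum.elim_inr]
    generalize Sum.elim (fun a => φ (Block.mk γ a)) (Block.mk π) x = z
    have hz := h (φ.symm z)
    rw [Equiv.apply_symm_apply] at hz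
    simp only [Block.size, ← Set.ncard_coe_finset] at hz
    rw [show {b | z = Block.mk π b} = ↑z.toFinset by
        ext b
        simp [Block.mem_toFinset, eq_comm],
      hz]
    congr 1
    ext a
    simp [Block.mem_toFinset, Equiv.eq_symm_apply, eq_comm]

/-- The orbit representative `ℓ_π^γ`, which sends the `j`-th block of `γ` to the `j`-th block of
`π`. -/
noncomputable def ell {γ π : Setoid (Fin k)} (h : type γ = type π) : L π :=
  ⟨ofBlockEquiv (blockEquiv h).toEquiv (size_blockEquiv h), by
    ext a b
    exact Quotient.eq⟩

/-! ### The action of the maximal subgroup on blocks -/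

/-- The top row meets every block of `g` in one block of `π`. -/
noncomputable def topEquiv {π : Setoid (Fin k)} (g : G π) : Block π ≃ Quotient g.1.rel :=
  Equiv.ofBijective
    (Quotient.map Sum.inl fun a b (h : π a b) => by
      rw [← g.2.1] at h
      exact h) (by
      constructor
      · intro q q'
        induction q, q' using Quotient.inductionOn₂ with | _ a b
        intro h
        have h : g.1.top a b := Quotient.exact (s := g.1.rel) h
        rw [g.2.1] at h
        exact Quotient.sound h
      · intro q
        induction q using Quotient.inductionOn with | _ x
        obtain ⟨a, ha⟩ := g.1.exists_top x
        exact ⟨Block.mk π a, Quotient.sound (g.1.rel.symm' ha)⟩)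

/-- The bottom row meets every block of `g` in one block of `π`. -/
noncomputable def botEquiv {π : Setoid (Fin k)} (g : G π) : Block π ≃ Quotient g.1.rel :=
  Equiv.ofBijective
    (Quotient.map Sum.inr fun a b (h : π a b) => by
      rw [← g.2.2] at h
      exact h) (by
      constructor
      · intro q q'
        induction q, q' using Quotient.inductionOn₂ with | _ a b
        intro h
        have h : g.1.bot a b := Quotient.exact (s := g.1.rel) h
        rw [g.2.2] at h
        exact Quotient.sound h
      · intro q
        induction q using Quotient.inductionOn with | _ x
        obtain ⟨a, ha⟩ := g.1.exists_bot x
        exact ⟨Block.mk π a, Quotient.sound (g.1.rel.symm' ha)⟩)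

/-- The permutation of the blocks of `π` sending `d_i ∩ [k̄]` to `d_i ∩ [k]`.  The product of `G π`
is composition of bijections from top to bottom read from left to right, so it is this direction
that gives a left action. -/
noncomputable def blockPerm {π : Setoid (Fin k)} (g : G π) : Equiv.Perm (Block π) :=
  (botEquiv g).trans (topEquiv g).symm

theorem blockPerm_iff {π : Setoid (Fin k)} (g : G π) (a b : Fin k) :
    blockPerm g (Block.mk π b) = Block.mk π a ↔ g.1.rel (Sum.inl a) (Sum.inr b) := by
  rw [blockPerm, Equiv.trans_apply, Equiv.symm_apply_eq]
  constructor
  · intro h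
    exact g.1.rel.symm' (Quotient.exact h)
  · intro h
    exact Quotient.sound (g.1.rel.symm' h)

theorem blockPerm_one {π : Setoid (Fin k)} : blockPerm (1 : G π) = 1 := by
  ext q
  obtain ⟨b, rfl⟩ := q.exists_mk
  exact (blockPerm_iff 1 b b).2 rfl

theorem blockPerm_mul {π : Setoid (Fin k)} (g h : G π) :
    blockPerm (g * h) = blockPerm g * blockPerm h := by
  ext q
  obtain ⟨c, rfl⟩ := q.exists_mk
  obtain ⟨b, hb⟩ := (blockPerm h (Block.mk π c)).exists_mk
  obtain ⟨a, ha⟩ := (blockPerm g (Block.mk π b)).exists_mk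
  rw [Equiv.Perm.mul_apply, ← hb, ← ha, blockPerm_iff]
  exact U.mul_top_bot ((blockPerm_iff g a b).1 ha.symm) ((blockPerm_iff h b c).1 hb.symm)

theorem size_blockPerm {π : Setoid (Fin k)} (g : G π) (q : Block π) :
    (blockPerm g q).size = q.size := by
  obtain ⟨b, rfl⟩ := q.exists_mk
  obtain ⟨a, ha⟩ := (blockPerm g (Block.mk π b)).exists_mk
  have hab := (blockPerm_iff g a b).1 ha.symm
  rw [← ha]
  simp only [Block.size, ← Set.ncard_coe_finset]
  convert g.1.uniform (Sum.inl a) using 2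
  · ext c
    rw [Finset.mem_coe, Block.mem_toFinset, Block.mk_eq]
    have : π c a ↔ g.1.top c a := by rw [g.2.1]
    rw [this]
    exact ⟨fun h => Setoid.symm' _ h, fun h => Setoid.symm' _ h⟩
  · ext c
    rw [Finset.mem_coe, Block.mem_toFinset, Block.mk_eq]
    have : π c b ↔ g.1.bot c b := by rw [g.2.2]
    rw [this]
    exact ⟨fun h => Setoid.trans' _ hab (Setoid.symm' g.1.bot h),
      fun h => Setoid.symm' g.1.rel (Setoid.trans' g.1.rel (Setoid.symm' g.1.rel hab) h)⟩

/-- The set of blocks of `π` of size `n`. -/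
abbrev BlockOfSize (π : Setoid (Fin k)) (n : ℕ) : Type := {q : Block π // q.size = n}

/-- The action of `G_{e_π}` on the blocks of size `n`. -/
noncomputable def blockPermOfSize (π : Setoid (Fin k)) (n : ℕ) :
    G π →* Equiv.Perm (BlockOfSize π n) where
  toFun g := (blockPerm g).subtypePerm fun q => by rw [size_blockPerm]
  map_one' := by
    ext q
    simp [blockPerm_one]
  map_mul' g h := by
    ext q
    simp only [blockPerm_mul]
    rfl

/-! ### Specht modules -/

section SpechtModule

variable (μ : YoungDiagram) (B : Type)

/-- Tableaux of shape `μ` with entries the elements of `B`, each used once. -/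
abbrev Tableau : Type := ↥μ.cells ≃ B

/-- Row equivalence of tableaux: every entry lies in the same row of both. -/
def rowSetoid : Setoid (Tableau μ B) := Setoid.ker fun t (b : B) => (t.symm b).1.1

/-- Tabloids of shape `μ`. -/
def Tabloid : Type := Quotient (rowSetoid μ B)

variable {μ B}

/-- The tabloid of a tableau. -/
def Tabloid.mk (t : Tableau μ B) : Tabloid μ B := Quotient.mk _ t

theorem Tabloid.exists_mk (x : Tabloid μ B) : ∃ t, Tabloid.mk t = x := Quotient.exists_rep x

/-- Permuting the entries of a tabloid. -/
def Tabloid.permute (σ : Equiv.Perm B) : Tabloid μ B → Tabloid μ B :=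
  Quotient.map (fun t : Tableau μ B => (t.trans σ : Tableau μ B)) fun t t' h => by
    funext b
    exact congrFun h (σ.symm b)

variable (μ B)

theorem Tabloid.permute_mk {μ : YoungDiagram} {B : Type} (σ : Equiv.Perm B) (t : Tableau μ B) :
    Tabloid.permute σ (Tabloid.mk t) = Tabloid.mk (t.trans σ) := rfl

/-- The permutation module on tabloids. -/
noncomputable def tabloidRep : Representation ℂ (Equiv.Perm B) (Tabloid μ B →₀ ℂ) where
  toFun σ := Finsupp.lmapDomain ℂ ℂ (Tabloid.permute σ)
  map_one' := by
    ext t : 1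
    ext1
    obtain ⟨t, rfl⟩ := t.exists_mk
    simp only [LinearMap.coe_comp, Function.comp_apply, Finsupp.lsingle_apply,
      Finsupp.lmapDomain_apply, Finsupp.mapDomain_single, Module.End.one_apply, Tabloid.permute_mk]
    rfl
  map_mul' σ τ := by
    ext t : 1
    ext1
    obtain ⟨t, rfl⟩ := t.exists_mk
    simp only [LinearMap.coe_comp, Function.comp_apply, Finsupp.lsingle_apply,
      Finsupp.lmapDomain_apply, Finsupp.mapDomain_single, Module.End.mul_apply,
      Tabloid.permute_mk]
    rfl

variable {μ B}

/-- `σ` lies in the column stabilizer of `t`. -/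
def IsColumnPerm (t : Tableau μ B) (σ : Equiv.Perm B) : Prop :=
  ∀ b, (t.symm (σ b)).1.2 = (t.symm b).1.2

variable [Fintype B] [DecidableEq B]

open Classical in
/-- The polytabloid `e_t`, the signed sum of the tabloids `{σ t}` over the column stabilizer. -/
noncomputable def polytabloid (t : Tableau μ B) : Tabloid μ B →₀ ℂ :=
  ∑ σ : Equiv.Perm B with IsColumnPerm t σ,
    ((Equiv.Perm.sign σ : ℤ) : ℂ) • Finsupp.single (Tabloid.mk (t.trans σ)) 1

theorem tabloidRep_polytabloid (σ : Equiv.Perm B) (t : Tableau μ B) :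
    tabloidRep μ B σ (polytabloid t) = polytabloid (t.trans σ) := by
  classical
  rw [polytabloid, polytabloid, map_sum]
  refine Finset.sum_equiv (MulAut.conj σ).toEquiv (fun τ => ?_) (fun τ _ => ?_)
  · rw [Finset.mem_filter, Finset.mem_filter]
    simp only [Finset.mem_univ, true_and, IsColumnPerm]
    constructor
    · intro h b
      simpa using h (σ.symm b)
    · intro h b
      simpa using h (σ b)
  · rw [map_smul]
    congr 1
    · have : Equiv.Perm.sign ((MulAut.conj σ).toEquiv τ) = Equiv.Perm.sign τ := by
        simp [mul_comm (Equiv.Perm.sign σ), mul_assoc]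
      rw [this]
    · simp only [tabloidRep, MonoidHom.coe_mk, OneHom.coe_mk, Finsupp.lmapDomain_apply,
        Finsupp.mapDomain_single]
      congr 1
      change Tabloid.mk ((t.trans τ).trans σ) = _
      congr 1
      ext c
      simp

variable (μ B)

/-- The Specht module, as a submodule of the permutation module on tabloids: the span of the
polytabloids. -/
noncomputable def spechtSubmodule : Submodule ℂ (Tabloid μ B →₀ ℂ) :=
  Submodule.span ℂ (Set.range polytabloid)

/-- The Specht module as a type. -/
def Specht : Type := ↥(spechtSubmodule μ B)

noncomputable instance : AddCommGroup (Specht μ B) :=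
  inferInstanceAs (AddCommGroup ↥(spechtSubmodule μ B))

noncomputable instance : Module ℂ (Specht μ B) :=
  inferInstanceAs (Module ℂ ↥(spechtSubmodule μ B))

/-- The irreducible representation of the permutation group of `B` indexed by `μ`. -/
noncomputable def spechtRep : Representation ℂ (Equiv.Perm B) (Specht μ B) :=
  (tabloidRep μ B).subrepresentation (spechtSubmodule μ B) fun σ => by
    rw [spechtSubmodule, Submodule.span_le]
    rintro _ ⟨t, rfl⟩
    rw [SetLike.mem_coe, Submodule.mem_comap, tabloidRep_polytabloid]
    exact Submodule.subset_span ⟨_, rfl⟩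

variable {μ B}

/-- The element of the Specht module given by a tableau. -/
noncomputable def spechtVec (t : Tableau μ B) : Specht μ B :=
  (⟨polytabloid t, Submodule.subset_span ⟨t, rfl⟩⟩ : ↥(spechtSubmodule μ B))

/-- A tableau filled with subsets of `[k]` is standard if it is increasing along rows and columns
for the last letter order, which compares the maxima. -/
def IsStandard (t : ↥μ.cells → Finset (Fin k)) : Prop :=
  (∀ c c' : ↥μ.cells, c.1.1 = c'.1.1 → c.1.2 < c'.1.2 → (t c).max < (t c').max) ∧
  (∀ c c' : ↥μ.cells, c.1.2 = c'.1.2 → c.1.1 < c'.1.1 → (t c).max < (t c').max)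

end SpechtModule

/-! ### The representations `V` and `W` -/

/-- The index set `I_k`: the sequences `(λ^(1), …, λ^(k))` of partitions with
`∑ i |λ^(i)| = k`.  The partition `λ^(i)` has index `i - 1 : Fin k`. -/
@[ext]
structure Index (k : ℕ) where
  part : Fin k → YoungDiagram
  sum_eq : ∑ i : Fin k, ((i : ℕ) + 1) * (part i).card = k

/-- The sizes of the blocks of `π_λ` in increasing order: `|λ^(1)|` times `1`, `|λ^(2)|` times `2`,
and so on.  As a multiset this is the partition `(1^{a_1} 2^{a_2} ⋯)` with `a_i = |λ^(i)|`. -/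
def Index.sizes (lam : Index k) : List ℕ :=
  (List.finRange k).flatMap fun i => List.replicate (lam.part i).card ((i : ℕ) + 1)

/-- The composition of `k` into consecutive intervals of these sizes. -/
def Index.composition (lam : Index k) : Composition k where
  blocks := lam.sizes
  blocks_pos := by
    intro i hi
    simp only [Index.sizes, List.mem_flatMap, List.mem_replicate] at hi
    obtain ⟨j, _, _, rfl⟩ := hi
    omega
  blocks_sum := by
    have h := lam.sum_eq
    rw [Fin.sum_univ_def] at h
    simp only [Index.sizes, List.flatMap, List.sum_flatten, List.map_map, Function.comp_def,
      List.sum_replicate, smul_eq_mul]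
    simpa [mul_comm] using h

/-- The representative set partition `π_λ`, whose blocks are consecutive intervals, first the
blocks of size `1`, then those of size `2`, and so on. -/
def Index.pi (lam : Index k) : Setoid (Fin k) := Setoid.ker lam.composition.index

/-- The partition `(1^{a_1} 2^{a_2} ⋯ k^{a_k})` with `a_i = |λ^(i)|`, as a multiset. -/
def Index.type (lam : Index k) : Multiset ℕ := lam.sizes

/-- The set partition `π_λ` has type `λ`. -/
theorem Index.type_pi (lam : Index k) : UBP.type lam.pi = lam.type := by
  classical
  set c := lam.composition with hc
  have hmk : ∀ a b, Block.mk lam.pi a = Block.mk lam.pi b ↔ c.index a = c.index b :=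
    fun a b => Block.mk_eq
  let u : Fin c.length → Block lam.pi := fun i =>
    Block.mk lam.pi (c.embedding i ⟨0, c.blocks_pos' i i.2⟩)
  have hu : ∀ a i, Block.mk lam.pi a = u i ↔ c.index a = i := by
    intro a i
    rw [hmk, Composition.index_embedding]
  have hbij : Function.Bijective u := by
    constructor
    · intro i j hij
      have := (hu _ j).1 hij
      rwa [Composition.index_embedding] at this
    · intro q
      obtain ⟨a, rfl⟩ := q.exists_mk
      exact ⟨c.index a, ((hu a _).2 rfl).symm⟩
  have hsize : ∀ i, (u i).size = c.blocksFun i := by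
    intro i
    have : (u i).toFinset = Finset.univ.map (c.embedding i).toEmbedding := by
      ext a
      rw [Block.mem_toFinset, hu, eq_comm, ← Composition.mem_range_embedding_iff']
      simp
    rw [Block.size, this, Finset.card_map, Finset.card_univ, Fintype.card_fin]
  have h1 : (Finset.univ : Finset (Block lam.pi)).val =
      (Finset.univ : Finset (Fin c.length)).val.map u := by
    rw [← Finset.map_univ_equiv (Equiv.ofBijective u hbij)]
    rfl
  rw [UBP.type, h1, Multiset.map_map]
  have h2 : (Block.size ∘ u) = c.blocksFun := funext hsize
  rw [h2]
  change _ = ((c.blocks : List ℕ) : Multiset ℕ)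
  rw [← c.ofFn_blocksFun]
  simp [Fin.univ_def, List.ofFn_eq_map]

/-- The representation `V^λ` of `G_{e_π}`: the tensor product over `i` of the irreducible
representations, indexed by `λ^(i)`, of the permutation groups of the blocks of size `i`. -/
noncomputable def V (π : Setoid (Fin k)) (lam : Index k) : Representation ℂ (G π)
    (⨂[ℂ] i : Fin k, Specht (lam.part i) (BlockOfSize π ((i : ℕ) + 1))) where
  toFun g := PiTensorProduct.map fun i =>
    spechtRep (lam.part i) (BlockOfSize π ((i : ℕ) + 1)) (blockPermOfSize π ((i : ℕ) + 1) g)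
  map_one' := by
    simp only [map_one]
    exact PiTensorProduct.map_one
  map_mul' g h := by
    simp only [map_mul]
    exact PiTensorProduct.map_mul _ _

/-- The underlying space of `V^λ`, for `π = π_λ`. -/
abbrev VSpace (lam : Index k) : Type :=
  ⨂[ℂ] i : Fin k, Specht (lam.part i) (BlockOfSize lam.pi ((i : ℕ) + 1))

/-- The relations `ℓ g ⊗ v = ℓ ⊗ g v` that turn the tensor product over `ℂ` into the tensor
product over the group algebra of `G_λ`. -/
noncomputable def balanced (lam : Index k) : Submodule ℂ (CL lam.pi ⊗[ℂ] VSpace lam) :=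
  Submodule.span ℂ {z | ∃ (x : CL lam.pi) (g : G lam.pi) (v : VSpace lam),
    z = rightAct g x ⊗ₜ[ℂ] v - x ⊗ₜ[ℂ] V lam.pi lam g v}

/-- The space `W^λ = ℂ L_λ ⊗_{ℂ G_λ} V^λ`. -/
abbrev WSpace (lam : Index k) : Type :=
  (CL lam.pi ⊗[ℂ] VSpace lam) ⧸ balanced lam

/-- The representation `W^λ`, with `d · (ℓ ⊗ v) = (d ⊙ ℓ) ⊗ v`. -/
noncomputable def W (lam : Index k) : Representation ℂ (U k) (WSpace lam) :=
  ((schutzenberger lam.pi).tprod (Representation.trivial ℂ (U k) (VSpace lam))).quotient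
    (balanced lam) fun m => by
      rw [balanced, Submodule.span_le]
      rintro _ ⟨x, g, v, rfl⟩
      rw [SetLike.mem_coe, Submodule.mem_comap, map_sub, Representation.tprod_apply,
        TensorProduct.map_tmul, TensorProduct.map_tmul, schutzenberger_rightAct]
      exact Submodule.subset_span ⟨_, g, v, rfl⟩

/-- The element `x ⊗ v` of `W^λ`. -/
noncomputable def W.tmul {lam : Index k} (x : CL lam.pi) (v : VSpace lam) : WSpace lam :=
  Submodule.Quotient.mk (x ⊗ₜ[ℂ] v)

/-- A `π`-tableau of shape `λ`: a sequence of standard tableaux `T^(i)` of shape `λ^(i)` filled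
with the blocks of `π` of size `i`. -/
@[ext]
structure PiTableau (π : Setoid (Fin k)) (lam : Index k) where
  tab : ∀ i : Fin k, Tableau (lam.part i) (BlockOfSize π ((i : ℕ) + 1))
  standard : ∀ i, IsStandard fun c => (tab i c).1.toFinset

/-- The element of `V^λ` given by a `π_λ`-tableau. -/
noncomputable def PiTableau.vec {lam : Index k} (T : PiTableau lam.pi lam) : VSpace lam :=
  ⨂ₜ[ℂ] i, spechtVec (T.tab i)

/-! ### Uniform tableaux and Garnir straightening -/

/-- Sequences of tableaux `S^(i)` of shape `λ^(i)` filled with subsets of `[k]` of size `i`, such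
that the entries form a set partition of `[k]`. -/
@[ext]
structure Filling (lam : Index k) where
  entry : ∀ i : Fin k, ↥(lam.part i).cells → Finset (Fin k)
  card_entry : ∀ i c, (entry i c).card = (i : ℕ) + 1
  partition : ∀ a : Fin k, ∃! p : Σ i : Fin k, ↥(lam.part i).cells, a ∈ entry p.1 p.2

/-- Uniform tableaux of shape `λ`. -/
def UniformTableau (lam : Index k) : Type :=
  {S : Filling lam // ∀ i, IsStandard (S.entry i)}

/-- Replacing every letter `a` in `S` by `σ(a)`. -/
def Filling.relabel {lam : Index k} (σ : Equiv.Perm (Fin k)) (S : Filling lam) : Filling lam where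
  entry i c := (S.entry i c).map σ.toEmbedding
  card_entry i c := by rw [Finset.card_map, S.card_entry]
  partition a := by
    obtain ⟨p, hp, hu⟩ := S.partition (σ.symm a)
    refine ⟨p, by simpa [Finset.mem_map_equiv] using hp, fun q hq => hu q ?_⟩
    simpa [Finset.mem_map_equiv] using hq

/-- Permuting the cells of `S^(i)` by `σ`. -/
def Filling.permCells {lam : Index k} (S : Filling lam) (i : Fin k)
    (σ : Equiv.Perm ↥(lam.part i).cells) : Filling lam where
  entry j c := S.entry j ((Pi.mulSingle i σ : ∀ j, Equiv.Perm ↥(lam.part j).cells) j c)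
  card_entry j c := S.card_entry j _
  partition a := by
    set τ : ∀ j, Equiv.Perm ↥(lam.part j).cells := Pi.mulSingle i σ
    obtain ⟨p, hp, hu⟩ := S.partition a
    refine ⟨⟨p.1, (τ p.1).symm p.2⟩, by simpa using hp, ?_⟩
    rintro ⟨j, c⟩ hq
    have := hu ⟨j, τ j c⟩ hq
    subst this
    simp

/-- `X` is a transversal of the left cosets of `𝔖_A × 𝔖_B` in `𝔖_{A ∪ B}`, for disjoint sets `A`
and `B`. -/
def IsTransversal {C : Type} (A B : Set C) (X : Finset (Equiv.Perm C)) : Prop :=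
  (∀ σ ∈ X, ∀ c, c ∉ A ∪ B → σ c = c) ∧
  ∀ τ : Equiv.Perm C, (∀ c, c ∉ A ∪ B → τ c = c) →
    ∃! σ, σ ∈ X ∧ (∀ c, (σ⁻¹ * τ) c ∈ A ↔ c ∈ A) ∧ (∀ c, (σ⁻¹ * τ) c ∈ B ↔ c ∈ B)

/-- The column relations: permuting the entries of the columns of one tableau multiplies by the
sign. -/
def columnRelations (lam : Index k) : Set (Filling lam →₀ ℂ) :=
  {z | ∃ (S : Filling lam) (i : Fin k) (σ : Equiv.Perm ↥(lam.part i).cells),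
    (∀ c, (σ c).1.2 = c.1.2) ∧
    z = Finsupp.single (S.permCells i σ) 1 -
      ((Equiv.Perm.sign σ : ℤ) : ℂ) • Finsupp.single S 1}

/-- The Garnir relations: `A` and `B` are sets of cells of the adjacent columns `j` and `j + 1` of
one tableau with `|A ∪ B|` larger than the length of column `j`, and the signed sum over a
transversal of the cosets of `𝔖_A × 𝔖_B` in `𝔖_{A ∪ B}` is zero. -/
def garnirRelations (lam : Index k) : Set (Filling lam →₀ ℂ) :=
  {z | ∃ (S : Filling lam) (i : Fin k) (j : ℕ) (A B : Finset ↥(lam.part i).cells)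
      (X : Finset (Equiv.Perm ↥(lam.part i).cells)),
    (∀ c ∈ A, c.1.2 = j) ∧ (∀ c ∈ B, c.1.2 = j + 1) ∧
    (lam.part i).colLen j < A.card + B.card ∧ IsTransversal (A : Set _) (B : Set _) X ∧
    z = ∑ σ ∈ X, ((Equiv.Perm.sign σ : ℤ) : ℂ) • Finsupp.single (S.permCells i σ) 1}

/-- The linear combination `x` of uniform tableaux is obtained from the sequence of tableaux `S` by
Garnir straightening: `S` and `x` agree modulo column relations and Garnir relations. -/
def IsStraightening {lam : Index k} (S : Filling lam) (x : UniformTableau lam →₀ ℂ) : Prop :=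
  Finsupp.single S 1 - Finsupp.mapDomain Subtype.val x ∈
    Submodule.span ℂ (columnRelations lam ∪ garnirRelations lam)

/-- The sequence of tableaux obtained from a `π`-tableau by replacing the `j`-th block of `π` by the
`j`-th block of `γ`, for all `j`. -/
noncomputable def PiTableau.replace {π γ : Setoid (Fin k)} {lam : Index k} (T : PiTableau π lam)
    (h : UBP.type γ = UBP.type π) : ∀ i : Fin k, ↥(lam.part i).cells → Finset (Fin k) :=
  fun i c => ((blockEquiv h).symm (T.tab i c).1).toFinset

/-- `θ` is the action on formal linear combinations of uniform tableaux in which `b_i` fixes `S` if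
`i` and `i + 1` lie in the same cell of `S` and kills it otherwise, and `s_i` exchanges `i` and
`i + 1` in `S` and applies Garnir straightening. -/
def IsTableauAction {lam : Index k}
    (θ : Representation ℂ (U k) (UniformTableau lam →₀ ℂ)) : Prop :=
  ∀ (i : ℕ) (hi : i + 1 < k) (S : UniformTableau lam),
    ((∃ j c, (⟨i, by omega⟩ : Fin k) ∈ S.1.entry j c ∧ ⟨i + 1, hi⟩ ∈ S.1.entry j c) →
      θ (U.b i hi) (Finsupp.single S 1) = Finsupp.single S 1) ∧
    ((¬ ∃ j c, (⟨i, by omega⟩ : Fin k) ∈ S.1.entry j c ∧ ⟨i + 1, hi⟩ ∈ S.1.entry j c) →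
      θ (U.b i hi) (Finsupp.single S 1) = 0) ∧
    IsStraightening (S.1.relabel (Equiv.swap ⟨i, by omega⟩ ⟨i + 1, hi⟩))
      (θ (U.s i hi) (Finsupp.single S 1))

end UBP

namespace UBP

variable {k : ℕ}

/-! ### The Garnir straightening algorithm -/

section Straightening

/-! Right multiplication makes L_λ a free G_λ-set whose orbits are the fibres of the top set
partition (`L.mulRight_injective`, `L.exists_mulRight_eq`). Hence W^λ is the direct sum, over the
set partitions γ of type λ, of the copies ℓ_π^γ ⊗ V^λ of V^λ (`W.componentsEquiv`), and any basis of
V^λ gives one of W^λ. The standard polytabloids provide it: they span by straightening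
(`mem_span_standard`) and are independent because they are unitriangular in the tabloids
(`linearIndependent_spechtVec`).

For irreducibility, the reflection of ℓ_π^γ in a horizontal line kills every summand except the one
of γ, which it carries to e_π ⊗ V^λ (`W_flip_ell`). So a nonzero subrepresentation meets e_π ⊗ V^λ
in a nonzero G_λ-stable subspace. Since V^λ has no proper one (`V_submodule_eq_top`), the
subrepresentation contains e_π ⊗ V^λ, and acting by the elements of L_λ it reaches all of W^λ. The
irreducibility of V^λ is the classical argument for Specht modules: the column antisymmetrizer of t
has rank one, with image spanned by the polytabloid of t (`spechtAntisymm_apply`), and no nonzero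
vector is killed by all of them. Since G_λ maps onto the product of the symmetric groups, this
passes to the tensor product.

A filling is the same as an element of L_λ together with a sequence of tableaux filled with blocks
of π_λ, up to the action of G_λ, so it defines a vector of W^λ (`fillVec_fill`). This assignment
kills the column and Garnir relations (`relationSpan_le_ker`) and sends the uniform tableaux
bijectively to the basis above. As the uniform tableaux span modulo the relations, the coordinates
of this vector are the one and only straightening (`isStraightening_iff`). The action on uniform
tableaux is that of W^λ in this basis: s_i relabels the letters, and b_i fixes or kills. It is
unique because the s_i and b_i generate the monoid (`U.closure_generators`). -/

theorem exists_isTransversal {C : Type} [Finite C] (A B : Set C) :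
    ∃ X : Finset (Equiv.Perm C), IsTransversal A B X := by
  classical
  have := Fintype.ofFinite C
  -- Two permutations are related when they lie in the same left coset of the stabilizer of `A` and
  -- `B`; the transversal consists of chosen representatives.
  let r : Setoid {τ : Equiv.Perm C // ∀ c, c ∉ A ∪ B → τ c = c} :=
    { r := fun σ τ => (∀ c, (σ.1⁻¹ * τ.1) c ∈ A ↔ c ∈ A) ∧ (∀ c, (σ.1⁻¹ * τ.1) c ∈ B ↔ c ∈ B)
      iseqv :=
        { refl := fun σ => by simp
          symm := by
            intro σ τ h
            refine ⟨fun c => ?_, fun c => ?_⟩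
            · have := h.1 ((τ.1⁻¹ * σ.1) c)
              simpa using this.symm
            · have := h.2 ((τ.1⁻¹ * σ.1) c)
              simpa using this.symm
          trans := by
            intro σ τ ρ h h'
            refine ⟨fun c => ?_, fun c => ?_⟩
            · have := h.1 ((τ.1⁻¹ * ρ.1) c)
              rw [h'.1 c] at this
              simpa using this
            · have := h.2 ((τ.1⁻¹ * ρ.1) c)
              rw [h'.2 c] at this
              simpa using this } }
  refine ⟨Finset.univ.image fun q : Quotient r => q.out.1, ?_, ?_⟩
  · intro σ hσ
    obtain ⟨q, -, rfl⟩ := Finset.mem_image.1 hσ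
    exact q.out.2
  · intro τ hτ
    have h0 : r (Quotient.mk r ⟨τ, hτ⟩).out ⟨τ, hτ⟩ := Quotient.mk_out _
    refine ⟨(Quotient.mk r ⟨τ, hτ⟩).out.1, ⟨Finset.mem_image_of_mem _ (Finset.mem_univ _), h0⟩, ?_⟩
    rintro σ ⟨hσ, h1, h2⟩
    obtain ⟨q, -, rfl⟩ := Finset.mem_image.1 hσ
    have : q = Quotient.mk r ⟨τ, hτ⟩ := by
      rw [← Quotient.out_eq q]
      exact Quotient.sound ⟨h1, h2⟩
    rw [this]

/-- This is the rearrangement inequality for one transposition: the difference of the sums is `(w b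
- w a) * (f a - f b)`. -/
theorem sum_mul_swap_lt {C : Type} [Fintype C] [DecidableEq C] (w f : C → ℕ) {a b : C}
    (hw : w a < w b) (hf : f b < f a) :
    ∑ c, w c * f c < ∑ c, w c * f (Equiv.swap a b c) := by
  have hab : a ≠ b := by
    rintro rfl
    exact lt_irrefl _ hw
  zify
  rw [← sub_pos, ← Finset.sum_sub_distrib, Fintype.sum_eq_add a b hab]
  · rw [Equiv.swap_apply_left, Equiv.swap_apply_right]
    zify at hw hf
    nlinarith
  · rintro c ⟨h1, h2⟩
    rw [Equiv.swap_apply_of_ne_of_ne h1 h2, sub_self]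

/-- Exchanging small entries of `B` with large entries of `A` increases the sum over `B`. -/
theorem sum_lt_sum_of_exchange {C : Type} [Fintype C] [DecidableEq C] {A B : Finset C}
    (x : Equiv.Perm C) (hx : ∀ c, c ∉ A ∪ B → x c = c) (f : C → ℤ) (v : ℤ)
    (hA : ∀ c ∈ A, v < f c) (hB : ∀ c ∈ B, f c ≤ v) (hne : ∃ c ∈ B, x c ∉ B) :
    ∑ c ∈ B, f c < ∑ c ∈ B, f (x c) := by
  have hmem : ∀ c ∈ B, x c ∉ B → x c ∈ A := by
    intro c hc hxc
    by_contra hA'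
    have : x (x c) = x c := hx _ (by simp [hA', hxc])
    exact hxc (by rwa [x.injective this])
  have h1 : ∑ c ∈ B, f (x c) = ∑ c ∈ B.map x.toEmbedding, f c := by
    rw [Finset.sum_map]; rfl
  -- After subtracting `v` the terms on `B` are nonpositive and those on `A` positive. Passing from
  -- `B` to its image under `x` drops nonpositive terms and gains at least one positive term. The
  -- two sets have equal size, so the shift by `v` cancels in the end.
  have h2 : ∑ c ∈ B, (f c - v) < ∑ c ∈ B.map x.toEmbedding, (f c - v) := by
    rw [← Finset.sum_ite_mem_eq, ← Finset.sum_ite_mem_eq (s := B.map _)]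
    have hxB : ∀ b, b ∈ B.map x.toEmbedding → b ∉ B → v < f b := by
      intro b hb hb'
      obtain ⟨c, hc, rfl⟩ := Finset.mem_map.1 hb
      exact hA _ (hmem c hc hb')
    obtain ⟨c, hc, hxc⟩ := hne
    apply Finset.sum_lt_sum
    · intro b _
      by_cases h : b ∈ B <;> by_cases h' : b ∈ B.map x.toEmbedding
      · simp only [h, h', if_true, le_refl]
      · simp only [h, h', if_true, if_false]
        linarith [hB b h]
      · simp only [h, h', if_true, if_false]
        linarith [hxB b h' h]
      · simp only [h, h', if_false, le_refl]
    · refine ⟨x c, Finset.mem_univ _, ?_⟩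
      have h' : x c ∈ B.map x.toEmbedding := Finset.mem_map_of_mem _ hc
      simp only [hxc, h', if_true, if_false]
      linarith [hxB _ h' hxc]
  rw [Finset.sum_sub_distrib, Finset.sum_sub_distrib] at h2
  simp only [Finset.sum_const, Finset.card_map] at h2
  rw [h1]
  linarith

variable {μ : YoungDiagram}

/-- The keys increase along rows and columns. -/
def IsStandardKey {α : Type*} [LT α] (f : ↥μ.cells → α) : Prop :=
  (∀ c c' : ↥μ.cells, c.1.1 = c'.1.1 → c.1.2 < c'.1.2 → f c < f c') ∧
  (∀ c c' : ↥μ.cells, c.1.2 = c'.1.2 → c.1.1 < c'.1.1 → f c < f c')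

theorem row_lt_of_adjacent (f : ↥μ.cells → ℕ)
    (h : ∀ c c' : ↥μ.cells, c.1.1 = c'.1.1 → c.1.2 + 1 = c'.1.2 → f c < f c') :
    ∀ c c' : ↥μ.cells, c.1.1 = c'.1.1 → c.1.2 < c'.1.2 → f c < f c' := by
  rintro ⟨⟨r, j⟩, hc⟩ ⟨⟨r', j'⟩, hc'⟩ hr hj
  obtain rfl : r = r' := hr
  change j < j' at hj
  induction j', hj using Nat.le_induction with
  | base => exact h _ _ rfl rfl
  | succ n hn ih =>
    have hm : (r, n) ∈ μ.cells := μ.up_left_mem le_rfl (Nat.le_succ n) hc'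
    exact (ih hm).trans (h ⟨_, hm⟩ ⟨_, hc'⟩ rfl rfl)

/-- The sets of cells of the Garnir relation at a cell `c`. -/
theorem colLen_lt_card_add_card (c : ↥μ.cells) (c' : ↥μ.cells) (hr : c.1.1 = c'.1.1) :
    μ.colLen c.1.2 <
      (Finset.univ.filter fun a : ↥μ.cells => a.1.2 = c.1.2 ∧ c.1.1 ≤ a.1.1).card +
      (Finset.univ.filter fun a : ↥μ.cells => a.1.2 = c'.1.2 ∧ a.1.1 ≤ c'.1.1).card := by
  have h1 : Finset.Ico c.1.1 (μ.colLen c.1.2) ⊆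
      (Finset.univ.filter fun a : ↥μ.cells => a.1.2 = c.1.2 ∧ c.1.1 ≤ a.1.1).image
        fun a => a.1.1 := by
    intro n hn
    rw [Finset.mem_Ico, ← YoungDiagram.mem_iff_lt_colLen] at hn
    exact Finset.mem_image.2 ⟨⟨(n, c.1.2), hn.2⟩, by simpa using hn.1, rfl⟩
  have h2 : Finset.range (c'.1.1 + 1) ⊆
      (Finset.univ.filter fun a : ↥μ.cells => a.1.2 = c'.1.2 ∧ a.1.1 ≤ c'.1.1).image
        fun a => a.1.1 := by
    intro n hn
    have hn' : n ≤ c'.1.1 := by simpa [Nat.lt_succ_iff] using hn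
    have hm : (n, c'.1.2) ∈ μ.cells := μ.up_left_mem hn' le_rfl c'.2
    exact Finset.mem_image.2 ⟨⟨_, hm⟩, by simpa using hn', rfl⟩
  have h3 := (Finset.card_le_card h1).trans Finset.card_image_le
  have h4 := (Finset.card_le_card h2).trans Finset.card_image_le
  rw [Nat.card_Ico] at h3
  rw [Finset.card_range] at h4
  have h5 : c.1.1 < μ.colLen c.1.2 := YoungDiagram.mem_iff_lt_colLen.1 c.2
  omega

/-- The order in which straightening proceeds: first the sum of `column * entry`, then the sum of
`row * entry`. -/
def weight (key : ↥μ.cells → ℕ) (σ : Equiv.Perm ↥μ.cells) : ℕ ×ₗ ℕ :=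
  toLex (∑ c, c.1.2 * key (σ c), ∑ c, c.1.1 * key (σ c))

/-- An exchange within a column leaves the first sum unchanged, because it only permutes cells of
equal column index. The second sum decides, and it grows by the rearrangement inequality. -/
theorem weight_lt_of_column (key : ↥μ.cells → ℕ) (σ : Equiv.Perm ↥μ.cells) {c c' : ↥μ.cells}
    (hcol : c.1.2 = c'.1.2) (hrow : c.1.1 < c'.1.1) (h : key (σ c') < key (σ c)) :
    weight key σ < weight key (σ * Equiv.swap c c') := by
  rw [weight, weight, Prod.Lex.toLex_lt_toLex]
  refine Or.inr ⟨?_, sum_mul_swap_lt (fun a : ↥μ.cells => a.1.1) (fun a => key (σ a)) hrow h⟩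
  have : ∀ a, (Equiv.swap c c' a).1.2 = a.1.2 := by
    intro a
    rw [Equiv.swap_apply_def]
    split_ifs with h1 h2
    · rw [h1, hcol]
    · rw [h2, hcol]
    · rfl
  rw [← Equiv.sum_comp (Equiv.swap c c')]
  simp [this]

/-- On `A ∪ B` the column index is `j` plus the indicator of `B`, and `x` keeps the total of the
keys. So the first sum changes exactly as the sum of the keys over `B`, which grows because small
entries leave `B` and large ones enter. -/
theorem weight_lt_of_garnir (key : ↥μ.cells → ℕ) (σ x : Equiv.Perm ↥μ.cells)
    {A B : Finset ↥μ.cells} {j v : ℕ} (hA : ∀ c ∈ A, c.1.2 = j) (hB : ∀ c ∈ B, c.1.2 = j + 1)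
    (hx : ∀ c, c ∉ A ∪ B → x c = c) (hvA : ∀ c ∈ A, v < key (σ c)) (hvB : ∀ c ∈ B, key (σ c) ≤ v)
    (hne : ∃ c ∈ B, x c ∉ B) :
    weight key σ < weight key (σ * x) := by
  rw [weight, weight, Prod.Lex.toLex_lt_toLex]
  refine Or.inl ?_
  have h1 := sum_lt_sum_of_exchange x hx (fun c => (key (σ c) : ℤ)) v
    (fun c hc => by exact_mod_cast hvA c hc) (fun c hc => by exact_mod_cast hvB c hc) hne
  have h2 : ∑ c, (key (σ (x c)) : ℤ) = ∑ c, (key (σ c) : ℤ) :=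
    Equiv.sum_comp x fun c => (key (σ c) : ℤ)
  have h3 : ∀ c : ↥μ.cells, (c.1.2 : ℤ) * ((key (σ (x c)) : ℤ) - key (σ c)) =
      j * ((key (σ (x c)) : ℤ) - key (σ c)) +
        if c ∈ B then ((key (σ (x c)) : ℤ) - key (σ c)) else 0 := by
    intro c
    by_cases hcB : c ∈ B
    · rw [hB c hcB, if_pos hcB]
      push_cast
      ring
    · rw [if_neg hcB, add_zero]
      by_cases hcA : c ∈ A
      · rw [hA c hcA]
      · rw [hx c (by simp [hcA, hcB]), sub_self, mul_zero, mul_zero]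
  change ∑ c : ↥μ.cells, c.1.2 * key (σ c) < ∑ c : ↥μ.cells, c.1.2 * key (σ (x c))
  zify
  rw [← sub_pos, ← Finset.sum_sub_distrib]
  simp only [← mul_sub]
  rw [Finset.sum_congr rfl fun c _ => h3 c, Finset.sum_add_distrib, ← Finset.mul_sum,
    Finset.sum_sub_distrib, h2, sub_self, mul_zero, zero_add, Finset.sum_ite_mem_eq,
    Finset.sum_sub_distrib]
  exact sub_pos.2 h1

theorem sign_smul_sign_smul {C M : Type*} [Fintype C] [DecidableEq C] [AddCommGroup M]
    [Module ℂ M] (σ : Equiv.Perm C) (m : M) :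
    ((Equiv.Perm.sign σ : ℤ) : ℂ) • ((Equiv.Perm.sign σ : ℤ) : ℂ) • m = m := by
  rcases Int.units_eq_one_or (Equiv.Perm.sign σ) with h | h <;> simp [h]

/-- A function on the rearrangements of a tableau that satisfies the column relations and the
Garnir relations takes values in the span of its values at the standard rearrangements. -/
theorem mem_span_standard {M : Type*} [AddCommGroup M] [Module ℂ M]
    (f : Equiv.Perm ↥μ.cells → M)
    (hcol : ∀ σ τ : Equiv.Perm ↥μ.cells, (∀ c, (τ c).1.2 = c.1.2) →
      f (σ * τ) = ((Equiv.Perm.sign τ : ℤ) : ℂ) • f σ)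
    (hgar : ∀ (σ : Equiv.Perm ↥μ.cells) (j : ℕ) (A B : Finset ↥μ.cells)
      (X : Finset (Equiv.Perm ↥μ.cells)), (∀ c ∈ A, c.1.2 = j) → (∀ c ∈ B, c.1.2 = j + 1) →
      μ.colLen j < A.card + B.card → IsTransversal (A : Set ↥μ.cells) (B : Set ↥μ.cells) X →
      ∑ x ∈ X, ((Equiv.Perm.sign x : ℤ) : ℂ) • f (σ * x) = 0)
    (key : ↥μ.cells → ℕ) (hkey : Function.Injective key) (σ : Equiv.Perm ↥μ.cells) :
    f σ ∈ Submodule.span ℂ (f '' {σ' | IsStandardKey fun c => key (σ' c)}) := by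
  set N := Submodule.span ℂ (f '' {σ' | IsStandardKey fun c => key (σ' c)})
  -- The induction runs towards larger weight. It terminates because there are finitely many
  -- rearrangements.
  let r : Equiv.Perm ↥μ.cells → Equiv.Perm ↥μ.cells → Prop :=
    fun τ σ => weight key σ < weight key τ
  have : IsTrans _ r := ⟨fun _ _ _ h h' => lt_trans h' h⟩
  have : Std.Irrefl r := ⟨fun _ h => lt_irrefl _ h⟩
  have hwf : WellFounded r := Finite.wellFounded_of_trans_of_irrefl r
  induction σ using hwf.induction with | _ σ ih
  by_cases hc : ∀ c c' : ↥μ.cells, c.1.2 = c'.1.2 → c.1.1 < c'.1.1 → key (σ c) < key (σ c')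
  · by_cases hr : ∀ c c' : ↥μ.cells, c.1.1 = c'.1.1 → c.1.2 + 1 = c'.1.2 →
        key (σ c) < key (σ c')
    · exact Submodule.subset_span ⟨σ, ⟨row_lt_of_adjacent (fun c => key (σ c)) hr, hc⟩, rfl⟩
    · push Not at hr
      obtain ⟨c, c', hrow, hcol', hle⟩ := hr
      have hlt : key (σ c') < key (σ c) := by
        refine lt_of_le_of_ne hle fun h => ?_
        have := σ.injective (hkey h)
        rw [this] at hcol'
        omega
      -- At a row descent from `c` to its right neighbour `c'`, `A` runs from `c` to the bottom of
      -- its column and `B` from the top of the next column to `c'`. Since columns already increase,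
      -- every entry of `B` is at most that of `c'`, which is smaller than every entry of `A`.
      set A := Finset.univ.filter fun a : ↥μ.cells => a.1.2 = c.1.2 ∧ c.1.1 ≤ a.1.1 with hAdef
      set B := Finset.univ.filter fun a : ↥μ.cells => a.1.2 = c'.1.2 ∧ a.1.1 ≤ c'.1.1 with hBdef
      have hA : ∀ a ∈ A, a.1.2 = c.1.2 := fun a ha => (Finset.mem_filter.1 ha).2.1
      have hB : ∀ a ∈ B, a.1.2 = c.1.2 + 1 := fun a ha =>
        (Finset.mem_filter.1 ha).2.1.trans hcol'.symm
      have hdisj : ∀ a ∈ A, a ∉ B := fun a ha hb => by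
        have h1 := hA a ha
        have h2 := hB a hb
        omega
      have hvA : ∀ a ∈ A, key (σ c') < key (σ a) := by
        intro a ha
        obtain ⟨h1, h2⟩ := (Finset.mem_filter.1 ha).2
        rcases h2.eq_or_lt with h2 | h2
        · have : a = c := Subtype.ext (Prod.ext h2.symm h1)
          rwa [this]
        · exact hlt.trans (hc c a h1.symm h2)
      have hvB : ∀ a ∈ B, key (σ a) ≤ key (σ c') := by
        intro a ha
        obtain ⟨h1, h2⟩ := (Finset.mem_filter.1 ha).2
        rcases h2.eq_or_lt with h2 | h2
        · have : a = c' := Subtype.ext (Prod.ext h2 h1)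
          rw [this]
        · exact (hc a c' h1 h2).le
      obtain ⟨X, hX⟩ := exists_isTransversal (A : Set ↥μ.cells) (B : Set ↥μ.cells)
      -- `x₀` represents the trivial coset. It preserves columns, so its term in the Garnir relation
      -- is `f σ` itself, the two signs cancelling; all other terms have larger weight.
      obtain ⟨x₀, ⟨hx₀, hx₀A, hx₀B⟩, huniq⟩ := hX.2 1 fun _ _ => rfl
      have hsum := hgar σ c.1.2 A B X hA hB (colLen_lt_card_add_card c c' hrow) hX
      rw [← Finset.add_sum_erase _ _ hx₀] at hsum
      have hx₀col : ∀ a, (x₀ a).1.2 = a.1.2 := by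
        intro a
        by_cases haA : a ∈ A
        · have : x₀ a ∈ A := (hx₀A (x₀ a)).1 (by simpa using haA)
          rw [hA _ this, hA _ haA]
        · by_cases haB : a ∈ B
          · have : x₀ a ∈ B := (hx₀B (x₀ a)).1 (by simpa using haB)
            rw [hB _ this, hB _ haB]
          · rw [hX.1 x₀ hx₀ a (by simp [haA, haB])]
      rw [hcol σ x₀ hx₀col, sign_smul_sign_smul] at hsum
      rw [eq_neg_of_add_eq_zero_left hsum]
      refine N.neg_mem (N.sum_mem fun x hx => N.smul_mem _ (ih _ ?_))
      obtain ⟨hxne, hxX⟩ := Finset.mem_erase.1 hx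
      have hxout : ∀ a, a ∉ A ∪ B → x a = a := fun a ha =>
        hX.1 x hxX a (by simpa using ha)
      refine weight_lt_of_garnir key σ x hA hB hxout hvA hvB ?_
      -- A representative that maps `B` into itself stabilizes `B` and, being trivial outside `A ∪
      -- B`, also `A`. It then lies in the trivial coset, so it would be `x₀`.
      by_contra hcon
      push Not at hcon
      apply hxne
      have hmap : B.map x.toEmbedding = B := by
        apply Finset.eq_of_subset_of_card_le
        · intro b hb
          obtain ⟨a, ha, rfl⟩ := Finset.mem_map.1 hb
          exact hcon a ha
        · rw [Finset.card_map]
      have hB' : ∀ a, x⁻¹ a ∈ B ↔ a ∈ B := by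
        intro a
        conv_rhs => rw [← hmap]
        rw [Finset.mem_map_equiv]
        rfl
      have hA' : ∀ a, x⁻¹ a ∈ A ↔ a ∈ A := by
        intro a
        have hx1 : x (x⁻¹ a) = a := by simp
        constructor
        · intro h
          by_contra h'
          by_cases h2 : a ∈ B
          · exact hdisj _ h ((hB' a).2 h2)
          · have h3 : x a = a := hxout a (by simp [h', h2])
            have h4 : x⁻¹ a = a := by rw [Equiv.Perm.inv_eq_iff_eq, h3]
            rw [h4] at h
            exact h' h
        · intro h
          by_contra h'
          by_cases h2 : x⁻¹ a ∈ B
          · exact hdisj _ h ((hB' a).1 h2)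
          · have h3 := hxout (x⁻¹ a) (by rw [Finset.mem_union]; exact not_or.2 ⟨h', h2⟩)
            rw [hx1] at h3
            rw [← h3] at h'
            exact h' h
      exact huniq x ⟨hxX, fun a => by simpa using hA' a, fun a => by simpa using hB' a⟩
  · push Not at hc
    obtain ⟨c, c', hcol', hrow, hle⟩ := hc
    have hne : c ≠ c' := by
      rintro rfl
      exact lt_irrefl _ hrow
    have hlt : key (σ c') < key (σ c) :=
      lt_of_le_of_ne hle fun h => hne (σ.injective (hkey h)).symm
    have h1 := hcol σ (Equiv.swap c c') (by
      intro a
      rw [Equiv.swap_apply_def]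
      split_ifs with h1 h2
      · rw [h1, hcol']
      · rw [h2, hcol']
      · rfl)
    rw [Equiv.Perm.sign_swap hne] at h1
    have h2 : f σ = - f (σ * Equiv.swap c c') := by
      rw [h1]
      simp
    rw [h2]
    exact N.neg_mem (ih _ (weight_lt_of_column key σ hcol' hrow hlt))

end Straightening

/-! ### Column and Garnir relations in Specht modules -/

section SpechtRelations

variable {μ : YoungDiagram} {B : Type}

theorem Tabloid.mk_eq {t t' : Tableau μ B} :
    Tabloid.mk t = Tabloid.mk t' ↔ ∀ b, (t.symm b).1.1 = (t'.symm b).1.1 :=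
  Quotient.eq.trans funext_iff

theorem Tabloid.mk_trans_eq {t : Tableau μ B} {ρ : Equiv.Perm ↥μ.cells}
    (h : ∀ c, (ρ c).1.1 = c.1.1) : Tabloid.mk (ρ.trans t) = Tabloid.mk t := by
  rw [Tabloid.mk_eq]
  intro b
  rw [Equiv.symm_trans_apply]
  have := h (ρ.symm (t.symm b))
  rwa [Equiv.apply_symm_apply, eq_comm] at this

/-- A permutation of the cells preserves columns. -/
def PreservesColumns (ρ : Equiv.Perm ↥μ.cells) : Prop := ∀ c, (ρ c).1.2 = c.1.2

theorem PreservesColumns.inv {ρ : Equiv.Perm ↥μ.cells} (h : PreservesColumns ρ) :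
    PreservesColumns ρ⁻¹ := fun c => by
  have h1 : ρ (ρ⁻¹ c) = c := by simp
  rw [← h (ρ⁻¹ c), h1]

theorem PreservesColumns.mul {ρ ρ' : Equiv.Perm ↥μ.cells} (h : PreservesColumns ρ)
    (h' : PreservesColumns ρ') : PreservesColumns (ρ * ρ') := fun c =>
  (h (ρ' c)).trans (h' c)

variable [Fintype B] [DecidableEq B]

-- Conjugation by `t` turns column permutations of entries into column permutations of cells. In
-- this form the group of the sum no longer depends on `t`.
open Classical in
theorem polytabloid_eq_sum_cells (t : Tableau μ B) :
    polytabloid t = ∑ ρ : Equiv.Perm ↥μ.cells with PreservesColumns ρ,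
      ((Equiv.Perm.sign ρ : ℤ) : ℂ) • Finsupp.single (Tabloid.mk (ρ.trans t)) 1 := by
  rw [polytabloid]
  symm
  refine Finset.sum_equiv (t.permCongr) (fun ρ => ?_) (fun ρ _ => ?_)
  · rw [Finset.mem_filter, Finset.mem_filter]
    simp only [Finset.mem_univ, true_and, IsColumnPerm, PreservesColumns]
    constructor
    · intro h b
      simpa using h (t.symm b)
    · intro h c
      simpa using h (t c)
  · rw [Equiv.Perm.sign_permCongr]
    congr 3
    ext c
    simp

theorem polytabloid_trans_of_preservesColumns (t : Tableau μ B) {ρ : Equiv.Perm ↥μ.cells}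
    (h : PreservesColumns ρ) :
    polytabloid (ρ.trans t) = ((Equiv.Perm.sign ρ : ℤ) : ℂ) • polytabloid t := by
  classical
  rw [polytabloid_eq_sum_cells, polytabloid_eq_sum_cells, Finset.smul_sum]
  refine Finset.sum_equiv (Equiv.mulLeft ρ) (fun ρ' => ?_) (fun ρ' _ => ?_)
  · simp only [Finset.mem_filter, Finset.mem_univ, true_and, Equiv.coe_mulLeft]
    refine ⟨fun h' => h.mul h', fun h' => ?_⟩
    simpa using h.inv.mul h'
  · rw [Equiv.coe_mulLeft, Equiv.Perm.sign_mul, Units.val_mul, Int.cast_mul, mul_smul,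
      sign_smul_sign_smul]
    rfl

/-- The sum over the symmetric group of the union is the sum over a transversal, times the order
of the subgroup, when the summand is invariant under the subgroup. -/
theorem sum_eq_card_mul_sum_transversal {C : Type} [Fintype C] [DecidableEq C] {A B : Finset C}
    {X : Finset (Equiv.Perm C)} (hX : IsTransversal (A : Set C) (B : Set C) X) {M : Type*}
    [AddCommGroup M] (g : Equiv.Perm C → M)
    (hg : ∀ σ y : Equiv.Perm C, (∀ c, c ∉ A ∪ B → y c = c) → (∀ c, y c ∈ A ↔ c ∈ A) →
      (∀ c, y c ∈ B ↔ c ∈ B) → g (σ * y) = g σ) :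
    ∑ h : Equiv.Perm C with (∀ c, c ∉ A ∪ B → h c = c), g h =
      (Finset.univ.filter fun y : Equiv.Perm C => (∀ c, c ∉ A ∪ B → y c = c) ∧
        (∀ c, y c ∈ A ↔ c ∈ A) ∧ (∀ c, y c ∈ B ↔ c ∈ B)).card • ∑ x ∈ X, g x := by
  set K := Finset.univ.filter fun y : Equiv.Perm C => (∀ c, c ∉ A ∪ B → y c = c) ∧
        (∀ c, y c ∈ A ↔ c ∈ A) ∧ (∀ c, y c ∈ B ↔ c ∈ B) with hK
  have hXout : ∀ x ∈ X, ∀ c, c ∉ A ∪ B → x c = c := fun x hx c hc =>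
    hX.1 x hx c (by simpa using hc)
  have hinv : ∀ x : Equiv.Perm C, (∀ c, c ∉ A ∪ B → x c = c) → ∀ c, c ∉ A ∪ B → x⁻¹ c = c :=
    fun x hx c hc => by rw [Equiv.Perm.inv_eq_iff_eq, hx c hc]
  have h1 : ∑ x ∈ X, ∑ y ∈ K, g (x * y) = K.card • ∑ x ∈ X, g x := by
    rw [Finset.smul_sum]
    refine Finset.sum_congr rfl fun x _ => ?_
    rw [← Finset.sum_const]
    refine Finset.sum_congr rfl fun y hy => ?_
    obtain ⟨h1, h2, h3⟩ := (Finset.mem_filter.1 hy).2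
    exact hg x y h1 h2 h3
  rw [← h1, ← Finset.sum_product']
  symm
  -- Every element of the symmetric group of the union is uniquely a representative times an element
  -- of the subgroup.
  refine Finset.sum_bij (fun p _ => p.1 * p.2) ?_ ?_ ?_ fun _ _ => rfl
  · rintro ⟨x, y⟩ hp
    obtain ⟨hx, hy⟩ := Finset.mem_product.1 hp
    obtain ⟨h1, h2, h3⟩ := (Finset.mem_filter.1 hy).2
    refine Finset.mem_filter.2 ⟨Finset.mem_univ _, fun c hc => ?_⟩
    rw [Equiv.Perm.mul_apply, h1 c hc, hXout x hx c hc]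
  · rintro ⟨x, y⟩ hp ⟨x', y'⟩ hp' h
    obtain ⟨hx, hy⟩ := Finset.mem_product.1 hp
    obtain ⟨hx', hy'⟩ := Finset.mem_product.1 hp'
    obtain ⟨h1, h2, h3⟩ := (Finset.mem_filter.1 hy).2
    obtain ⟨h1', h2', h3'⟩ := (Finset.mem_filter.1 hy').2
    change x * y = x' * y' at h
    have hxx : x = x' := by
      obtain ⟨z, _, hz⟩ := hX.2 (x * y) fun c hc => by
        have hc' : c ∉ A ∪ B := by simpa using hc
        rw [Equiv.Perm.mul_apply, h1 c hc', hXout x hx c hc']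
      rw [hz x ⟨hx, fun c => by simpa using h2 c, fun c => by simpa using h3 c⟩,
        hz x' ⟨hx', fun c => by rw [h]; simpa using h2' c, fun c => by rw [h]; simpa using h3' c⟩]
    subst hxx
    rw [mul_left_cancel h]
  · intro h hh
    have hh' := (Finset.mem_filter.1 hh).2
    obtain ⟨x, ⟨hx, hA, hB⟩, _⟩ := hX.2 h fun c hc => hh' c (by simpa using hc)
    refine ⟨(x, x⁻¹ * h), Finset.mem_product.2 ⟨hx, Finset.mem_filter.2
      ⟨Finset.mem_univ _, fun c hc => ?_, hA, hB⟩⟩, by simp⟩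
    rw [Equiv.Perm.mul_apply, hh' c hc, hinv x (hXout x hx) c hc]

/-- Fix a column permutation `ρ` in the expansion of the polytabloids. By the pigeonhole principle
`ρ⁻¹` puts two cells of `A ∪ A'` in the same row. Composing `h` with their transposition keeps the
tabloid and reverses the sign, so the sum over `h` equals its own negative. -/
theorem sum_garnir_full_eq_zero (t : Tableau μ B) {j : ℕ} {A A' : Finset ↥μ.cells}
    (hA : ∀ c ∈ A, c.1.2 = j) (hA' : ∀ c ∈ A', c.1.2 = j + 1)
    (hcard : μ.colLen j < A.card + A'.card) :
    ∑ h : Equiv.Perm ↥μ.cells with (∀ c, c ∉ A ∪ A' → h c = c),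
      ((Equiv.Perm.sign h : ℤ) : ℂ) • polytabloid (h.trans t) = 0 := by
  classical
  have hdisj : Disjoint A A' := by
    rw [Finset.disjoint_left]
    intro c hc hc'
    have h1 := hA c hc
    have h2 := hA' c hc'
    omega
  simp only [polytabloid_eq_sum_cells, Finset.smul_sum]
  rw [Finset.sum_comm]
  refine Finset.sum_eq_zero fun ρ hρ => ?_
  have hρ : PreservesColumns ρ := (Finset.mem_filter.1 hρ).2
  -- The rows available to `ρ⁻¹ c` are those of column `j` or `j + 1`. Column lengths weakly
  -- decrease, so there are at most `μ.colLen j` of them.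
  obtain ⟨a, ha, b, hb, hab, hrow⟩ := Finset.exists_ne_map_eq_of_card_lt_of_maps_to
    (s := A ∪ A') (t := Finset.range (μ.colLen j)) (f := fun c => (ρ⁻¹ c).1.1) (by
      rw [Finset.card_union_of_disjoint hdisj, Finset.card_range]
      exact hcard) (by
      intro c hc
      change (ρ⁻¹ c).1.1 ∈ ((Finset.range (μ.colLen j) : Finset ℕ) : Set ℕ)
      rw [Finset.mem_coe, Finset.mem_range]
      have h1 : (ρ⁻¹ c).1.1 < μ.colLen (ρ⁻¹ c).1.2 := YoungDiagram.mem_iff_lt_colLen.1 (ρ⁻¹ c).2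
      rw [hρ.inv c] at h1
      rcases Finset.mem_union.1 hc with hc | hc
      · rwa [hA c hc] at h1
      · rw [hA' c hc] at h1
        exact h1.trans_le (μ.colLen_anti _ _ (Nat.le_succ j)))
  set u := Equiv.swap a b with hu
  set S := ∑ h : Equiv.Perm ↥μ.cells with (∀ c, c ∉ A ∪ A' → h c = c),
    ((Equiv.Perm.sign h : ℤ) : ℂ) • ((Equiv.Perm.sign ρ : ℤ) : ℂ) •
      (Finsupp.single (Tabloid.mk (ρ.trans (h.trans t))) (1 : ℂ)) with hS
  have huout : ∀ c, c ∉ A ∪ A' → u c = c := by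
    intro c hc
    apply Equiv.swap_apply_of_ne_of_ne
    · rintro rfl
      exact hc ha
    · rintro rfl
      exact hc hb
  have hneg : S = -S := by
    conv_rhs => rw [hS, ← Finset.sum_neg_distrib]
    refine Finset.sum_equiv (Equiv.mulRight u) (fun h => ?_) (fun h _ => ?_)
    · simp only [Finset.mem_filter, Finset.mem_univ, true_and, Equiv.coe_mulRight,
        Equiv.Perm.mul_apply]
      constructor
      · intro h' c hc
        rw [huout c hc, h' c hc]
      · intro h' c hc
        have := h' c hc
        rwa [huout c hc] at this
    · rw [Equiv.coe_mulRight, Equiv.Perm.sign_mul, hu, Equiv.Perm.sign_swap hab]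
      have hmk : Tabloid.mk (ρ.trans ((h * Equiv.swap a b).trans t)) =
          Tabloid.mk (ρ.trans (h.trans t)) := by
        -- Moved past `ρ`, the transposition of `a` and `b` becomes that of `ρ⁻¹ a` and `ρ⁻¹ b`,
        -- which lie in one row, so it does not change the tabloid.
        rw [← Tabloid.mk_trans_eq (t := ρ.trans (h.trans t))
          (ρ := Equiv.swap (ρ⁻¹ a) (ρ⁻¹ b))]
        · congr 1
          ext c
          simp only [Equiv.trans_apply, Equiv.Perm.mul_apply]
          congr 2
          have h1 : ρ (ρ⁻¹ a) = a := by simp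
          have h2 : ρ (ρ⁻¹ b) = b := by simp
          have := (Equiv.swap_apply_apply ρ (ρ⁻¹ a) (ρ⁻¹ b))
          rw [h1, h2] at this
          rw [this]
          simp
        · intro c
          rw [Equiv.swap_apply_def]
          split_ifs with h1 h2
          · rw [h1, ← hrow]
          · rw [h2, ← hrow]
          · rfl
      rw [hmk]
      simp
  have h2 : (2 : ℂ) • S = 0 := by
    rw [two_smul]
    nth_rewrite 2 [hneg]
    exact add_neg_cancel S
  exact (smul_eq_zero.1 h2).resolve_left two_ne_zero

/-- The signed summand is constant on cosets, since the subgroup preserves columns. The sum over the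
whole group is therefore the order of the subgroup times the sum over the transversal, and this
order is invertible in ℂ. -/
theorem sum_garnir_polytabloid_eq_zero (t : Tableau μ B) {j : ℕ} {A A' : Finset ↥μ.cells}
    {X : Finset (Equiv.Perm ↥μ.cells)}
    (hA : ∀ c ∈ A, c.1.2 = j) (hA' : ∀ c ∈ A', c.1.2 = j + 1)
    (hcard : μ.colLen j < A.card + A'.card)
    (hX : IsTransversal (A : Set ↥μ.cells) (A' : Set ↥μ.cells) X) :
    ∑ x ∈ X, ((Equiv.Perm.sign x : ℤ) : ℂ) • polytabloid (x.trans t) = 0 := by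
  have h1 := sum_eq_card_mul_sum_transversal hX
    (fun h => ((Equiv.Perm.sign h : ℤ) : ℂ) • polytabloid (h.trans t)) (by
      intro σ y hy hyA hyA'
      have hcol : PreservesColumns y := by
        intro c
        by_cases hc : c ∈ A
        · rw [hA _ hc, hA _ ((hyA c).2 hc)]
        · by_cases hc' : c ∈ A'
          · rw [hA' _ hc', hA' _ ((hyA' c).2 hc')]
          · rw [hy c (by rw [Finset.mem_union]; exact not_or.2 ⟨hc, hc'⟩)]
      have h2 : (σ * y).trans t = y.trans (σ.trans t) := rfl
      change ((Equiv.Perm.sign (σ * y) : ℤ) : ℂ) • polytabloid ((σ * y).trans t) =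
        ((Equiv.Perm.sign σ : ℤ) : ℂ) • polytabloid (σ.trans t)
      rw [h2, polytabloid_trans_of_preservesColumns _ hcol, Equiv.Perm.sign_mul, Units.val_mul,
        Int.cast_mul, mul_smul, sign_smul_sign_smul])
  rw [sum_garnir_full_eq_zero t hA hA' hcard, ← Nat.cast_smul_eq_nsmul ℂ, eq_comm,
    smul_eq_zero] at h1
  refine h1.resolve_left ?_
  refine Nat.cast_ne_zero.2 ?_
  exact Finset.card_ne_zero_of_mem (a := 1) (Finset.mem_filter.2 ⟨Finset.mem_univ _, by simp⟩)

theorem spechtVec_trans_of_preservesColumns (t : Tableau μ B) {ρ : Equiv.Perm ↥μ.cells}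
    (h : PreservesColumns ρ) :
    spechtVec (ρ.trans t) = ((Equiv.Perm.sign ρ : ℤ) : ℂ) • spechtVec t :=
  Subtype.ext (polytabloid_trans_of_preservesColumns t h)

/-- The inclusion of the Specht module in the permutation module. -/
noncomputable def spechtIncl (μ : YoungDiagram) (B : Type) [Fintype B] [DecidableEq B] :
    Specht μ B →ₗ[ℂ] (Tabloid μ B →₀ ℂ) := (spechtSubmodule μ B).subtype

theorem spechtIncl_injective : Function.Injective (spechtIncl μ B) := Subtype.val_injective

theorem spechtIncl_spechtVec (t : Tableau μ B) :
    spechtIncl μ B (spechtVec t) = polytabloid t := rfl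

theorem sum_garnir_spechtVec_eq_zero (t : Tableau μ B) {j : ℕ} {A A' : Finset ↥μ.cells}
    {X : Finset (Equiv.Perm ↥μ.cells)}
    (hA : ∀ c ∈ A, c.1.2 = j) (hA' : ∀ c ∈ A', c.1.2 = j + 1)
    (hcard : μ.colLen j < A.card + A'.card)
    (hX : IsTransversal (A : Set ↥μ.cells) (A' : Set ↥μ.cells) X) :
    ∑ x ∈ X, ((Equiv.Perm.sign x : ℤ) : ℂ) • spechtVec (x.trans t) = 0 := by
  apply spechtIncl_injective
  rw [map_sum, map_zero, ← sum_garnir_polytabloid_eq_zero t hA hA' hcard hX]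
  exact Finset.sum_congr rfl fun x _ => map_smul _ _ _

theorem span_range_spechtVec :
    Submodule.span ℂ (Set.range (spechtVec : Tableau μ B → Specht μ B)) = ⊤ := by
  have h : Set.range (spechtVec : Tableau μ B → Specht μ B) =
      (Subtype.val : ↥(spechtSubmodule μ B) → _) ⁻¹' Set.range polytabloid := by
    ext x
    constructor
    · rintro ⟨t, rfl⟩
      exact ⟨t, rfl⟩
    · rintro ⟨t, ht⟩
      exact ⟨t, Subtype.ext ht⟩
  rw [h]
  exact Submodule.span_span_coe_preimage

theorem spechtRep_spechtVec (σ : Equiv.Perm B) (t : Tableau μ B) :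
    spechtRep μ B σ (spechtVec t) = spechtVec (t.trans σ) :=
  Subtype.ext (tabloidRep_polytabloid σ t)

end SpechtRelations

/-! ### Standard polytabloids are linearly independent -/

section StandardPolytabloids

/-- The values of `q` on a fibre of `p` are distinct and form an initial segment. Monotonicity gives
`q a ≤ q (ρ a)` by induction, and both sides have the same sum over all `a`, so equality holds
everywhere. It serves with rows as fibres and with columns as fibres. -/
theorem perm_eq_one_of_monotone {C : Type} [Finite C] (p q : C → ℕ)
    (hinj : ∀ a b, p a = p b → q a = q b → a = b)
    (hdown : ∀ a r, q a = r + 1 → ∃ a', p a' = p a ∧ q a' = r) (ρ : Equiv.Perm C)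
    (hp : ∀ a, p (ρ a) = p a)
    (hmono : ∀ a a', p a = p a' → q a < q a' → q (ρ a) < q (ρ a')) : ρ = 1 := by
  have := Fintype.ofFinite C
  have hle : ∀ n a, q a = n → n ≤ q (ρ a) := by
    intro n
    induction n with
    | zero => exact fun _ _ => Nat.zero_le _
    | succ n ih =>
      intro a ha
      obtain ⟨a', h1, h2⟩ := hdown a n ha
      exact (ih a' h2).trans_lt (hmono a' a h1 (by omega))
  have h1 := (Finset.sum_eq_sum_iff_of_le fun a (_ : a ∈ Finset.univ) => hle _ a rfl).1
    (Equiv.sum_comp ρ q).symm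
  ext a
  rw [Equiv.Perm.one_apply]
  exact hinj _ _ (hp a) (h1 a (Finset.mem_univ a)).symm

variable {μ : YoungDiagram} {B : Type}

/-- The permutation of cells comparing `t` with `t'` preserves rows and is increasing along each of
them, hence trivial. -/
theorem Tableau.eq_of_mk_eq {key : B → ℕ} {t t' : Tableau μ B}
    (ht : ∀ c c' : ↥μ.cells, c.1.1 = c'.1.1 → c.1.2 < c'.1.2 → key (t c) < key (t c'))
    (ht' : ∀ c c' : ↥μ.cells, c.1.1 = c'.1.1 → c.1.2 < c'.1.2 → key (t' c) < key (t' c'))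
    (h : Tabloid.mk t = Tabloid.mk t') : t = t' := by
  rw [Tabloid.mk_eq] at h
  have h1 : (t.trans t'.symm : Equiv.Perm ↥μ.cells) = 1 := by
    have hrow : ∀ a, ((t.trans t'.symm) a).1.1 = a.1.1 := by
      intro a
      rw [Equiv.trans_apply, ← h, Equiv.symm_apply_apply]
    refine perm_eq_one_of_monotone (fun c : ↥μ.cells => c.1.1) (fun c => c.1.2)
      (fun a b h1 h2 => Subtype.ext (Prod.ext h1 h2)) ?_ _ hrow ?_
    · rintro ⟨⟨r', j'⟩, hc⟩ r h
      obtain rfl : j' = r + 1 := h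
      exact ⟨⟨(r', r), μ.up_left_mem le_rfl (Nat.le_succ r) hc⟩, rfl, rfl⟩
    · intro a a' h1 h2
      have h3 := ht a a' h1 h2
      have h4 : ((t.trans t'.symm) a).1.1 = ((t.trans t'.symm) a').1.1 := by
        rw [hrow, hrow, h1]
      by_contra h
      rcases (not_lt.1 h).eq_or_lt with h5 | h5
      · have h6 := (t.trans t'.symm).injective (Subtype.ext (Prod.ext h4.symm h5))
        rw [h6] at h3
        exact lt_irrefl _ h3
      · have := ht' _ _ h4.symm h5
        simp only [Equiv.trans_apply, Equiv.apply_symm_apply] at this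
        exact lt_asymm h3 this
  ext c
  have := congrArg t' (Equiv.ext_iff.1 h1 c)
  simpa using this

theorem eq_one_of_preservesColumns_of_mk_eq {t : Tableau μ B} {ρ : Equiv.Perm ↥μ.cells}
    (hρ : PreservesColumns ρ) (h : Tabloid.mk (ρ.trans t) = Tabloid.mk t) : ρ = 1 := by
  rw [Tabloid.mk_eq] at h
  ext c : 1
  have h1 := h (t (ρ c))
  rw [Equiv.symm_apply_apply, Equiv.symm_trans_apply, Equiv.symm_apply_apply,
    Equiv.symm_apply_apply] at h1
  exact Subtype.ext (Prod.ext h1.symm (hρ c))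

variable [Fintype B]

/-- The sum of `row * key` over the entries of a tabloid. -/
def Tabloid.weight (key : B → ℕ) : Tabloid μ B → ℕ :=
  Quotient.lift (fun t : Tableau μ B => ∑ b, (t.symm b).1.1 * key b) fun t t' h =>
    Finset.sum_congr rfl fun b _ => by rw [show (t.symm b).1.1 = (t'.symm b).1.1 from congrFun h b]

theorem Tabloid.weight_mk (key : B → ℕ) (t : Tableau μ B) :
    (Tabloid.mk t).weight key = ∑ c : ↥μ.cells, c.1.1 * key (t c) := by
  change ∑ b, (t.symm b).1.1 * key b = _
  rw [← Equiv.sum_comp t]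
  simp

/-- Among the column rearrangements of `t`, one of maximal weight must increase down its columns,
since otherwise a transposition would raise the weight. The only such rearrangement is `t` itself.
-/
theorem Tabloid.weight_trans_le {key : B → ℕ} (hkey : Function.Injective key) {t : Tableau μ B}
    (ht : ∀ c c' : ↥μ.cells, c.1.2 = c'.1.2 → c.1.1 < c'.1.1 → key (t c) < key (t c'))
    {ρ : Equiv.Perm ↥μ.cells} (hρ : PreservesColumns ρ) :
    (Tabloid.mk (ρ.trans t)).weight key ≤ (Tabloid.mk t).weight key ∧
      ((Tabloid.mk (ρ.trans t)).weight key = (Tabloid.mk t).weight key → ρ = 1) := by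
  have key1 : ∀ m : Equiv.Perm ↥μ.cells, PreservesColumns m →
      (∀ σ : Equiv.Perm ↥μ.cells, PreservesColumns σ →
        (Tabloid.mk (σ.trans t)).weight key ≤ (Tabloid.mk (m.trans t)).weight key) → m = 1 := by
    intro m hm hmax
    have hinc : ∀ c c' : ↥μ.cells, c.1.2 = c'.1.2 → c.1.1 < c'.1.1 →
        key (t (m c)) < key (t (m c')) := by
      intro c c' h1 h2
      by_contra h
      have hne : c ≠ c' := by
        rintro rfl
        exact lt_irrefl _ h2
      have hlt : key (t (m c')) < key (t (m c)) :=
        lt_of_le_of_ne (not_lt.1 h) fun h => hne (m.injective (t.injective (hkey h))).symm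
      have h3 := sum_mul_swap_lt (fun a : ↥μ.cells => a.1.1) (fun a => key (t (m a))) h2 hlt
      have h4 := hmax (m * Equiv.swap c c') (hm.mul fun a => by
        rw [Equiv.swap_apply_def]
        split_ifs with h1' h2'
        · rw [h1', h1]
        · rw [h2', h1]
        · rfl)
      rw [Tabloid.weight_mk, Tabloid.weight_mk] at h4
      exact absurd h3 (not_lt.2 h4)
    refine perm_eq_one_of_monotone (fun c : ↥μ.cells => c.1.2) (fun c => c.1.1)
      (fun a b h1 h2 => Subtype.ext (Prod.ext h2 h1)) ?_ m hm ?_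
    · rintro ⟨⟨r', j⟩, hc⟩ r rfl
      exact ⟨⟨(r, j), μ.up_left_mem (Nat.le_succ r) le_rfl hc⟩, rfl, rfl⟩
    · intro a a' h1 h2
      have h3 := hinc a a' h1 h2
      have h4 : (m a).1.2 = (m a').1.2 := (hm a).trans (h1.trans (hm a').symm)
      by_contra h
      rcases (not_lt.1 h).eq_or_lt with h5 | h5
      · have : m a' = m a := Subtype.ext (Prod.ext h5 h4.symm)
        rw [this] at h3
        exact lt_irrefl _ h3
      · exact lt_asymm h3 (ht _ _ h4.symm h5)
  have hne : Nonempty {σ : Equiv.Perm ↥μ.cells // PreservesColumns σ} := ⟨⟨1, fun _ => rfl⟩⟩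
  obtain ⟨⟨m, hm⟩, hmax⟩ := Finite.exists_max fun σ : {σ : Equiv.Perm ↥μ.cells //
    PreservesColumns σ} => (Tabloid.mk (σ.1.trans t)).weight key
  have hmax' := fun σ hσ => hmax ⟨σ, hσ⟩
  obtain rfl := key1 m hm hmax'
  refine ⟨hmax' ρ hρ, fun h => key1 ρ hρ fun σ hσ => ?_⟩
  rw [h]
  exact hmax' σ hσ

variable [DecidableEq B]

open Classical in
theorem polytabloid_apply (t : Tableau μ B) (x : Tabloid μ B) :
    polytabloid t x = ∑ ρ : Equiv.Perm ↥μ.cells with PreservesColumns ρ,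
      ((Equiv.Perm.sign ρ : ℤ) : ℂ) * if Tabloid.mk (ρ.trans t) = x then 1 else 0 := by
  rw [polytabloid_eq_sum_cells, Finsupp.finsetSum_apply]
  exact Finset.sum_congr rfl fun ρ _ => by
    rw [Finsupp.smul_apply, Finsupp.single_apply, smul_eq_mul]

theorem polytabloid_apply_mk_self (t : Tableau μ B) : polytabloid t (Tabloid.mk t) = 1 := by
  classical
  rw [polytabloid_apply, Finset.sum_eq_single 1]
  · simp [show (Equiv.trans (1 : Equiv.Perm ↥μ.cells) t) = t from rfl]
  · intro ρ hρ hne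
    rw [if_neg fun h => hne (eq_one_of_preservesColumns_of_mk_eq (Finset.mem_filter.1 hρ).2 h),
      mul_zero]
  · intro h
    exact absurd (Finset.mem_filter.2 ⟨Finset.mem_univ _, fun _ => rfl⟩) h

/-- Take `t₀` of maximal weight among the tableaux with nonzero coefficient and compare coefficients
at its tabloid. The polytabloid of `t₀` contributes 1. Another standard `t` contributes nothing: its
tabloids other than its own have smaller weight than `t`, and its own tabloid determines it. -/
theorem linearIndependent_spechtVec {key : B → ℕ} (hkey : Function.Injective key) :
    LinearIndependent ℂ fun t : {t : Tableau μ B // IsStandardKey fun c => key (t c)} =>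
      spechtVec t.1 := by
  classical
  apply LinearIndependent.of_comp (spechtIncl μ B)
  rw [linearIndependent_iff']
  intro s g hsum
  by_contra hcon
  push Not at hcon
  obtain ⟨t₁, ht₁, hg₁⟩ := hcon
  obtain ⟨t₀, ht₀, hmax⟩ := Finset.exists_max_image (s.filter fun t => g t ≠ 0)
    (fun t => (Tabloid.mk t.1).weight key) ⟨t₁, Finset.mem_filter.2 ⟨ht₁, hg₁⟩⟩
  have h0 := DFunLike.congr_fun hsum (Tabloid.mk t₀.1)
  rw [Finsupp.finsetSum_apply, Finset.sum_eq_single t₀] at h0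
  · rw [Finsupp.smul_apply] at h0
    change g t₀ • polytabloid t₀.1 (Tabloid.mk t₀.1) = 0 at h0
    rw [polytabloid_apply_mk_self, smul_eq_mul, mul_one] at h0
    exact (Finset.mem_filter.1 ht₀).2 h0
  · intro t ht hne
    by_cases hgt : g t = 0
    · rw [hgt, zero_smul, Finsupp.coe_zero, Pi.zero_apply]
    · have hle := hmax t (Finset.mem_filter.2 ⟨ht, hgt⟩)
      change g t • polytabloid t.1 (Tabloid.mk t₀.1) = 0
      rw [polytabloid_apply, Finset.sum_eq_zero, smul_zero]
      intro ρ hρ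
      rw [if_neg, mul_zero]
      intro heq
      obtain ⟨h1, h2⟩ := Tabloid.weight_trans_le hkey t.2.2 (Finset.mem_filter.1 hρ).2
      rw [heq] at h1 h2
      obtain rfl := h2 (le_antisymm h1 hle)
      exact hne (Subtype.ext (Tableau.eq_of_mk_eq t.2.1 t₀.2.1 heq))
  · intro h
    exact absurd (Finset.mem_filter.1 ht₀).1 h

theorem span_standard_spechtVec {key : B → ℕ} (hkey : Function.Injective key) :
    Submodule.span ℂ (Set.range fun t : {t : Tableau μ B // IsStandardKey fun c => key (t c)} =>
      spechtVec t.1) = ⊤ := by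
  rw [eq_top_iff, ← span_range_spechtVec, Submodule.span_le]
  rintro _ ⟨t, rfl⟩
  have h := mem_span_standard (fun σ : Equiv.Perm ↥μ.cells => spechtVec (σ.trans t))
    (fun σ τ hτ => spechtVec_trans_of_preservesColumns (σ.trans t) hτ)
    (fun σ j A A' X hA hA' hcard hX =>
      sum_garnir_spechtVec_eq_zero (σ.trans t) hA hA' hcard hX)
    (fun c => key (t c)) (hkey.comp t.injective) 1
  refine Submodule.span_mono ?_ h
  rintro _ ⟨σ, hσ, rfl⟩
  exact ⟨⟨σ.trans t, hσ⟩, rfl⟩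

/-- The basis of the Specht module given by the standard polytabloids. -/
noncomputable def spechtBasis {key : B → ℕ} (hkey : Function.Injective key) :
    Module.Basis {t : Tableau μ B // IsStandardKey fun c => key (t c)} ℂ (Specht μ B) :=
  Module.Basis.mk (linearIndependent_spechtVec hkey) (span_standard_spechtVec hkey).ge

theorem spechtBasis_apply {key : B → ℕ} (hkey : Function.Injective key)
    (t : {t : Tableau μ B // IsStandardKey fun c => key (t c)}) :
    spechtBasis hkey t = spechtVec t.1 := by
  rw [spechtBasis, Module.Basis.mk_apply]

end StandardPolytabloids

/-! ### Column antisymmetrizers -/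

section Antisymmetrizer

variable {μ : YoungDiagram} {B : Type}

theorem IsColumnPerm.inv {t : Tableau μ B} {σ : Equiv.Perm B} (h : IsColumnPerm t σ) :
    IsColumnPerm t σ⁻¹ := fun b => by
  have h1 : σ (σ⁻¹ b) = b := by simp
  rw [← h (σ⁻¹ b), h1]

theorem IsColumnPerm.mul {t : Tableau μ B} {σ τ : Equiv.Perm B} (h : IsColumnPerm t σ)
    (h' : IsColumnPerm t τ) : IsColumnPerm t (σ * τ) := fun b => (h (τ b)).trans (h' b)

/-- Among the sets of `n` naturals, `{0, …, n - 1}` alone has the smallest sum. Elements outside it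
are at least `n`, the elements missing from `S` are less than `n`, and there are equally many of
both kinds. -/
theorem subset_range_of_sum_le {S : Finset ℕ} (h : ∑ n ∈ S, n ≤ ∑ n ∈ Finset.range S.card, n) :
    S ⊆ Finset.range S.card := by
  set R := Finset.range S.card with hR
  have hcard : (S \ R).card = (R \ S).card :=
    Finset.card_sdiff_comm (by rw [hR, Finset.card_range])
  rw [← Finset.sum_inter_add_sum_sdiff S R fun n => n,
    ← Finset.sum_inter_add_sum_sdiff R S fun n => n, Finset.inter_comm R S,
    add_le_add_iff_left] at h
  have h1 : (S \ R).card * S.card ≤ ∑ n ∈ S \ R, n := by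
    rw [← smul_eq_mul]
    refine Finset.card_nsmul_le_sum _ _ _ fun n hn => ?_
    have := (Finset.mem_sdiff.1 hn).2
    rwa [hR, Finset.mem_range, not_lt] at this
  have h2 : ∑ n ∈ R \ S, (n + 1) ≤ (R \ S).card * S.card := by
    rw [← smul_eq_mul]
    refine Finset.sum_le_card_nsmul _ _ _ fun n hn => ?_
    have := (Finset.mem_sdiff.1 hn).1
    rwa [hR, Finset.mem_range] at this
  rw [Finset.sum_add_distrib, Finset.sum_const, smul_eq_mul, mul_one] at h2
  rw [hcard] at h1
  have h3 : (S \ R).card = 0 := by omega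
  rwa [Finset.card_eq_zero, Finset.sdiff_eq_empty_iff_subset] at h3

/-- If no two entries lie in the same row of `s` and the same column of `t`, then the tabloid of
`s` is obtained from the one of `t` by a column permutation. -/
theorem exists_isColumnPerm_mk_eq [Finite B] (s t : Tableau μ B)
    (h : ∀ b b', (s.symm b).1.1 = (s.symm b').1.1 → (t.symm b).1.2 = (t.symm b').1.2 → b = b') :
    ∃ τ : Equiv.Perm B, IsColumnPerm t τ ∧ Tabloid.mk s = Tabloid.mk (t.trans τ) := by
  classical
  have := Fintype.ofFinite B
  let col : ℕ → Finset B := fun j => Finset.univ.filter fun b => (t.symm b).1.2 = j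
  have hmem : ∀ j b, b ∈ col j ↔ (t.symm b).1.2 = j := fun j b => by simp [col]
  have hinjs : ∀ j, Set.InjOn (fun b => (s.symm b).1.1) (col j : Set B) := by
    intro j b hb b' hb' hbb'
    exact h b b' hbb' (((hmem j b).1 hb).trans ((hmem j b').1 hb').symm)
  have hinjt : ∀ j, Set.InjOn (fun b => (t.symm b).1.1) (col j : Set B) := by
    intro j b hb b' hb' hbb'
    exact t.symm.injective (Subtype.ext (Prod.ext hbb'
      (((hmem j b).1 hb).trans ((hmem j b').1 hb').symm)))
  have himt : ∀ j, (col j).image (fun b => (t.symm b).1.1) = Finset.range (μ.colLen j) := by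
    intro j
    ext r
    rw [Finset.mem_range, ← YoungDiagram.mem_iff_lt_colLen, Finset.mem_image]
    constructor
    · rintro ⟨b, hb, rfl⟩
      rw [← (hmem j b).1 hb]
      exact (t.symm b).2
    · intro hr
      exact ⟨t ⟨(r, j), hr⟩, (hmem _ _).2 (by rw [Equiv.symm_apply_apply]), by
        rw [Equiv.symm_apply_apply]⟩
  have hcard : ∀ j, (col j).card = μ.colLen j := by
    intro j
    rw [← Finset.card_range (μ.colLen j), ← himt, Finset.card_image_of_injOn (hinjt j)]
  let S : ℕ → Finset ℕ := fun j => (col j).image fun b => (s.symm b).1.1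
  have hScard : ∀ j, (S j).card = μ.colLen j := fun j => by
    rw [← hcard, Finset.card_image_of_injOn (hinjs j)]
  let J : Finset ℕ := Finset.univ.image fun b : B => (t.symm b).1.2
  have hfib : ∀ f : B → ℕ, ∑ j ∈ J, ∑ b ∈ col j, f b = ∑ b, f b := fun f =>
    Finset.sum_fiberwise_of_maps_to (fun b _ => Finset.mem_image_of_mem _ (Finset.mem_univ b)) f
  have hs : ∀ j, ∑ b ∈ col j, (s.symm b).1.1 = ∑ n ∈ S j, n := fun j =>
    (Finset.sum_image (f := fun n => n) (hinjs j)).symm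
  have ht : ∀ j, ∑ b ∈ col j, (t.symm b).1.1 = ∑ n ∈ Finset.range (μ.colLen j), n := fun j => by
    rw [← himt, Finset.sum_image (hinjt j)]
  -- Both sides add up the row indices of all cells of `μ`.
  have htot : ∑ b, (s.symm b).1.1 = ∑ b, (t.symm b).1.1 := by
    rw [Equiv.sum_comp s.symm fun c : ↥μ.cells => c.1.1,
      Equiv.sum_comp t.symm fun c : ↥μ.cells => c.1.1]
  rw [← hfib, ← hfib] at htot
  -- The entries of column `j` of `t` occupy `μ.colLen j` distinct rows of `s`, so their row sum is
  -- at least that of an initial segment. As the totals agree, every column attains its minimum and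
  -- the rows are exactly an initial segment.
  have hle : ∀ j, ∑ n ∈ Finset.range (μ.colLen j), n ≤ ∑ n ∈ S j, n := by
    intro j
    by_contra hcon
    rw [not_le, ← hScard] at hcon
    have h1 := Finset.eq_of_subset_of_card_le (subset_range_of_sum_le hcon.le)
      (by rw [Finset.card_range])
    rw [← h1] at hcon
    exact lt_irrefl _ hcon
  have heq := (Finset.sum_eq_sum_iff_of_le (s := J)
    (f := fun j => ∑ n ∈ Finset.range (μ.colLen j), n) (g := fun j => ∑ n ∈ S j, n)
    fun j _ => hle j).1 (by
      rw [← Finset.sum_congr rfl fun j _ => ht j, ← Finset.sum_congr rfl fun j _ => hs j, htot])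
  -- The row of `b` in `s` and the column of `b` in `t` meet in a cell of `μ`. Sending `b` to the
  -- entry of `t` in that cell is a column permutation, whose inverse is the one sought.
  have hcell : ∀ b, ((s.symm b).1.1, (t.symm b).1.2) ∈ μ.cells := by
    intro b
    have hj := heq _ (Finset.mem_image_of_mem (fun b : B => (t.symm b).1.2) (Finset.mem_univ b))
    have h1 : S (t.symm b).1.2 ⊆ Finset.range (μ.colLen (t.symm b).1.2) := by
      rw [← hScard]
      apply subset_range_of_sum_le
      rw [hScard]
      exact hj.ge
    have h2 := h1 (Finset.mem_image_of_mem _ ((hmem _ b).2 rfl))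
    exact YoungDiagram.mem_iff_lt_colLen.2 (Finset.mem_range.1 h2)
  have hinj : Function.Injective fun b => t ⟨_, hcell b⟩ := by
    intro b b' hbb'
    have h1 := Prod.ext_iff.1 (Subtype.ext_iff.1 (t.injective hbb'))
    exact h b b' h1.1 h1.2
  let τ : Equiv.Perm B := Equiv.ofBijective _ (Finite.injective_iff_bijective.1 hinj)
  have hτ : ∀ b, τ b = t ⟨_, hcell b⟩ := fun b => rfl
  refine ⟨τ⁻¹, IsColumnPerm.inv fun b => ?_, ?_⟩
  · rw [hτ, Equiv.symm_apply_apply]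
  · rw [Tabloid.mk_eq]
    intro b
    change _ = (t.symm (τ b)).1.1
    rw [hτ, Equiv.symm_apply_apply]

theorem tabloidRep_single_mk (σ : Equiv.Perm B) (t : Tableau μ B) :
    tabloidRep μ B σ (Finsupp.single (Tabloid.mk t) 1) =
      Finsupp.single (Tabloid.mk (t.trans σ)) 1 :=
  Finsupp.mapDomain_single

variable [Fintype B] [DecidableEq B]

open Classical in
/-- The signed sum over the column stabilizer of `t`. -/
noncomputable def tabloidAntisymm (t : Tableau μ B) : Module.End ℂ (Tabloid μ B →₀ ℂ) :=
  ∑ σ : Equiv.Perm B with IsColumnPerm t σ,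
    ((Equiv.Perm.sign σ : ℤ) : ℂ) • tabloidRep μ B σ

theorem tabloidAntisymm_single_mk_self (t : Tableau μ B) :
    tabloidAntisymm t (Finsupp.single (Tabloid.mk t) 1) = polytabloid t := by
  rw [tabloidAntisymm, LinearMap.sum_apply, polytabloid]
  exact Finset.sum_congr rfl fun σ _ => by rw [LinearMap.smul_apply, tabloidRep_single_mk]

theorem tabloidAntisymm_tabloidRep (t : Tableau μ B) {τ : Equiv.Perm B} (hτ : IsColumnPerm t τ)
    (v : Tabloid μ B →₀ ℂ) : tabloidAntisymm t (tabloidRep μ B τ v) =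
      ((Equiv.Perm.sign τ : ℤ) : ℂ) • tabloidAntisymm t v := by
  classical
  rw [tabloidAntisymm, LinearMap.sum_apply, LinearMap.sum_apply, Finset.smul_sum]
  refine Finset.sum_equiv (Equiv.mulRight τ) (fun σ => ?_) (fun σ _ => ?_)
  · rw [Finset.mem_filter, Finset.mem_filter]
    simp only [Finset.mem_univ, true_and, Equiv.coe_mulRight]
    refine ⟨fun h => h.mul hτ, fun h => ?_⟩
    simpa using h.mul hτ.inv
  · have h1 : tabloidRep μ B (σ * τ) v = tabloidRep μ B σ (tabloidRep μ B τ v) := by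
      rw [map_mul]
      rfl
    have h2 : Equiv.Perm.sign (σ * τ) = Equiv.Perm.sign τ * Equiv.Perm.sign σ := by
      rw [Equiv.Perm.sign_mul, mul_comm]
    change _ = ((Equiv.Perm.sign τ : ℤ) : ℂ) •
      (((Equiv.Perm.sign (σ * τ) : ℤ) : ℂ) • tabloidRep μ B (σ * τ)) v
    rw [LinearMap.smul_apply, LinearMap.smul_apply, h1, h2, Units.val_mul, Int.cast_mul, mul_smul,
      sign_smul_sign_smul]

/-- By linearity it suffices to treat the tabloid of some `s`. If two entries share a row of `s` and
a column of `t`, their transposition fixes the tabloid but reverses the sign of the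
antisymmetrization, which vanishes. Otherwise the tabloid is `τ` applied to that of `t` for a column
permutation `τ`, and the result is `sign τ` times the polytabloid. In both cases the scalar is the
coefficient of the tabloid in the polytabloid. -/
theorem tabloidAntisymm_apply (t : Tableau μ B) (v : Tabloid μ B →₀ ℂ) :
    tabloidAntisymm t v = Finsupp.linearCombination ℂ (polytabloid t) v • polytabloid t := by
  classical
  induction v using Finsupp.induction_linear with
  | zero => simp
  | add v w hv hw => rw [map_add, map_add, add_smul, hv, hw]
  | single x a =>
    obtain ⟨s, rfl⟩ := x.exists_mk
    rw [Finsupp.linearCombination_single, smul_assoc,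
      show Finsupp.single (Tabloid.mk s) a = a • Finsupp.single (Tabloid.mk s) (1 : ℂ) by simp,
      map_smul]
    congr 1
    by_cases h : ∀ b b', (s.symm b).1.1 = (s.symm b').1.1 →
        (t.symm b).1.2 = (t.symm b').1.2 → b = b'
    · obtain ⟨τ, hτ, hs⟩ := exists_isColumnPerm_mk_eq s t h
      have h1 : tabloidAntisymm t (Finsupp.single (Tabloid.mk s) 1) =
          ((Equiv.Perm.sign τ : ℤ) : ℂ) • polytabloid t := by
        rw [hs, ← tabloidRep_single_mk, tabloidAntisymm_tabloidRep t hτ,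
          tabloidAntisymm_single_mk_self]
      rw [h1]
      congr 1
      rw [polytabloid, Finsupp.finsetSum_apply, Finset.sum_eq_single τ]
      · rw [hs, Finsupp.smul_apply, Finsupp.single_eq_same, smul_eq_mul, mul_one]
      · intro σ hσ hne
        rw [Finsupp.smul_apply, Finsupp.single_apply, if_neg, smul_zero]
        intro heq
        apply hne
        rw [hs, Tabloid.mk_eq] at heq
        have hσ := (Finset.mem_filter.1 hσ).2
        -- Both inverses take `b` to an entry of the same row and of the same column of `t`, hence
        -- to the same entry.
        have h3 : σ⁻¹ = τ⁻¹ := by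
          ext b
          apply t.symm.injective
          refine Subtype.ext (Prod.ext (heq b) ?_)
          rw [hσ.inv b, hτ.inv b]
        exact inv_injective h3
      · intro h'
        exact absurd (Finset.mem_filter.2 ⟨Finset.mem_univ _, hτ⟩) h'
    · push Not at h
      obtain ⟨b, b', hrow, hcol, hne⟩ := h
      have hτ : IsColumnPerm t (Equiv.swap b b') := by
        intro c
        rw [Equiv.swap_apply_def]
        split_ifs with h1 h2
        · rw [h1, hcol]
        · rw [h2, hcol]
        · rfl
      have hfix : tabloidRep μ B (Equiv.swap b b') (Finsupp.single (Tabloid.mk s) 1) =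
          Finsupp.single (Tabloid.mk s) 1 := by
        rw [tabloidRep_single_mk]
        congr 1
        rw [Tabloid.mk_eq]
        intro c
        change (s.symm (Equiv.swap b b' c)).1.1 = _
        rw [Equiv.swap_apply_def]
        split_ifs with h1 h2
        · rw [h1, hrow]
        · rw [h2, hrow]
        · rfl
      have h1 := tabloidAntisymm_tabloidRep t hτ (Finsupp.single (Tabloid.mk s) 1)
      rw [hfix, Equiv.Perm.sign_swap hne] at h1
      have h2 : tabloidAntisymm t (Finsupp.single (Tabloid.mk s) 1) = 0 := by
        have : (2 : ℂ) • tabloidAntisymm t (Finsupp.single (Tabloid.mk s) 1) = 0 := by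
          rw [two_smul]
          nth_rewrite 2 [h1]
          simp
        exact (smul_eq_zero.1 this).resolve_left two_ne_zero
      have h3 : polytabloid t (Tabloid.mk s) = 0 := by
        rw [polytabloid, Finsupp.finsetSum_apply]
        refine Finset.sum_eq_zero fun σ hσ => ?_
        have hσ := (Finset.mem_filter.1 hσ).2
        rw [Finsupp.smul_apply, Finsupp.single_apply, if_neg, smul_zero]
        intro heq
        rw [Tabloid.mk_eq] at heq
        have h4 : σ⁻¹ b = σ⁻¹ b' := by
          apply t.symm.injective
          refine Subtype.ext (Prod.ext ((heq b).trans (hrow.trans (heq b').symm)) ?_)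
          rw [hσ.inv b, hσ.inv b', hcol]
        exact hne (σ⁻¹.injective h4)
      rw [h2, h3, zero_smul]

open Classical in
/-- The signed sum over the column stabilizer of `t`, on the Specht module. -/
noncomputable def spechtAntisymm (t : Tableau μ B) : Module.End ℂ (Specht μ B) :=
  ∑ σ : Equiv.Perm B with IsColumnPerm t σ,
    ((Equiv.Perm.sign σ : ℤ) : ℂ) • spechtRep μ B σ

/-- The pairing of the Specht module with a polytabloid. -/
noncomputable def spechtPairing (t : Tableau μ B) : Module.Dual ℂ (Specht μ B) :=
  Finsupp.linearCombination ℂ (polytabloid t) ∘ₗ spechtIncl μ B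

theorem spechtAntisymm_apply (t : Tableau μ B) (v : Specht μ B) :
    spechtAntisymm t v = spechtPairing t v • spechtVec t := by
  apply spechtIncl_injective
  rw [map_smul, spechtIncl_spechtVec, spechtPairing, LinearMap.comp_apply, ← tabloidAntisymm_apply,
    spechtAntisymm, tabloidAntisymm, LinearMap.sum_apply, LinearMap.sum_apply, map_sum]
  rfl

theorem conj_polytabloid (t : Tableau μ B) (x : Tabloid μ B) :
    starRingEnd ℂ (polytabloid t x) = polytabloid t x := by
  classical
  rw [polytabloid_apply, map_sum]
  refine Finset.sum_congr rfl fun ρ _ => ?_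
  split_ifs <;> simp

/-- The pairing is bilinear, not Hermitian. However, polytabloids have real coefficients, so the
Specht module is stable under complex conjugation. Hence `v` pairs to zero with its own conjugate,
and the sum of the squared absolute values of its coefficients vanishes. -/
theorem eq_zero_of_spechtPairing_eq_zero {v : Specht μ B}
    (h : ∀ t : Tableau μ B, spechtPairing t v = 0) : v = 0 := by
  apply spechtIncl_injective
  rw [map_zero]
  set u : Tabloid μ B →₀ ℂ := spechtIncl μ B v with hu
  have h1 : ∀ w ∈ spechtSubmodule μ B, Finsupp.linearCombination ℂ (w : Tabloid μ B → ℂ) u = 0 := by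
    intro w hw
    induction hw using Submodule.span_induction with
    | mem w hw =>
      obtain ⟨t, rfl⟩ := hw
      exact h t
    | zero => simp
    | add w w' _ _ hw hw' =>
      rw [Finsupp.linearCombination_apply] at *
      simp only [Finsupp.coe_add, Pi.add_apply, smul_add, Finsupp.sum_add] at *
      rw [hw, hw', add_zero]
    | smul a w _ hw =>
      rw [Finsupp.linearCombination_apply, Finsupp.sum] at *
      simp only [Finsupp.coe_smul, Pi.smul_apply, smul_eq_mul] at *
      rw [← mul_zero a, ← hw, Finset.mul_sum]
      exact Finset.sum_congr rfl fun x _ => by ring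
  have h2 : ∀ w ∈ spechtSubmodule μ B,
      Finsupp.mapRange (starRingEnd ℂ) (map_zero _) w ∈ spechtSubmodule μ B := by
    intro w hw
    induction hw using Submodule.span_induction with
    | mem w hw =>
      obtain ⟨t, rfl⟩ := hw
      have : Finsupp.mapRange (starRingEnd ℂ) (map_zero _) (polytabloid t) = polytabloid t := by
        ext x
        rw [Finsupp.mapRange_apply, conj_polytabloid]
      rw [this]
      exact Submodule.subset_span ⟨t, rfl⟩
    | zero => simp
    | add w w' _ _ hw hw' =>
      rw [Finsupp.mapRange_add (by simp)]
      exact Submodule.add_mem _ hw hw'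
    | smul a w _ hw =>
      have : Finsupp.mapRange (starRingEnd ℂ) (map_zero _) (a • w) =
          starRingEnd ℂ a • Finsupp.mapRange (starRingEnd ℂ) (map_zero _) w := by
        ext x
        simp
      rw [this]
      exact Submodule.smul_mem _ _ hw
  have h3 := h1 _ (h2 u v.2)
  rw [Finsupp.linearCombination_apply, Finsupp.sum] at h3
  simp only [Finsupp.mapRange_apply, smul_eq_mul, Complex.mul_conj] at h3
  rw [← Complex.ofReal_sum, Complex.ofReal_eq_zero,
    Finset.sum_eq_zero_iff_of_nonneg fun _ _ => Complex.normSq_nonneg _] at h3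
  ext x
  by_contra hx
  exact hx (Complex.normSq_eq_zero.1 (h3 x (Finsupp.mem_support_iff.2 hx)))

instance : Finite (Tabloid μ B) := inferInstanceAs (Finite (Quotient _))

instance : Module.Finite ℂ (Specht μ B) :=
  inferInstanceAs (Module.Finite ℂ ↥(spechtSubmodule μ B))

/-- In finite dimension a set of functionals without common nonzero zero spans the dual space. -/
theorem span_range_spechtPairing :
    Submodule.span ℂ (Set.range (spechtPairing : Tableau μ B → Module.Dual ℂ (Specht μ B))) =
      ⊤ := by
  rw [← Subspace.dualCoannihilator_dualAnnihilator_eq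
    (W := Submodule.span ℂ (Set.range (spechtPairing : Tableau μ B → _)))]
  have : (Submodule.span ℂ (Set.range (spechtPairing : Tableau μ B → _))).dualCoannihilator =
      ⊥ := by
    rw [eq_bot_iff]
    intro v hv
    rw [Submodule.mem_dualCoannihilator] at hv
    exact eq_zero_of_spechtPairing_eq_zero fun t => hv _ (Submodule.subset_span ⟨t, rfl⟩)
  rw [this, Submodule.dualAnnihilator_bot]

theorem spechtVec_ne_zero (t : Tableau μ B) : spechtVec t ≠ 0 := by
  intro h
  have h1 := congrArg (fun v => spechtIncl μ B v (Tabloid.mk t)) h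
  simp only [spechtIncl_spechtVec, polytabloid_apply_mk_self, map_zero, Finsupp.coe_zero,
    Pi.zero_apply] at h1
  exact one_ne_zero h1

end Antisymmetrizer

/-! ### The representation `V` -/

section TensorProductOfSpecht

/-- The rank of the maximum of a finite set. -/
noncomputable def maxKey (s : Finset (Fin k)) : ℕ :=
  ((monoEquivOfFin (WithBot (Fin k)) rfl).symm s.max).1

theorem maxKey_lt_maxKey {s s' : Finset (Fin k)} : maxKey s < maxKey s' ↔ s.max < s'.max := by
  rw [maxKey, maxKey, ← Fin.lt_def, OrderIso.lt_iff_lt]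

theorem max_eq_of_maxKey_eq {s s' : Finset (Fin k)} (h : maxKey s = maxKey s') :
    s.max = s'.max :=
  (monoEquivOfFin (WithBot (Fin k)) rfl).symm.injective (Fin.ext h)

theorem isStandard_iff {μ : YoungDiagram} (t : ↥μ.cells → Finset (Fin k)) :
    IsStandard t ↔ IsStandardKey fun c => maxKey (t c) := by
  simp only [IsStandard, IsStandardKey, maxKey_lt_maxKey]

/-- The sort key on the blocks of one size. -/
noncomputable def blockKey {π : Setoid (Fin k)} {n : ℕ} (q : BlockOfSize π n) : ℕ :=
  maxKey q.1.toFinset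

theorem blockKey_injective {π : Setoid (Fin k)} {n : ℕ} :
    Function.Injective (blockKey : BlockOfSize π n → ℕ) := fun _ _ h =>
  Subtype.ext (Block.eq_of_max (max_eq_of_maxKey_eq h))

theorem BlockOfSize.lt_iff {π : Setoid (Fin k)} {n : ℕ} {q q' : BlockOfSize π n} :
    q.1 < q'.1 ↔ q.1.toFinset.max < q'.1.toFinset.max := by
  change q.1.key < q'.1.key ↔ _
  rw [Block.key, Block.key, Prod.Lex.toLex_lt_toLex, q.2, q'.2]
  simp

variable {lam : Index k}

/-- The element of `V^λ` given by a sequence of tableaux filled with blocks of `π_λ`. -/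
noncomputable def tableauxVec
    (t : ∀ i : Fin k, Tableau (lam.part i) (BlockOfSize lam.pi ((i : ℕ) + 1))) : VSpace lam :=
  ⨂ₜ[ℂ] i, spechtVec (t i)

theorem V_tableauxVec (g : G lam.pi)
    (t : ∀ i : Fin k, Tableau (lam.part i) (BlockOfSize lam.pi ((i : ℕ) + 1))) :
    V lam.pi lam g (tableauxVec t) =
      tableauxVec fun i => (t i).trans (blockPermOfSize lam.pi ((i : ℕ) + 1) g) := by
  change PiTensorProduct.map _ _ = _
  rw [tableauxVec, PiTensorProduct.map_tprod]
  simp only [spechtRep_spechtVec]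
  rfl

theorem span_range_tableauxVec :
    Submodule.span ℂ (Set.range (tableauxVec (lam := lam))) = ⊤ := by
  rw [← Submodule.ker_mkQ (Submodule.span ℂ (Set.range (tableauxVec (lam := lam)))),
    LinearMap.ker_eq_top]
  refine PiTensorProduct.ext_of_span_eq_top (g := fun i => spechtVec)
    (fun i => span_range_spechtVec) fun t => ?_
  rw [LinearMap.zero_apply, Submodule.mkQ_apply, Submodule.Quotient.mk_eq_zero]
  exact Submodule.subset_span ⟨t, rfl⟩

/-- `π`-tableaux are families of standard tableaux. -/
noncomputable def piTableauEquiv (π : Setoid (Fin k)) (lam : Index k) :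
    (∀ i : Fin k, {t : Tableau (lam.part i) (BlockOfSize π ((i : ℕ) + 1)) //
      IsStandardKey fun c => blockKey (t c)}) ≃ PiTableau π lam where
  toFun t := ⟨fun i => (t i).1, fun i => (isStandard_iff _).2 (t i).2⟩
  invFun T := fun i => ⟨T.tab i, (isStandard_iff _).1 (T.standard i)⟩
  left_inv _ := rfl
  right_inv _ := rfl

/-- The basis of `V^λ` given by the `π_λ`-tableaux. -/
noncomputable def vBasis (lam : Index k) :
    Module.Basis (PiTableau lam.pi lam) ℂ (VSpace lam) :=
  (Basis.piTensorProduct fun i : Fin k =>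
    spechtBasis (μ := lam.part i) (B := BlockOfSize lam.pi ((i : ℕ) + 1))
      blockKey_injective).reindex (piTableauEquiv lam.pi lam)

theorem vBasis_apply (T : PiTableau lam.pi lam) : vBasis lam T = T.vec := by
  rw [vBasis, Module.Basis.reindex_apply, Basis.piTensorProduct_apply]
  simp only [spechtBasis_apply]
  rfl

/-- The permutation of the blocks given by permutations of the blocks of each size. -/
noncomputable def permOfSizes {π : Setoid (Fin k)} (σ : ∀ n, Equiv.Perm (BlockOfSize π n)) :
    Equiv.Perm (Block π) :=
  (Equiv.sigmaFiberEquiv Block.size).symm.trans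
    ((Equiv.sigmaCongrRight σ).trans (Equiv.sigmaFiberEquiv Block.size))

theorem permOfSizes_apply {π : Setoid (Fin k)} (σ : ∀ n, Equiv.Perm (BlockOfSize π n)) (n : ℕ)
    (q : BlockOfSize π n) : permOfSizes σ q.1 = (σ n q).1 := by
  obtain ⟨q, rfl⟩ := q
  rfl

/-- Every permutation of the blocks that preserves their sizes comes from `G_π`. -/
theorem exists_blockPerm_eq {π : Setoid (Fin k)} (φ : Equiv.Perm (Block π))
    (h : ∀ q, (φ q).size = q.size) : ∃ g : G π, blockPerm g = φ := by
  have h' : ∀ q, (φ.symm q).size = q.size := fun q => by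
    rw [← h (φ.symm q), Equiv.apply_symm_apply]
  refine ⟨⟨ofBlockEquiv φ.symm h', ?_, ?_⟩, ?_⟩
  · ext a b
    change φ.symm _ = φ.symm _ ↔ _
    rw [φ.symm.apply_eq_iff_eq, Block.mk_eq]
  · ext a b
    exact Block.mk_eq
  · ext q
    obtain ⟨b, rfl⟩ := q.exists_mk
    obtain ⟨a, ha⟩ := (φ (Block.mk π b)).exists_mk
    rw [← ha, blockPerm_iff]
    change φ.symm (Block.mk π a) = Block.mk π b
    rw [ha, Equiv.symm_apply_apply]

/-- Surjectivity of G_π onto the product of the symmetric groups on the blocks of each size; it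
allows one to act on the tensor factors independently. -/
theorem exists_blockPermOfSize_eq {π : Setoid (Fin k)}
    (σ : ∀ i : Fin k, Equiv.Perm (BlockOfSize π ((i : ℕ) + 1))) :
    ∃ g : G π, ∀ i : Fin k, blockPermOfSize π ((i : ℕ) + 1) g = σ i := by
  -- The index `i : Fin k` stands for size `i + 1`. There are no blocks of size 0 or of size above
  -- `k`, so the value 1 there is immaterial.
  let σ' : ∀ n, Equiv.Perm (BlockOfSize π n) := fun n =>
    match n with
    | 0 => 1
    | n + 1 => if h : n < k then σ ⟨n, h⟩ else 1
  have hσ' : ∀ i : Fin k, σ' ((i : ℕ) + 1) = σ i := fun i => dif_pos i.2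
  have hsize : ∀ q, (permOfSizes σ' q).size = q.size := by
    intro q
    rw [permOfSizes_apply σ' q.size ⟨q, rfl⟩]
    exact (σ' q.size ⟨q, rfl⟩).2
  obtain ⟨g, hg⟩ := exists_blockPerm_eq (permOfSizes σ') hsize
  refine ⟨g, fun i => ?_⟩
  ext q : 2
  change blockPerm g q.1 = _
  rw [hg, permOfSizes_apply, hσ']

theorem map_spechtAntisymm_apply
    (t : ∀ i : Fin k, Tableau (lam.part i) (BlockOfSize lam.pi ((i : ℕ) + 1)))
    (z : VSpace lam) : PiTensorProduct.map (fun i => spechtAntisymm (t i)) z =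
      PiTensorProduct.dualDistrib (⨂ₜ[ℂ] i, spechtPairing (t i)) z • tableauxVec t := by
  induction z using PiTensorProduct.induction_on with
  | smul_tprod r v =>
    rw [map_smul, map_smul, smul_assoc, PiTensorProduct.map_tprod,
      PiTensorProduct.dualDistrib_apply, tableauxVec, ← MultilinearMap.map_smul_univ]
    simp only [spechtAntisymm_apply]
  | add x y hx hy => rw [map_add, map_add, add_smul, hx, hy]

/-- Expanding the tensor product of the antisymmetrizers multilinearly gives a signed sum of tuples
of permutations, each of which is the action of an element of G_λ. -/
theorem map_spechtAntisymm_mem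
    (t : ∀ i : Fin k, Tableau (lam.part i) (BlockOfSize lam.pi ((i : ℕ) + 1)))
    {N : Submodule ℂ (VSpace lam)} (hN : ∀ g, ∀ z ∈ N, V lam.pi lam g z ∈ N) {z : VSpace lam}
    (hz : z ∈ N) : PiTensorProduct.map (fun i => spechtAntisymm (t i)) z ∈ N := by
  classical
  have h1 : PiTensorProduct.mapMultilinear ℂ
      (fun i : Fin k => Specht (lam.part i) (BlockOfSize lam.pi ((i : ℕ) + 1)))
      (fun i : Fin k => Specht (lam.part i) (BlockOfSize lam.pi ((i : ℕ) + 1)))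
      (fun i => spechtAntisymm (t i)) z ∈ N := by
    simp only [spechtAntisymm]
    rw [MultilinearMap.map_sum_finset, LinearMap.sum_apply]
    refine N.sum_mem fun σ _ => ?_
    rw [MultilinearMap.map_smul_univ, LinearMap.smul_apply]
    refine N.smul_mem _ ?_
    obtain ⟨g, hg⟩ := exists_blockPermOfSize_eq σ
    have := hN g z hz
    change PiTensorProduct.map _ z ∈ N at this
    simp only [hg] at this
    exact this
  exact h1

/-- The pairings span the dual of every factor, and in finite dimension the dual of the tensor
product is the tensor product of the duals. So all functionals vanish at `z`. -/
theorem eq_zero_of_pairings_eq_zero {z : VSpace lam}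
    (h : ∀ t : ∀ i : Fin k, Tableau (lam.part i) (BlockOfSize lam.pi ((i : ℕ) + 1)),
      PiTensorProduct.dualDistrib (⨂ₜ[ℂ] i, spechtPairing (t i)) z = 0) : z = 0 := by
  have h1 : (LinearMap.applyₗ z) ∘ₗ (PiTensorProduct.dualDistrib (R := ℂ)
      (M := fun i : Fin k => Specht (lam.part i) (BlockOfSize lam.pi ((i : ℕ) + 1)))) = 0 :=
    PiTensorProduct.ext_of_span_eq_top (g := fun i => spechtPairing)
      (fun i => span_range_spechtPairing) fun t => h t
  have h2 : ∀ f : Module.Dual ℂ (VSpace lam), f z = 0 := by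
    intro f
    obtain ⟨w, rfl⟩ := (PiTensorProduct.dualDistribEquiv (R := ℂ)
      (M := fun i : Fin k =>
        Specht (lam.part i) (BlockOfSize lam.pi ((i : ℕ) + 1)))).surjective f
    exact LinearMap.congr_fun h1 w
  exact (Module.forall_dual_apply_eq_zero_iff ℂ z).1 h2

/-- A nonzero subspace of `V^λ` that is stable under `G_λ` is everything. -/
theorem V_submodule_eq_top {N : Submodule ℂ (VSpace lam)}
    (hN : ∀ g, ∀ z ∈ N, V lam.pi lam g z ∈ N) {z : VSpace lam} (hz : z ∈ N) (hz0 : z ≠ 0) :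
    N = ⊤ := by
  have h1 : ∃ t : ∀ i : Fin k, Tableau (lam.part i) (BlockOfSize lam.pi ((i : ℕ) + 1)),
      PiTensorProduct.dualDistrib (⨂ₜ[ℂ] i, spechtPairing (t i)) z ≠ 0 := by
    by_contra h
    push Not at h
    exact hz0 (eq_zero_of_pairings_eq_zero h)
  obtain ⟨t, ht⟩ := h1
  -- The antisymmetrizers of `t` send `z` to a nonzero multiple of `tableauxVec t`, which therefore
  -- lies in `N`.
  have h2 := map_spechtAntisymm_mem t hN hz
  rw [map_spechtAntisymm_apply, N.smul_mem_iff ht] at h2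
  rw [eq_top_iff, ← span_range_tableauxVec, Submodule.span_le]
  rintro _ ⟨t', rfl⟩
  -- G_λ is transitive on sequences of tableaux, and their vectors span.
  obtain ⟨g, hg⟩ := exists_blockPermOfSize_eq fun i => ((t i).symm.trans (t' i))
  have h3 := hN g _ h2
  rw [V_tableauxVec] at h3
  have : (fun i => (t i).trans (blockPermOfSize lam.pi ((i : ℕ) + 1) g)) = t' := by
    funext i
    rw [hg]
    ext c
    simp
  rwa [this] at h3

end TensorProductOfSpecht

/-! ### Types of set partitions -/

section Types

theorem type_eq_of_equiv {ι : Type*} [Fintype ι] {γ : Setoid (Fin k)} (φ : Block γ ≃ ι)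
    (f : ι → ℕ) (h : ∀ q, f (φ q) = q.size) : type γ = (Finset.univ : Finset ι).val.map f := by
  have h1 : (Finset.univ : Finset ι).val = (Finset.univ : Finset (Block γ)).val.map φ := by
    rw [← Finset.map_univ_equiv φ]
    rfl
  rw [h1, Multiset.map_map, type]
  exact Multiset.map_congr rfl fun q _ => (h q).symm

theorem Block.size_mk (γ : Setoid (Fin k)) (a : Fin k) :
    (Block.mk γ a).size = {a' | γ a a'}.ncard := by
  rw [Block.size, ← Set.ncard_coe_finset]
  congr 1
  ext a'
  rw [Finset.mem_coe, Block.mem_toFinset, Block.mk_eq]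
  exact ⟨fun h => γ.symm' h, fun h => γ.symm' h⟩

/-- The bijection between the blocks in the top row and the blocks in the bottom row. -/
noncomputable def topBotEquiv (d : U k) : Block d.top ≃ Block d.bot :=
  Equiv.ofBijective
    (Quotient.lift (fun a => Block.mk d.bot (d.dn (Sum.inl a))) fun a b h =>
      Block.mk_eq.2 (d.rel.trans' (d.rel.symm' (d.dn_spec (Sum.inl a)))
        (d.rel.trans' h (d.dn_spec (Sum.inl b)))))
    (by
      constructor
      · intro q q'
        induction q, q' using Quotient.inductionOn₂ with | _ a b
        intro h
        exact Quotient.sound (d.rel.trans' (d.dn_spec (Sum.inl a))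
          (d.rel.trans' (Block.mk_eq.1 h) (d.rel.symm' (d.dn_spec (Sum.inl b)))))
      · intro q
        obtain ⟨b, rfl⟩ := q.exists_mk
        obtain ⟨a, ha⟩ := d.exists_top (Sum.inr b)
        exact ⟨Block.mk _ a, Block.mk_eq.2
          (d.rel.trans' (d.rel.symm' (d.dn_spec (Sum.inl a))) (d.rel.symm' ha))⟩)

theorem type_top (d : U k) : type d.top = type d.bot := by
  refine type_eq_of_equiv (topBotEquiv d) Block.size fun q => ?_
  obtain ⟨a, rfl⟩ := q.exists_mk
  change (Block.mk d.bot (d.dn (Sum.inl a))).size = _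
  rw [Block.size_mk, Block.size_mk]
  have h := d.dn_spec (Sum.inl a)
  have h1 : {b | d.bot (d.dn (Sum.inl a)) b} = {b | d.rel (Sum.inl a) (Sum.inr b)} := by
    ext b
    exact ⟨fun h' => d.rel.trans' h h', fun h' => d.rel.trans' (d.rel.symm' h) h'⟩
  rw [h1]
  exact (d.uniform (Sum.inl a)).symm

/-- Coarsening is a surjection from the blocks of `γ` to those of `γ'`. Equal types give equal
numbers of blocks, so nothing is merged. -/
theorem eq_of_le_of_type_eq {γ γ' : Setoid (Fin k)} (hle : γ ≤ γ') (h : type γ = type γ') :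
    γ = γ' := by
  refine le_antisymm hle fun a b hab => ?_
  let f : Block γ → Block γ' := Quotient.map id fun _ _ h => hle h
  have hf : Function.Surjective f := by
    intro q
    obtain ⟨a, rfl⟩ := q.exists_mk
    exact ⟨Block.mk γ a, rfl⟩
  have hf' : Function.Bijective f :=
    (Fintype.bijective_iff_surjective_and_card f).2 ⟨hf, card_block_eq h⟩
  exact Block.mk_eq.1 (hf'.1 (Block.mk_eq.2 hab : f (Block.mk γ a) = f (Block.mk γ b)))

theorem List.coe_flatMap_eq_sum {α : Type*} (l : List α) (f : α → List ℕ) :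
    ((l.flatMap f : List ℕ) : Multiset ℕ) = (l.map fun i => (f i : Multiset ℕ)).sum := by
  induction l with
  | nil => rfl
  | cons a l ih => rw [List.flatMap_cons, ← Multiset.coe_add, ih, List.map_cons, List.sum_cons]

theorem Index.type_eq_sum (lam : Index k) :
    lam.type = ∑ i : Fin k, Multiset.replicate (lam.part i).card ((i : ℕ) + 1) := by
  rw [Index.type, Index.sizes, List.coe_flatMap_eq_sum, Fin.sum_univ_def]
  rfl

theorem Index.count_type (lam : Index k) (i : Fin k) :
    lam.type.count ((i : ℕ) + 1) = (lam.part i).card := by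
  rw [Index.type_eq_sum, Multiset.count_sum', Finset.sum_eq_single i]
  · rw [Multiset.count_replicate_self]
  · intro j _ hj
    rw [Multiset.count_replicate, if_neg]
    intro h
    exact hj (Fin.ext (by omega))
  · simp

theorem Index.card_blockOfSize {lam : Index k} {γ : Setoid (Fin k)} (h : UBP.type γ = lam.type)
    (i : Fin k) : Fintype.card (BlockOfSize γ ((i : ℕ) + 1)) = (lam.part i).card := by
  rw [← lam.count_type, ← h, UBP.type, Multiset.count_map, Fintype.card_subtype]
  simp only [Finset.card_def, Finset.filter_val, eq_comm]

theorem Index.nonempty_tableaux (lam : Index k) (i : Fin k) :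
    Nonempty (Tableau (lam.part i) (BlockOfSize lam.pi ((i : ℕ) + 1))) := by
  refine ⟨Fintype.equivOfCardEq ?_⟩
  rw [Index.card_blockOfSize lam.type_pi, Fintype.card_coe]

end Types

/-! ### The structure of `L`-classes -/

section LClass

/-- Stacking `m` on `d` glues those blocks of `d` that are joined by a block of `m.bot`, and any
such gluing is visible in the bottom row because every block of `d` reaches it. This is the
criterion for `odot` to be nonzero. -/
theorem bot_le_top_of_mul_bot {m d : U k} (h : (m * d).bot = d.bot) : m.bot ≤ d.top := by
  intro a b hab
  have ha := d.dn_spec (Sum.inl a)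
  have hb := d.dn_spec (Sum.inl b)
  have h1 : (m * d).bot (d.dn (Sum.inl a)) (d.dn (Sum.inl b)) :=
    (stack m.rel d.rel).trans' ((stack m.rel d.rel).symm' (stack_lower ha))
      ((stack m.rel d.rel).trans' (stack_upper (a := Sum.inr a) (b := Sum.inr b) hab)
        (stack_lower hb))
  rw [h] at h1
  exact d.rel.trans' ha (d.rel.trans' h1 (d.rel.symm' hb))

variable {π : Setoid (Fin k)}

theorem L.top_mulRight (l : L π) (g : G π) : (l.mulRight g).1.top = l.1.top :=
  U.top_mul_of_eq (l.2.trans g.2.1.symm)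

theorem L.mulRight_mul (l : L π) (g h : G π) : l.mulRight (g * h) = (l.mulRight g).mulRight h :=
  Subtype.ext (mul_assoc l.1 g.1 h.1).symm

/-- The action is free: multiplying `l * g` on the left by the reflection of `l` gives `e_π * g =
g`. -/
theorem L.mulRight_injective (l : L π) : Function.Injective l.mulRight := by
  intro g g' h
  have h1 := congrArg (fun x : L π => l.1.flip * x.1) h
  change l.1.flip * (l.1 * g.1) = l.1.flip * (l.1 * g'.1) at h1
  rw [← mul_assoc, ← mul_assoc, U.flip_mul_self, l.2, U.e_mul g.2.1.ge, U.e_mul g'.2.1.ge] at h1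
  exact Subtype.ext h1

/-- The witness is the reflection of `l` times `l'`, since `l` times its reflection is the
idempotent at the common top set partition. -/
theorem L.exists_mulRight_eq {l l' : L π} (h : l.1.top = l'.1.top) :
    ∃ g : G π, l.mulRight g = l' := by
  have h1 : l.1.flip.bot = l'.1.top := h
  refine ⟨⟨l.1.flip * l'.1, ?_, ?_⟩, Subtype.ext ?_⟩
  · rw [U.top_mul_of_eq h1]
    exact l.2
  · rw [U.bot_mul_of_eq h1, l'.2]
  · change l.1 * (l.1.flip * l'.1) = l'.1
    rw [← mul_assoc, U.mul_flip, h, U.e_mul le_rfl]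

theorem ell_top {γ : Setoid (Fin k)} (h : type γ = type π) : (ell h).1.top = γ := by
  ext a b
  change blockEquiv h (Block.mk γ a) = blockEquiv h (Block.mk γ b) ↔ _
  rw [(blockEquiv h).injective.eq_iff, Block.mk_eq]

/-- The identity of `G_π`, as an element of `L_π`. -/
def L.id (π : Setoid (Fin k)) : L π := ⟨U.e π, U.e_bot π⟩

theorem rightAct_of (g : G π) (l : L π) : rightAct g (CL.of l) = CL.of (l.mulRight g) :=
  CL.lift_of _ _

theorem schutzenberger_of (d : U k) (l : L π) : schutzenberger π d (CL.of l) = odot d l :=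
  CL.lift_of _ _

end LClass

/-! ### The representation `W` -/

section WStructure

variable {lam : Index k}

/-- The tensor `x ⊗ v`, as a linear map in `v`. -/
noncomputable def W.tmulRight (x : CL lam.pi) : VSpace lam →ₗ[ℂ] WSpace lam :=
  (balanced lam).mkQ ∘ₗ TensorProduct.mk ℂ (CL lam.pi) (VSpace lam) x

theorem W.tmulRight_apply (x : CL lam.pi) (v : VSpace lam) : W.tmulRight x v = W.tmul x v := rfl

theorem W.zero_tmul (v : VSpace lam) : W.tmul (0 : CL lam.pi) v = 0 := by
  rw [W.tmul, TensorProduct.zero_tmul]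
  rfl

theorem W.tmul_mulRight (l : L lam.pi) (g : G lam.pi) (v : VSpace lam) :
    W.tmul (CL.of (l.mulRight g)) v = W.tmul (CL.of l) (V lam.pi lam g v) := by
  rw [W.tmul, W.tmul, Submodule.Quotient.eq, ← rightAct_of]
  exact Submodule.subset_span ⟨_, g, v, rfl⟩

theorem W_tmul (d : U k) (l : L lam.pi) (v : VSpace lam) :
    W lam d (W.tmul (CL.of l) v) = W.tmul (odot d l) v := by
  rw [← schutzenberger_of]
  rfl

theorem W.hom_ext {M : Type*} [AddCommGroup M] [Module ℂ M] {f g : WSpace lam →ₗ[ℂ] M}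
    (h : ∀ l v, f (W.tmul (CL.of l) v) = g (W.tmul (CL.of l) v)) : f = g := by
  apply Submodule.linearMap_qext
  apply TensorProduct.ext'
  intro x v
  change CL lam.pi at x
  have hx : x ∈ Submodule.span ℂ (Set.range (CL.of (π := lam.pi))) := by
    have : Submodule.span ℂ (Set.range (CL.of (π := lam.pi))) = ⊤ := by
      have h1 := (Finsupp.basisSingleOne (R := ℂ) (ι := L lam.pi)).span_eq
      rw [Finsupp.coe_basisSingleOne] at h1
      exact h1
    rw [this]
    trivial
  induction hx using Submodule.span_induction with
  | mem x hx =>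
    obtain ⟨l, rfl⟩ := hx
    exact h l v
  | zero => rw [TensorProduct.zero_tmul, map_zero, map_zero]
  | add x y _ _ hx hy => rw [TensorProduct.add_tmul, map_add, map_add, hx, hy]
  | smul a x _ hx => rw [← TensorProduct.smul_tmul', map_smul, map_smul, hx]

/-- The set partitions of type `λ`. -/
abbrev OfType (lam : Index k) : Type := {γ : Setoid (Fin k) // UBP.type γ = lam.type}

/-- The orbit representative with the given top set partition. -/
noncomputable def OfType.ell (γ : OfType lam) : L lam.pi :=
  UBP.ell (γ.2.trans lam.type_pi.symm)

theorem OfType.ell_top (γ : OfType lam) : γ.ell.1.top = γ.1 := UBP.ell_top _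

/-- The top set partition of an element of `L_λ`. -/
def L.topOfType (l : L lam.pi) : OfType lam :=
  ⟨l.1.top, by rw [type_top, l.2, lam.type_pi]⟩

theorem L.exists_ell_mulRight (l : L lam.pi) : ∃ g : G lam.pi, l.topOfType.ell.mulRight g = l :=
  L.exists_mulRight_eq l.topOfType.ell_top

/-- The component of `W^λ` at the top set partitions. -/
noncomputable def L.component (l : L lam.pi) : VSpace lam →ₗ[ℂ] (OfType lam →₀ VSpace lam) :=
  Finsupp.lsingle l.topOfType ∘ₗ V lam.pi lam l.exists_ell_mulRight.choose

/-- Freeness of the action determines the group element chosen in `L.component`, so any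
factorization through the orbit representative computes it. -/
theorem L.component_mulRight (γ : OfType lam) (g : G lam.pi) :
    (γ.ell.mulRight g).component = Finsupp.lsingle γ ∘ₗ V lam.pi lam g := by
  have h : ∀ (l : L lam.pi) (γ : OfType lam) (g : G lam.pi), γ = l.topOfType →
      γ.ell.mulRight g = l → l.component = Finsupp.lsingle γ ∘ₗ V lam.pi lam g := by
    rintro l _ g rfl hg
    have := L.mulRight_injective _ (hg.trans l.exists_ell_mulRight.choose_spec.symm)
    rw [L.component, ← this]
  refine h _ γ g (Subtype.ext ?_) rfl
  change _ = (γ.ell.mulRight g).1.top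
  rw [L.top_mulRight, γ.ell_top]

theorem L.component_mulRight' (l : L lam.pi) (g : G lam.pi) :
    (l.mulRight g).component = l.component ∘ₗ V lam.pi lam g := by
  obtain ⟨h, hh⟩ := l.exists_ell_mulRight
  rw [← hh, ← L.mulRight_mul, L.component_mulRight, L.component_mulRight, map_mul,
    Module.End.mul_eq_comp, LinearMap.comp_assoc]

/-- The decomposition of `W^λ` into copies of `V^λ`. -/
noncomputable def W.toComponents (lam : Index k) :
    WSpace lam →ₗ[ℂ] (OfType lam →₀ VSpace lam) :=
  (balanced lam).liftQ (TensorProduct.lift (CL.lift L.component)) (by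
    rw [balanced, Submodule.span_le]
    rintro _ ⟨x, g, v, rfl⟩
    rw [SetLike.mem_coe, LinearMap.mem_ker, map_sub, TensorProduct.lift.tmul,
      TensorProduct.lift.tmul, sub_eq_zero]
    have : CL.lift L.component ∘ₗ rightAct g =
        (LinearMap.lcomp ℂ _ (V lam.pi lam g)) ∘ₗ CL.lift (L.component (lam := lam)) := by
      apply CL.hom_ext
      intro l
      rw [LinearMap.comp_apply, LinearMap.comp_apply, rightAct_of, CL.lift_of, CL.lift_of,
        L.component_mulRight']
      rfl
    exact LinearMap.congr_fun (LinearMap.congr_fun this x) v)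

theorem W.toComponents_tmul (l : L lam.pi) (v : VSpace lam) :
    W.toComponents lam (W.tmul (CL.of l) v) = l.component v := by
  change TensorProduct.lift (CL.lift L.component) (CL.of l ⊗ₜ v) = _
  rw [TensorProduct.lift.tmul, CL.lift_of]

/-- The sum of copies of `V^λ` in `W^λ`. -/
noncomputable def W.ofComponents (lam : Index k) :
    (OfType lam →₀ VSpace lam) →ₗ[ℂ] WSpace lam :=
  Finsupp.lsum ℂ fun γ => W.tmulRight (CL.of γ.ell)

theorem W.ofComponents_single (γ : OfType lam) (v : VSpace lam) :
    W.ofComponents lam (Finsupp.single γ v) = W.tmul (CL.of γ.ell) v := by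
  rw [W.ofComponents, Finsupp.lsum_single, W.tmulRight_apply]

theorem OfType.component_ell (γ : OfType lam) : γ.ell.component = Finsupp.lsingle γ := by
  have h := L.component_mulRight γ 1
  have h1 : γ.ell.mulRight 1 = γ.ell := Subtype.ext (U.mul_e γ.ell.2.ge)
  rw [h1, map_one] at h
  rw [h]
  rfl

/-- `W^λ` is a direct sum of copies of `V^λ` indexed by the set partitions of type `λ`. -/
noncomputable def W.componentsEquiv (lam : Index k) :
    (OfType lam →₀ VSpace lam) ≃ₗ[ℂ] WSpace lam :=
  LinearEquiv.ofLinearMap (W.ofComponents lam) (W.toComponents lam)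
    (by
      apply W.hom_ext
      intro l v
      obtain ⟨g, hg⟩ := l.exists_ell_mulRight
      rw [LinearMap.comp_apply, W.toComponents_tmul, LinearMap.id_apply]
      generalize hγ : l.topOfType = γ at hg
      rw [← hg, L.component_mulRight, LinearMap.comp_apply, Finsupp.lsingle_apply,
        W.ofComponents_single, W.tmul_mulRight])
    (by
      apply Finsupp.lhom_ext
      intro γ v
      rw [LinearMap.comp_apply, W.ofComponents_single, W.toComponents_tmul, γ.component_ell]
      rfl)

theorem W.componentsEquiv_single (γ : OfType lam) (v : VSpace lam) :
    W.componentsEquiv lam (Finsupp.single γ v) = W.tmul (CL.of γ.ell) v :=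
  W.ofComponents_single γ v

/-- The basis of `W^λ` given by the elements `ℓ_π^γ ⊗ T`. -/
noncomputable def wBasis (lam : Index k) :
    Module.Basis (OfType lam × PiTableau lam.pi lam) ℂ (WSpace lam) :=
  ((Finsupp.basis fun _ : OfType lam => vBasis lam).reindex (Equiv.sigmaEquivProd _ _)).map
    (W.componentsEquiv lam)

theorem wBasis_apply (γ : OfType lam) (T : PiTableau lam.pi lam) :
    wBasis lam (γ, T) = W.tmul (CL.of γ.ell) T.vec := by
  rw [wBasis, Module.Basis.map_apply, Module.Basis.reindex_apply, Finsupp.coe_basis]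
  change W.componentsEquiv lam (Finsupp.single γ (vBasis lam T)) = _
  rw [vBasis_apply, W.componentsEquiv_single]

-- If the product stays in L_λ, then `γ` refines `γ'`, and equality of types forces `γ = γ'`. In
-- that case the product is `e_π`.
open Classical in
theorem flip_ell_odot (γ γ' : OfType lam) : odot γ.ell.1.flip γ'.ell =
    if γ' = γ then CL.of (L.id lam.pi) else 0 := by
  rw [odot]
  by_cases h : γ' = γ
  · subst h
    have h1 : γ'.ell.1.flip * γ'.ell.1 = U.e lam.pi := by rw [U.flip_mul_self, γ'.ell.2]
    have h2 : (γ'.ell.1.flip * γ'.ell.1).bot = lam.pi := by rw [h1, U.e_bot]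
    rw [dif_pos h2, if_pos rfl]
    congr 1
    exact Subtype.ext h1
  · rw [if_neg h, dif_neg]
    intro h1
    apply h
    have h2 := bot_le_top_of_mul_bot (h1.trans γ'.ell.2.symm)
    rw [U.flip_bot, γ.ell_top, γ'.ell_top] at h2
    exact Subtype.ext (eq_of_le_of_type_eq h2 (γ.2.trans γ'.2.symm)).symm

theorem W_flip_ell (γ : OfType lam) (f : OfType lam →₀ VSpace lam) :
    W lam γ.ell.1.flip (W.componentsEquiv lam f) = W.tmul (CL.of (L.id lam.pi)) (f γ) := by
  classical
  have : W lam γ.ell.1.flip ∘ₗ (W.componentsEquiv lam).toLinearMap =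
      W.tmulRight (CL.of (L.id lam.pi)) ∘ₗ Finsupp.lapply γ := by
    apply Finsupp.lhom_ext
    intro γ' v
    rw [LinearMap.comp_apply, LinearMap.comp_apply, LinearEquiv.coe_coe, W.componentsEquiv_single,
      W_tmul, flip_ell_odot, Finsupp.lapply_apply, Finsupp.single_apply, W.tmulRight_apply]
    split_ifs
    · rfl
    · rw [W.zero_tmul, ← W.tmulRight_apply, map_zero]
  exact LinearMap.congr_fun this f

theorem odot_id (l : L lam.pi) : odot l.1 (L.id lam.pi) = CL.of l := by
  have h1 : l.1 * (L.id lam.pi).1 = l.1 := U.mul_e l.2.ge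
  have h2 : (l.1 * (L.id lam.pi).1).bot = lam.pi := by rw [h1, l.2]
  rw [odot, dif_pos h2]
  congr 1
  exact Subtype.ext h1

theorem exists_tableauxVec_ne_zero (lam : Index k) : ∃ v : VSpace lam, v ≠ 0 := by
  have t : ∀ i : Fin k, Tableau (lam.part i) (BlockOfSize lam.pi ((i : ℕ) + 1)) :=
    fun i => (lam.nonempty_tableaux i).some
  have h : ∀ i, ∃ f : Module.Dual ℂ (Specht (lam.part i) (BlockOfSize lam.pi ((i : ℕ) + 1))),
      f (spechtVec (t i)) ≠ 0 := by
    intro i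
    by_contra hcon
    push Not at hcon
    exact spechtVec_ne_zero (t i) ((Module.forall_dual_apply_eq_zero_iff ℂ _).1 hcon)
  choose f hf using h
  refine ⟨tableauxVec t, fun h0 => ?_⟩
  have h1 := congrArg (PiTensorProduct.dualDistrib (⨂ₜ[ℂ] i, f i)) h0
  rw [tableauxVec, PiTensorProduct.dualDistrib_apply, map_zero, Finset.prod_eq_zero_iff] at h1
  obtain ⟨i, -, hi⟩ := h1
  exact hf i hi

/-- The reflected representatives isolate one component of a nonzero vector, V^λ being irreducible
fills up that component at `e_π`, and L_λ spreads it over all components. -/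
theorem W_isIrreducible (lam : Index k) : (W lam).IsIrreducible := by
  obtain ⟨v, hv⟩ := exists_tableauxVec_ne_zero lam
  have hne : ∃ w : WSpace lam, w ≠ 0 := by
    refine ⟨W.componentsEquiv lam (Finsupp.single ⟨lam.pi, lam.type_pi⟩ v), ?_⟩
    rw [Ne, LinearEquiv.map_eq_zero_iff, Finsupp.single_eq_zero]
    exact hv
  have hnt : Nontrivial (Subrepresentation (W lam)) := by
    obtain ⟨w, hw⟩ := hne
    refine ⟨⊥, ⊤, fun h => hw ?_⟩
    have h1 : w ∈ (⊤ : Subrepresentation (W lam)).toSubmodule := Submodule.mem_top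
    rw [← h] at h1
    exact (Submodule.mem_bot ℂ).1 h1
  refine { eq_bot_or_eq_top := fun N => ?_ }
  by_cases hN : ∃ w ∈ N.toSubmodule, w ≠ 0
  · right
    obtain ⟨w, hwN, hw⟩ := hN
    obtain ⟨f, rfl⟩ := (W.componentsEquiv lam).surjective w
    have hf : f ≠ 0 := fun h => hw (by rw [h, map_zero])
    obtain ⟨γ, hγ⟩ := Finsupp.ne_iff.1 hf
    have h1 := N.apply_mem_toSubmodule γ.ell.1.flip hwN
    rw [W_flip_ell] at h1
    -- The vectors `v` with `e_π ⊗ v` in `N` form a G_λ-stable subspace, because `g (e_π ⊗ v) = g ⊗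
    -- v = e_π ⊗ g v`. It contains the component of `f` at `γ`, which is nonzero.
    have h2 := V_submodule_eq_top
      (N := N.toSubmodule.comap (W.tmulRight (CL.of (L.id lam.pi)))) (by
        intro g z hz
        rw [Submodule.mem_comap, W.tmulRight_apply] at hz ⊢
        have h3 := N.apply_mem_toSubmodule g.1 hz
        have h4 : (⟨g.1, g.2.2⟩ : L lam.pi) = (L.id lam.pi).mulRight g :=
          Subtype.ext (U.e_mul g.2.1.ge).symm
        have h5 := odot_id (⟨g.1, g.2.2⟩ : L lam.pi)
        rwa [W_tmul, h5, h4, W.tmul_mulRight] at h3) h1 hγ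
    apply Subrepresentation.toSubmodule_injective
    change N.toSubmodule = ⊤
    rw [← Submodule.ker_mkQ N.toSubmodule, LinearMap.ker_eq_top]
    apply W.hom_ext
    -- Each `l ⊗ v` is `l` acting on `e_π ⊗ v`, which already lies in `N`.
    intro l v
    rw [Submodule.mkQ_apply, LinearMap.zero_apply, Submodule.Quotient.mk_eq_zero, ← odot_id,
      ← W_tmul]
    apply N.apply_mem_toSubmodule
    have h3 : v ∈ N.toSubmodule.comap (W.tmulRight (CL.of (L.id lam.pi))) := by
      rw [h2]
      trivial
    exact h3
  · left
    push Not at hN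
    apply Subrepresentation.toSubmodule_injective
    change N.toSubmodule = ⊥
    exact (Submodule.eq_bot_iff _).2 hN

end WStructure

/-! ### Fillings from elements of the `L`-class -/

section Fillings

/-- The block of `π` in the bottom row below `a`. -/
noncomputable def L.below {π : Setoid (Fin k)} (l : L π) (a : Fin k) : Block π :=
  Block.mk π (l.1.dn (Sum.inl a))

section Below

variable {π : Setoid (Fin k)}

theorem L.below_eq_mk (l : L π) (a b : Fin k) :
    l.below a = Block.mk π b ↔ l.1.rel (Sum.inl a) (Sum.inr b) := by
  have h : ∀ c c', π c c' ↔ l.1.rel (Sum.inr c) (Sum.inr c') := fun c c' => by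
    rw [← show l.1.bot c c' ↔ π c c' by rw [l.2]]
    rfl
  rw [L.below, Block.mk_eq, h]
  exact ⟨fun h' => l.1.rel.trans' (l.1.dn_spec _) h',
    fun h' => l.1.rel.trans' (l.1.rel.symm' (l.1.dn_spec _)) h'⟩

theorem L.below_surjective (l : L π) : Function.Surjective l.below := by
  intro q
  obtain ⟨b, rfl⟩ := q.exists_mk
  obtain ⟨a, ha⟩ := l.1.exists_top (Sum.inr b)
  exact ⟨a, (l.below_eq_mk a b).2 (l.1.rel.symm' ha)⟩

theorem L.below_eq_below (l : L π) (a a' : Fin k) : l.below a = l.below a' ↔ l.1.top a a' := by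
  obtain ⟨b, hb⟩ := (l.below a').exists_mk
  have h' := (l.below_eq_mk a' b).1 hb.symm
  rw [← hb, L.below_eq_mk]
  exact ⟨fun h => l.1.rel.trans' h (l.1.rel.symm' h'), fun h => l.1.rel.trans' h h'⟩

theorem L.card_below_eq (l : L π) (q : Block π) :
    (Finset.univ.filter fun a => l.below a = q).card = q.size := by
  obtain ⟨b, rfl⟩ := q.exists_mk
  obtain ⟨a, ha⟩ := l.below_surjective (Block.mk π b)
  have hab := (l.below_eq_mk a b).1 ha
  rw [Block.size_mk, ← Set.ncard_coe_finset]
  have h1 : {b' | π b b'} = {b' | l.1.rel (Sum.inl a) (Sum.inr b')} := by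
    ext b'
    rw [Set.mem_ofPred_eq, Set.mem_ofPred_eq, ← L.below_eq_mk, ha, Block.mk_eq]
  rw [h1, ← l.1.uniform]
  congr 1
  ext a'
  rw [Finset.mem_coe, Finset.mem_filter, ← ha, L.below_eq_below]
  exact ⟨fun h => l.1.rel.symm' h.2, fun h => ⟨Finset.mem_univ _, l.1.rel.symm' h⟩⟩

/-- A path from `a` to the bottom row of `l * g` passes through the block below `a` in `l` and then
through `g`, while `blockPerm g` reads `g` upwards. -/
theorem L.blockPerm_below_mulRight (l : L π) (g : G π) (a : Fin k) :
    blockPerm g ((l.mulRight g).below a) = l.below a := by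
  obtain ⟨c, hc⟩ := ((l.mulRight g).below a).exists_mk
  have h1 := ((l.mulRight g).below_eq_mk a c).1 hc.symm
  obtain ⟨b, hb, hbc⟩ := ((U.mul_rel_of_eq (l.2.trans g.2.1.symm)).2 a c).1 h1
  rw [← hc, (blockPerm_iff g b c).2 hbc, eq_comm, L.below_eq_mk]
  exact hb

theorem ell_below {γ : Setoid (Fin k)} (h : type γ = type π) (a : Fin k) :
    (ell h).below a = blockEquiv h (Block.mk γ a) := by
  obtain ⟨b, hb⟩ := (blockEquiv h (Block.mk γ a)).exists_mk
  rw [← hb, L.below_eq_mk]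
  exact hb.symm

end Below

variable {lam : Index k}

/-- Sequences of tableaux filled with the blocks of a set partition. -/
abbrev Tableaux (π : Setoid (Fin k)) (lam : Index k) : Type :=
  ∀ i : Fin k, Tableau (lam.part i) (BlockOfSize π ((i : ℕ) + 1))

theorem Tableaux.existsUnique {π : Setoid (Fin k)} (t : Tableaux π lam) (q : Block π) :
    ∃! p : Σ i : Fin k, ↥(lam.part i).cells, q = (t p.1 p.2).1 := by
  obtain ⟨a, ha⟩ := q.exists_mk
  have h0 : q.size ≠ 0 := Finset.card_ne_zero_of_mem (Block.mem_toFinset.2 ha)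
  have h1 : q.size ≤ k := (Finset.card_le_univ _).trans_eq (Fintype.card_fin k)
  obtain ⟨n, hn⟩ := Nat.exists_eq_succ_of_ne_zero h0
  -- Block sizes lie between 1 and `k`, so the size minus one is a valid index, and it singles out
  -- the only tableau that can contain `q`.
  refine ⟨⟨⟨n, by omega⟩, (t ⟨n, by omega⟩).symm ⟨q, hn⟩⟩, by simp, ?_⟩
  rintro ⟨i, c⟩ hq
  change q = (t i c).1 at hq
  have hi : i = ⟨n, by omega⟩ := by
    have := (t i c).2
    rw [← hq, hn] at this
    exact Fin.ext (by simpa using this.symm)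
  subst hi
  congr 1
  rw [Equiv.eq_symm_apply]
  exact Subtype.ext hq.symm

/-- The filling whose cells contain the letters above the blocks of `π_λ` in `t`. -/
noncomputable def fill (l : L lam.pi) (t : Tableaux lam.pi lam) : Filling lam where
  entry i c := Finset.univ.filter fun a => l.below a = (t i c).1
  card_entry i c := by rw [l.card_below_eq, (t i c).2]
  partition a := by
    simp only [Finset.mem_filter, Finset.mem_univ, true_and]
    exact t.existsUnique (l.below a)

theorem mem_fill_entry {l : L lam.pi} {t : Tableaux lam.pi lam} {i : Fin k}
    {c : ↥(lam.part i).cells} {a : Fin k} : a ∈ (fill l t).entry i c ↔ l.below a = (t i c).1 := by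
  simp [fill]

theorem fill_injective (l : L lam.pi) : Function.Injective (fill l) := by
  intro t t' h
  funext i
  ext c : 2
  obtain ⟨a, ha⟩ := l.below_surjective (t i c).1
  have h1 := mem_fill_entry.2 ha
  rw [h] at h1
  rw [← ha, mem_fill_entry.1 h1]

/-- The action of `G_λ` on sequences of tableaux. -/
noncomputable def Tableaux.act (g : G lam.pi) (t : Tableaux lam.pi lam) : Tableaux lam.pi lam :=
  fun i => (t i).trans (blockPermOfSize lam.pi ((i : ℕ) + 1) g)

/-- The counterpart for fillings of the relation `ℓ g ⊗ v = ℓ ⊗ g v`; it makes the vector of a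
filling well defined. -/
theorem fill_mulRight (l : L lam.pi) (g : G lam.pi) (t : Tableaux lam.pi lam) :
    fill (l.mulRight g) t = fill l (t.act g) := by
  ext i c a
  rw [mem_fill_entry, mem_fill_entry, ← l.blockPerm_below_mulRight g]
  change _ ↔ _ = blockPerm g (t i c).1
  rw [(blockPerm g).apply_eq_iff_eq]

theorem top_iff_fill (l : L lam.pi) (t : Tableaux lam.pi lam) (a a' : Fin k) :
    l.1.top a a' ↔ ∃ i c, a ∈ (fill l t).entry i c ∧ a' ∈ (fill l t).entry i c := by
  rw [← L.below_eq_below]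
  simp only [mem_fill_entry]
  constructor
  · intro h
    obtain ⟨p, hp, -⟩ := t.existsUnique (l.below a)
    exact ⟨p.1, p.2, hp, h ▸ hp⟩
  · rintro ⟨i, c, h, h'⟩
    rw [h, h']

theorem top_eq_of_fill_eq {l l' : L lam.pi} {t t' : Tableaux lam.pi lam}
    (h : fill l t = fill l' t') : l.1.top = l'.1.top := by
  ext a a'
  rw [top_iff_fill l t, top_iff_fill l' t', h]

/-- The cell containing a letter. -/
noncomputable def Filling.cellOf (S : Filling lam) (a : Fin k) : Σ i : Fin k, ↥(lam.part i).cells :=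
  (S.partition a).choose

theorem Filling.cellOf_eq {S : Filling lam} {a : Fin k} {p : Σ i : Fin k, ↥(lam.part i).cells} :
    S.cellOf a = p ↔ a ∈ S.entry p.1 p.2 := by
  constructor
  · rintro rfl
    exact (S.partition a).choose_spec.1
  · intro h
    exact ((S.partition a).choose_spec.2 p h).symm

/-- The set partition formed by the entries of a filling. -/
noncomputable def Filling.setoid (S : Filling lam) : Setoid (Fin k) := Setoid.ker S.cellOf

theorem Filling.entry_nonempty (S : Filling lam) (i : Fin k) (c : ↥(lam.part i).cells) :
    (S.entry i c).Nonempty := by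
  rw [← Finset.card_pos, S.card_entry]
  exact Nat.succ_pos _

/-- The bijection between the blocks and the cells. -/
noncomputable def Filling.blockEquivCells (S : Filling lam) :
    Block S.setoid ≃ Σ i : Fin k, ↥(lam.part i).cells :=
  Equiv.ofBijective (Quotient.lift S.cellOf fun _ _ h => h) (by
    constructor
    · intro q q'
      induction q, q' using Quotient.inductionOn₂ with | _ a b
      intro h
      exact Quotient.sound h
    · intro p
      obtain ⟨a, ha⟩ := S.entry_nonempty p.1 p.2
      exact ⟨Block.mk _ a, Filling.cellOf_eq.2 ha⟩)

theorem Filling.blockEquivCells_mk (S : Filling lam) (a : Fin k) :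
    S.blockEquivCells (Block.mk _ a) = S.cellOf a := rfl

theorem Filling.toFinset_blockEquivCells_symm (S : Filling lam)
    (p : Σ i : Fin k, ↥(lam.part i).cells) :
    (S.blockEquivCells.symm p).toFinset = S.entry p.1 p.2 := by
  ext a
  rw [Block.mem_toFinset, Equiv.eq_symm_apply, S.blockEquivCells_mk, Filling.cellOf_eq]

theorem Filling.type_setoid (S : Filling lam) : UBP.type S.setoid = lam.type := by
  rw [type_eq_of_equiv S.blockEquivCells (fun p => (p.1 : ℕ) + 1), lam.type_eq_sum]
  · rw [← Multiset.sum_map_singleton (Multiset.map _ _), Multiset.map_map]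
    change ∑ p : Σ i : Fin k, ↥(lam.part i).cells, ({(p.1 : ℕ) + 1} : Multiset ℕ) = _
    rw [Fintype.sum_sigma]
    refine Finset.sum_congr rfl fun i _ => ?_
    refine (Finset.sum_const ({(i : ℕ) + 1} : Multiset ℕ)).trans ?_
    rw [Multiset.nsmul_singleton, Finset.card_univ, Fintype.card_coe]
  · intro q
    obtain ⟨p, rfl⟩ := S.blockEquivCells.symm.surjective q
    rw [Equiv.apply_symm_apply, Block.size, S.toFinset_blockEquivCells_symm, S.card_entry]

/-- Let `l` match the blocks of `S` with those of π_λ in graded last letter order, and put in each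
cell the block of π_λ matched with the entry of `S`. -/
theorem exists_fill_eq (S : Filling lam) : ∃ l t, fill l t = S := by
  set h := S.type_setoid.trans lam.type_pi.symm with hh
  let f : ∀ i : Fin k, ↥(lam.part i).cells → BlockOfSize lam.pi ((i : ℕ) + 1) := fun i c =>
    ⟨blockEquiv h (S.blockEquivCells.symm ⟨i, c⟩), by
      rw [size_blockEquiv, Block.size, S.toFinset_blockEquivCells_symm, S.card_entry]⟩
  have hf : ∀ i, Function.Bijective (f i) := by
    intro i
    rw [Fintype.bijective_iff_injective_and_card, Index.card_blockOfSize lam.type_pi,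
      Fintype.card_coe]
    refine ⟨fun c c' hc => ?_, rfl⟩
    have h0 : (f i c).1 = (f i c').1 := by rw [hc]
    change blockEquiv h (S.blockEquivCells.symm ⟨i, c⟩) =
        blockEquiv h (S.blockEquivCells.symm ⟨i, c'⟩) at h0
    simpa using S.blockEquivCells.symm.injective ((blockEquiv h).injective h0)
  refine ⟨ell h, fun i => Equiv.ofBijective (f i) (hf i), ?_⟩
  ext i c a
  rw [mem_fill_entry, ell_below, Equiv.ofBijective_apply]
  change blockEquiv h _ = blockEquiv h _ ↔ _
  rw [(blockEquiv h).injective.eq_iff, Equiv.eq_symm_apply, S.blockEquivCells_mk,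
    Filling.cellOf_eq]

/-- The element of `W^λ` given by a filling. -/
noncomputable def fillVec (S : Filling lam) : WSpace lam :=
  W.tmul (CL.of (exists_fill_eq S).choose) (tableauxVec (exists_fill_eq S).choose_spec.choose)

/-- A filling determines the top set partition, so two presentations differ by some `g` in G_λ, and
the tensors agree by the balancing relation. Thus the choices in `fillVec` do not matter. -/
theorem fillVec_fill (l : L lam.pi) (t : Tableaux lam.pi lam) :
    fillVec (fill l t) = W.tmul (CL.of l) (tableauxVec t) := by
  have h := (exists_fill_eq (fill l t)).choose_spec.choose_spec
  rw [fillVec]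
  generalize (exists_fill_eq (fill l t)).choose_spec.choose = t' at *
  generalize (exists_fill_eq (fill l t)).choose = l' at *
  obtain ⟨g, rfl⟩ := L.exists_mulRight_eq (top_eq_of_fill_eq h)
  rw [fill_mulRight] at h
  obtain rfl := fill_injective _ h
  rw [W.tmul_mulRight, V_tableauxVec]
  rfl

end Fillings

/-! ### Existence and uniqueness of straightenings -/

section StraighteningOfFillings

variable {lam : Index k}

theorem Filling.permCells_one (S : Filling lam) (i : Fin k) : S.permCells i 1 = S := by
  ext j c a
  simp only [Filling.permCells, Pi.mulSingle_one]
  rfl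

theorem Filling.permCells_mul (S : Filling lam) (i : Fin k)
    (σ τ : Equiv.Perm ↥(lam.part i).cells) :
    S.permCells i (σ * τ) = (S.permCells i σ).permCells i τ := by
  ext j c a
  simp only [Filling.permCells, Pi.mulSingle_mul]
  rfl

theorem Filling.permCells_entry_self (S : Filling lam) (i : Fin k)
    (σ : Equiv.Perm ↥(lam.part i).cells) (c : ↥(lam.part i).cells) :
    (S.permCells i σ).entry i c = S.entry i (σ c) := by
  simp only [Filling.permCells, Pi.mulSingle_eq_same]

theorem Filling.permCells_entry_of_ne (S : Filling lam) {i j : Fin k} (h : j ≠ i)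
    (σ : Equiv.Perm ↥(lam.part i).cells) : (S.permCells i σ).entry j = S.entry j := by
  funext c
  simp only [Filling.permCells, Pi.mulSingle_eq_of_ne h]
  rfl

theorem Filling.maxKey_entry_injective (S : Filling lam) (i : Fin k) :
    Function.Injective fun c => maxKey (S.entry i c) := by
  intro c c' h
  obtain ⟨a, ha⟩ := S.entry_nonempty i c
  obtain ⟨m, hm⟩ := Finset.max_of_mem ha
  have h1 := Finset.mem_of_max hm
  have h2 := Finset.mem_of_max ((max_eq_of_maxKey_eq h).symm.trans hm)
  have h3 := (S.partition m).unique (y₁ := ⟨i, c⟩) (y₂ := ⟨i, c'⟩) h1 h2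
  simpa using h3

/-- The span of the column and Garnir relations. -/
noncomputable abbrev relationSpan (lam : Index k) : Submodule ℂ (Filling lam →₀ ℂ) :=
  Submodule.span ℂ (columnRelations lam ∪ garnirRelations lam)

/-- The class of a filling modulo the relations. -/
noncomputable def fillingClass (S : Filling lam) : (Filling lam →₀ ℂ) ⧸ relationSpan lam :=
  (relationSpan lam).mkQ (Finsupp.single S 1)

theorem fillingClass_permCells (S : Filling lam) (i : Fin k)
    {σ : Equiv.Perm ↥(lam.part i).cells} (h : ∀ c, (σ c).1.2 = c.1.2) :
    fillingClass (S.permCells i σ) = ((Equiv.Perm.sign σ : ℤ) : ℂ) • fillingClass S := by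
  rw [fillingClass, fillingClass, ← map_smul, Submodule.mkQ_apply, Submodule.mkQ_apply,
    Submodule.Quotient.eq]
  exact Submodule.subset_span (Or.inl ⟨S, i, σ, h, rfl⟩)

theorem sum_garnir_fillingClass_eq_zero (S : Filling lam) (i : Fin k) {j : ℕ}
    {A B : Finset ↥(lam.part i).cells} {X : Finset (Equiv.Perm ↥(lam.part i).cells)}
    (hA : ∀ c ∈ A, c.1.2 = j) (hB : ∀ c ∈ B, c.1.2 = j + 1)
    (hcard : (lam.part i).colLen j < A.card + B.card)
    (hX : IsTransversal (A : Set ↥(lam.part i).cells) (B : Set ↥(lam.part i).cells) X) :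
    ∑ σ ∈ X, ((Equiv.Perm.sign σ : ℤ) : ℂ) • fillingClass (S.permCells i σ) = 0 := by
  simp only [fillingClass, ← map_smul]
  rw [← map_sum, Submodule.mkQ_apply, Submodule.Quotient.mk_eq_zero]
  exact Submodule.subset_span (Or.inr ⟨S, i, j, A, B, X, hA, hB, hcard, hX, rfl⟩)

/-- The tableaux can be straightened one at a time: the relations for index `i` rearrange only
`S^(i)` and keep the other tableaux standard. -/
theorem fillingClass_mem_span (s : Finset (Fin k)) (S : Filling lam) :
    fillingClass S ∈ Submodule.span ℂ (fillingClass '' {S' | ∀ i ∈ s, IsStandard (S'.entry i)}) := by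
  classical
  induction s using Finset.induction_on with
  | empty => exact Submodule.subset_span ⟨S, by simp, rfl⟩
  | insert i s hi ih =>
    refine Submodule.span_le.2 ?_ ih
    rintro _ ⟨S', hS', rfl⟩
    have h := mem_span_standard (fun σ => fillingClass (S'.permCells i σ))
      (fun σ τ hτ => by
        rw [S'.permCells_mul, fillingClass_permCells _ _ hτ])
      (fun σ j A B X hA hB hcard hX => by
        simp only [S'.permCells_mul]
        exact sum_garnir_fillingClass_eq_zero (S'.permCells i σ) i hA hB hcard hX)
      _ (S'.maxKey_entry_injective i) 1
    simp only [S'.permCells_one] at h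
    refine Submodule.span_mono ?_ h
    rintro _ ⟨σ, hσ, rfl⟩
    refine ⟨S'.permCells i σ, fun j hj => ?_, rfl⟩
    by_cases hji : j = i
    · subst hji
      rw [isStandard_iff]
      simp only [Filling.permCells_entry_self]
      exact hσ
    · rw [S'.permCells_entry_of_ne hji]
      exact hS' j ((Finset.mem_insert.1 hj).resolve_left hji)

theorem map_mapDomain_val {M : Type*} [AddCommGroup M] [Module ℂ M]
    (F : (Filling lam →₀ ℂ) →ₗ[ℂ] M) (x : UniformTableau lam →₀ ℂ) :
    F (Finsupp.mapDomain Subtype.val x) =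
      Finsupp.linearCombination ℂ (fun T : UniformTableau lam => F (Finsupp.single T.1 1)) x := by
  have h : F = Finsupp.linearCombination ℂ fun S => F (Finsupp.single S 1) := by
    apply Finsupp.lhom_ext
    intro S a
    rw [Finsupp.linearCombination_single, ← map_smul, Finsupp.smul_single, smul_eq_mul, mul_one]
  refine (LinearMap.congr_fun h _).trans ?_
  exact Finsupp.linearCombination_mapDomain ℂ _ _

theorem exists_isStraightening (S : Filling lam) :
    ∃ x : UniformTableau lam →₀ ℂ, IsStraightening S x := by
  have h := fillingClass_mem_span Finset.univ S
  have h1 : fillingClass '' {S' : Filling lam | ∀ i ∈ Finset.univ, IsStandard (S'.entry i)} =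
      Set.range fun T : UniformTableau lam => fillingClass T.1 := by
    ext z
    constructor
    · rintro ⟨S', hS', rfl⟩
      exact ⟨⟨S', fun i => hS' i (Finset.mem_univ i)⟩, rfl⟩
    · rintro ⟨T, rfl⟩
      exact ⟨T.1, fun i _ => T.2 i, rfl⟩
  rw [h1, Finsupp.mem_span_range_iff_exists_finsupp] at h
  obtain ⟨x, hx⟩ := h
  refine ⟨x, ?_⟩
  rw [IsStraightening, ← Submodule.Quotient.eq, ← Submodule.mkQ_apply, ← Submodule.mkQ_apply,
    map_mapDomain_val]
  exact hx.symm

/-! ### The map from fillings to W^λ and the uniqueness of straightenings. -/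

theorem tableauxVec_update (t : Tableaux lam.pi lam) (i : Fin k)
    (σ : Equiv.Perm ↥(lam.part i).cells) :
    tableauxVec (fun j => ((Pi.mulSingle i σ : ∀ j, Equiv.Perm ↥(lam.part j).cells) j).trans (t j)) =
      PiTensorProduct.tprod ℂ
        (Function.update (fun j => spechtVec (t j)) i (spechtVec (σ.trans (t i)))) := by
  rw [tableauxVec]
  congr 1
  funext j
  by_cases h : j = i
  · subst h
    rw [Function.update_self, Pi.mulSingle_eq_same]
  · rw [Function.update_of_ne h, Pi.mulSingle_eq_of_ne h]
    rfl

theorem fillVec_permCells (l : L lam.pi) (t : Tableaux lam.pi lam) (i : Fin k)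
    (σ : Equiv.Perm ↥(lam.part i).cells) :
    fillVec ((fill l t).permCells i σ) = W.tmulRight (CL.of l) (PiTensorProduct.tprod ℂ
        (Function.update (fun j => spechtVec (t j)) i (spechtVec (σ.trans (t i))))) := by
  rw [← tableauxVec_update, W.tmulRight_apply, ← fillVec_fill]
  rfl

/-- The linear extension of `fillVec`. -/
noncomputable def fillMap (lam : Index k) : (Filling lam →₀ ℂ) →ₗ[ℂ] WSpace lam :=
  Finsupp.linearCombination ℂ fillVec

theorem fillMap_single (S : Filling lam) : fillMap lam (Finsupp.single S 1) = fillVec S := by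
  rw [fillMap, Finsupp.linearCombination_single, one_smul]

/-- With `l` fixed, a relation alters a single tensor factor, so multilinearity reduces it to the
same relation in one Specht module. -/
theorem relationSpan_le_ker : relationSpan lam ≤ LinearMap.ker (fillMap lam) := by
  rw [relationSpan, Submodule.span_le]
  rintro z (⟨S, i, σ, hσ, rfl⟩ | ⟨S, i, j, A, B, X, hA, hB, hcard, hX, rfl⟩)
  · obtain ⟨l, t, rfl⟩ := exists_fill_eq S
    rw [SetLike.mem_coe, LinearMap.mem_ker, map_sub, map_smul, fillMap_single, fillMap_single,
      fillVec_permCells, spechtVec_trans_of_preservesColumns _ hσ, MultilinearMap.map_update_smul,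
      Function.update_eq_self, map_smul, fillVec_fill]
    exact sub_self _
  · obtain ⟨l, t, rfl⟩ := exists_fill_eq S
    rw [SetLike.mem_coe, LinearMap.mem_ker, map_sum]
    simp only [map_smul, fillMap_single, fillVec_permCells]
    simp only [← map_smul, ← MultilinearMap.map_update_smul]
    rw [← map_sum, ← MultilinearMap.map_update_sum, sum_garnir_spechtVec_eq_zero _ hA hB hcard hX,
      MultilinearMap.map_update_zero, map_zero]

/-- Among blocks of one size the graded last letter order compares maxima, and `blockEquiv` is
monotone for it. Hence replacing blocks preserves standardness. -/
theorem blockEquiv_symm_standard_iff {γ π : Setoid (Fin k)} (h : UBP.type γ = UBP.type π)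
    {n : ℕ} (q q' : BlockOfSize π n) :
    ((blockEquiv h).symm q.1).toFinset.max < ((blockEquiv h).symm q'.1).toFinset.max ↔
      q.1.toFinset.max < q'.1.toFinset.max := by
  have hs : ∀ q : BlockOfSize π n, ((blockEquiv h).symm q.1).size = n := fun q => by
    rw [← size_blockEquiv h, OrderIso.apply_symm_apply, q.2]
  rw [← BlockOfSize.lt_iff, ← (blockEquiv h).symm.lt_iff_lt]
  exact (BlockOfSize.lt_iff (q := ⟨_, hs q⟩) (q' := ⟨_, hs q'⟩)).symm

theorem fill_ell_entry (γ : OfType lam) (t : Tableaux lam.pi lam) (i : Fin k)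
    (c : ↥(lam.part i).cells) : (fill γ.ell t).entry i c =
      ((blockEquiv (γ.2.trans lam.type_pi.symm)).symm (t i c).1).toFinset := by
  ext a
  rw [mem_fill_entry, Block.mem_toFinset, OfType.ell, ell_below, OrderIso.eq_symm_apply]

theorem isStandard_fill_ell (γ : OfType lam) (t : Tableaux lam.pi lam) (i : Fin k) :
    IsStandard ((fill γ.ell t).entry i) ↔ IsStandard fun c => (t i c).1.toFinset := by
  simp only [IsStandard, fill_ell_entry, blockEquiv_symm_standard_iff]

/-- The bijection between the basis of `W^λ` and the uniform tableaux. -/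
noncomputable def uniformTableauEquiv (lam : Index k) :
    OfType lam × PiTableau lam.pi lam ≃ UniformTableau lam :=
  Equiv.ofBijective (fun p => ⟨fill p.1.ell p.2.tab, fun i =>
    (isStandard_fill_ell p.1 p.2.tab i).2 (p.2.standard i)⟩) (by
    constructor
    · rintro ⟨γ, T⟩ ⟨γ', T'⟩ h
      have h1 : fill γ.ell T.tab = fill γ'.ell T'.tab := congrArg Subtype.val h
      have h2 := top_eq_of_fill_eq h1
      rw [γ.ell_top, γ'.ell_top] at h2
      obtain rfl : γ = γ' := Subtype.ext h2
      rw [PiTableau.ext (fill_injective _ h1)]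
    · rintro ⟨S, hS⟩
      obtain ⟨l, t, rfl⟩ := exists_fill_eq S
      -- Writing `l` as the orbit representative times `g` and moving `g` into the tableaux brings
      -- the filling to the required form.
      obtain ⟨g, hg⟩ := l.exists_ell_mulRight
      generalize l.topOfType = γ at hg
      subst hg
      simp only [fill_mulRight] at hS
      refine ⟨(γ, ⟨t.act g, fun i => (isStandard_fill_ell γ _ i).1 (hS i)⟩), ?_⟩
      exact Subtype.ext (fill_mulRight _ _ _).symm)

/-- The basis of `W^λ` indexed by the uniform tableaux. -/
noncomputable def uniformBasis (lam : Index k) :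
    Module.Basis (UniformTableau lam) ℂ (WSpace lam) :=
  (wBasis lam).reindex (uniformTableauEquiv lam)

theorem uniformBasis_apply (S : UniformTableau lam) : uniformBasis lam S = fillVec S.1 := by
  obtain ⟨⟨γ, T⟩, rfl⟩ := (uniformTableauEquiv lam).surjective S
  rw [uniformBasis, Module.Basis.reindex_apply, Equiv.symm_apply_apply, wBasis_apply]
  exact (fillVec_fill γ.ell T.tab).symm

theorem fillMap_mapDomain (x : UniformTableau lam →₀ ℂ) :
    fillMap lam (Finsupp.mapDomain Subtype.val x) = (uniformBasis lam).repr.symm x := by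
  rw [map_mapDomain_val, Module.Basis.repr_symm_apply]
  congr 2
  funext S
  rw [fillMap_single, uniformBasis_apply]

/-- Applying `fillMap` to a straightening kills the relations and turns the uniform tableaux into
basis vectors, so only the coordinate vector is possible. Some straightening exists, so the
coordinate vector is one. -/
theorem isStraightening_iff (S : Filling lam) (x : UniformTableau lam →₀ ℂ) :
    IsStraightening S x ↔ x = (uniformBasis lam).repr (fillVec S) := by
  have h : ∀ x, IsStraightening S x → x = (uniformBasis lam).repr (fillVec S) := by
    intro x hx
    have h1 := relationSpan_le_ker hx
    rw [LinearMap.mem_ker, map_sub, fillMap_single, fillMap_mapDomain, sub_eq_zero] at h1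
    rw [h1, LinearEquiv.apply_symm_apply]
  refine ⟨h x, ?_⟩
  rintro rfl
  obtain ⟨x, hx⟩ := exists_isStraightening S
  rwa [← h x hx]

end StraighteningOfFillings

/-! ### Generators of the monoid of uniform block permutations -/

section Generators

namespace U

theorem ofPerm_mul_rel (σ : Equiv.Perm (Fin k)) (d : U k) (x y : Fin k ⊕ Fin k) :
    (ofPerm σ * d).rel x y ↔ d.rel (Sum.map σ id x) (Sum.map σ id y) := by
  constructor
  · intro h
    have := mul_lift (Z := Quotient d.rel) (fun a => Quotient.mk _ (Sum.inl (σ a)))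
      (fun b => Quotient.mk _ (Sum.inl b)) (fun c => Quotient.mk _ (Sum.inr c))
      (by
        intro x y hxy
        have hxy : Sum.elim σ id x = Sum.elim σ id y := hxy
        rcases x with a | a <;> rcases y with b | b <;>
          exact congrArg (fun z => Quotient.mk d.rel (Sum.inl z)) hxy)
      (by
        intro x y hxy
        rcases x with a | a <;> rcases y with b | b <;> exact Quotient.sound hxy) h
    rcases x with a | a <;> rcases y with b | b <;> exact Quotient.exact this
  · intro h
    have hm := stack_lower (d := (ofPerm σ).rel) h
    have hl : ∀ a, stack (ofPerm σ).rel d.rel (Sum.inl a) (Sum.inr (Sum.inl (σ a))) := fun a =>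
      stack_upper (a := Sum.inl a) (b := Sum.inr (σ a)) rfl
    rw [mul_rel]
    rcases x with a | a <;> rcases y with b | b
    · exact Setoid.trans' _ (hl a) (Setoid.trans' _ hm (Setoid.symm' _ (hl b)))
    · exact Setoid.trans' _ (hl a) hm
    · exact Setoid.trans' _ hm (Setoid.symm' _ (hl b))
    · exact hm

theorem ofPerm_mul_bot (σ : Equiv.Perm (Fin k)) (d : U k) : (ofPerm σ * d).bot = d.bot := by
  ext a b
  exact ofPerm_mul_rel σ d (Sum.inr a) (Sum.inr b)

/-- Diagrams compose from top to bottom, which reverses the order of the permutations. -/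
theorem ofPerm_mul_ofPerm (σ τ : Equiv.Perm (Fin k)) :
    ofPerm σ * ofPerm τ = ofPerm (τ * σ) := by
  ext x y
  rw [ofPerm_mul_rel]
  rcases x with a | a <;> rcases y with b | b <;> exact Iff.rfl

theorem ofPerm_one : ofPerm (1 : Equiv.Perm (Fin k)) = 1 := by
  have h : ∀ a b : Fin k, a = b ↔ (Quotient.mk (⊥ : Setoid (Fin k)) a) = Quotient.mk _ b :=
    fun a b => (Quotient.eq (r := (⊥ : Setoid (Fin k)))).symm
  ext x y
  rcases x with a | a <;> rcases y with b | b <;> exact h a b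

theorem flip_ofPerm (σ : Equiv.Perm (Fin k)) : (ofPerm σ).flip = ofPerm σ⁻¹ := by
  apply ext_top_bot
  intro a b
  change a = σ b ↔ σ.symm a = b
  rw [Equiv.symm_apply_eq]

theorem mul_ofPerm_rel (σ : Equiv.Perm (Fin k)) (d : U k) (x y : Fin k ⊕ Fin k) :
    (d * ofPerm σ⁻¹).rel x y ↔ d.rel (Sum.map id σ x) (Sum.map id σ y) := by
  rw [← flip_flip (d * ofPerm σ⁻¹), flip_mul, flip_ofPerm, inv_inv, flip_rel, ofPerm_mul_rel,
    flip_rel]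
  rcases x with a | a <;> rcases y with b | b <;> exact Iff.rfl

theorem ofPerm_mul_e_mul_ofPerm (σ : Equiv.Perm (Fin k)) (π : Setoid (Fin k)) :
    ofPerm σ * (e π * ofPerm σ⁻¹) = e (π.comap σ) := by
  apply ext_top_bot
  intro a b
  rw [ofPerm_mul_rel, mul_ofPerm_rel]
  change Quotient.mk π (σ a) = Quotient.mk π (σ b) ↔
    Quotient.mk (π.comap σ) a = Quotient.mk (π.comap σ) b
  rw [Quotient.eq, Quotient.eq]
  exact Iff.rfl

theorem e_rel_inl_inr (π : Setoid (Fin k)) (a b : Fin k) :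
    (e π).rel (Sum.inl a) (Sum.inr b) ↔ π a b := Quotient.eq (r := π)

theorem e_mul_e (π π' : Setoid (Fin k)) : e π * e π' = e (π ⊔ π') := by
  apply ext_top_bot
  intro a b
  rw [e_rel_inl_inr]
  constructor
  · intro h
    refine Quotient.exact (s := π ⊔ π') (mul_lift (Z := Quotient (π ⊔ π')) (Quotient.mk _)
      (Quotient.mk _) (Quotient.mk _) ?_ ?_ h)
    · intro x y hxy
      rcases x with a | a <;> rcases y with b | b <;>
        exact Quotient.sound ((le_sup_left : π ≤ π ⊔ π') (Quotient.exact hxy))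
    · intro x y hxy
      rcases x with a | a <;> rcases y with b | b <;>
        exact Quotient.sound ((le_sup_right : π' ≤ π ⊔ π') (Quotient.exact hxy))
  · intro h
    let R := stack (e π).rel (e π').rel
    have hl : ∀ a, R (Sum.inl a) (Sum.inr (Sum.inl a)) := fun a =>
      stack_upper (a := Sum.inl a) (b := Sum.inr a) rfl
    have hr : ∀ a, R (Sum.inr (Sum.inl a)) (Sum.inr (Sum.inr a)) :=
      fun a => stack_lower (a := Sum.inl a) (b := Sum.inr a) rfl
    have hle : π ⊔ π' ≤ (e π * e π').top := by
      apply sup_le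
      · intro a a' h
        exact mul_top_top (Quotient.sound h)
      · intro a a' h
        exact R.trans' (hl a) (R.trans'
          (stack_lower (a := Sum.inl a) (b := Sum.inl a') (Quotient.sound h))
          (R.symm' (hl a')))
    exact R.trans' (hle h) (R.trans' (hl b) (hr b))

/-- The set partition whose only block with several elements is `{a, b}`. -/
def pair (a b : Fin k) : Setoid (Fin k) := Setoid.ker fun x => if x = b then a else x

theorem pair_le {π : Setoid (Fin k)} {a b : Fin k} (h : π a b) : pair a b ≤ π := by
  have h1 : ∀ x, π x (if x = b then a else x) := by
    intro x
    split_ifs with hx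
    · rw [hx]
      exact π.symm' h
    · exact π.refl' x
  intro x y hxy
  have hxy : (if x = b then a else x) = if y = b then a else y := hxy
  have h2 := h1 x
  rw [hxy] at h2
  exact π.trans' h2 (π.symm' (h1 y))

theorem pair_rel (a b : Fin k) : pair a b a b := by
  change (if a = b then a else a) = if b = b then a else b
  simp

theorem comap_pair (σ : Equiv.Perm (Fin k)) (a b : Fin k) :
    (pair (σ a) (σ b)).comap σ = pair a b := by
  ext x y
  change (if σ x = σ b then σ a else σ x) = (if σ y = σ b then σ a else σ y) ↔
    (if x = b then a else x) = if y = b then a else y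
  simp only [σ.apply_eq_iff_eq, ← apply_ite σ]

/-- The generators `s_i` and `b_i`. -/
def generators (k : ℕ) : Set (U k) :=
  {d | ∃ (i : ℕ) (hi : i + 1 < k), d = s i hi ∨ d = b i hi}

theorem ofPerm_mem_closure (σ : Equiv.Perm (Fin k)) :
    ofPerm σ ∈ Submonoid.closure (generators k) := by
  rcases k with _ | n
  · rw [Subsingleton.elim σ 1, ofPerm_one]
    exact one_mem _
  · have h : σ ∈ Submonoid.closure (Set.range fun i : Fin n => Equiv.swap i.castSucc i.succ) := by
      rw [Equiv.Perm.mclosure_swap_castSucc_succ]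
      trivial
    induction h using Submonoid.closure_induction with
    | mem τ hτ =>
      obtain ⟨i, rfl⟩ := hτ
      exact Submonoid.subset_closure ⟨i, by omega, Or.inl rfl⟩
    | one =>
      rw [ofPerm_one]
      exact one_mem _
    | mul σ τ _ _ hσ hτ =>
      rw [← ofPerm_mul_ofPerm]
      exact mul_mem hτ hσ

/-- Conjugation by a permutation that sends `a` and `c` to the first two letters turns the first
generator `b` into the idempotent of the pair. -/
theorem e_pair_mem_closure (a c : Fin k) :
    e (pair a c) ∈ Submonoid.closure (generators k) := by
  by_cases hac : a = c
  · subst hac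
    have : pair a a = ⊥ := by
      rw [eq_bot_iff]
      exact pair_le rfl
    rw [this]
    exact one_mem _
  · have hk : 0 + 1 < k := by
      have h1 := a.2
      have h2 := c.2
      have h3 : a.1 ≠ c.1 := fun h => hac (Fin.ext h)
      omega
    set z : Fin k := ⟨0, by omega⟩ with hz
    set o : Fin k := ⟨0 + 1, hk⟩ with ho
    have hzo : z ≠ o := by simp [hz, ho]
    let σ : Equiv.Perm (Fin k) := Equiv.swap (Equiv.swap a z c) o * Equiv.swap a z
    have hc : Equiv.swap a z c ≠ z := by
      intro h
      rw [Equiv.swap_apply_eq_iff, Equiv.swap_apply_right] at h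
      exact hac h.symm
    have h1 : σ a = z := by
      rw [Equiv.Perm.mul_apply, Equiv.swap_apply_left, Equiv.swap_apply_of_ne_of_ne hc.symm hzo]
    have h2 : σ c = o := by
      rw [Equiv.Perm.mul_apply, Equiv.swap_apply_left]
    rw [← comap_pair σ, h1, h2, ← ofPerm_mul_e_mul_ofPerm]
    refine mul_mem (ofPerm_mem_closure _) (mul_mem ?_ (ofPerm_mem_closure _))
    exact Submonoid.subset_closure ⟨0, hk, Or.inr rfl⟩

/-- A set partition is the join of the pairs it contains, and products of idempotents correspond to
joins. -/
theorem e_mem_closure (π : Setoid (Fin k)) : e π ∈ Submonoid.closure (generators k) := by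
  classical
  have h1 : ∀ T : Finset (Fin k × Fin k),
      e (T.sup fun p => pair p.1 p.2) ∈ Submonoid.closure (generators k) := by
    intro T
    induction T using Finset.induction_on with
    | empty => exact one_mem _
    | insert p T _ ih =>
      rw [Finset.sup_insert, ← e_mul_e]
      exact mul_mem (e_pair_mem_closure _ _) ih
  have h2 : (Finset.univ.filter fun p : Fin k × Fin k => π p.1 p.2).sup
      (fun p => pair p.1 p.2) = π := by
    apply le_antisymm
    · exact Finset.sup_le fun p hp => pair_le (Finset.mem_filter.1 hp).2
    · intro a b hab
      have hmem : (a, b) ∈ Finset.univ.filter fun p : Fin k × Fin k => π p.1 p.2 :=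
        Finset.mem_filter.2 ⟨Finset.mem_univ _, hab⟩
      exact Finset.le_sup (f := fun p : Fin k × Fin k => pair p.1 p.2) hmem (pair_rel a b)
  rw [← h2]
  exact h1 _

/-- By uniformity the letters of each block in the top row can be matched with those in the bottom
row. These matchings form `σ`, and the idempotent at `d.bot` restores the blocks. -/
theorem exists_eq_ofPerm_mul_e (d : U k) : ∃ σ, d = ofPerm σ * e d.bot := by
  classical
  have hcard : ∀ z : Quotient d.rel,
      Nonempty ({a : Fin k // Quotient.mk d.rel (Sum.inl a) = z} ≃
        {b : Fin k // Quotient.mk d.rel (Sum.inr b) = z}) := by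
    intro z
    exact Finite.card_eq.1
      (d.ncard_fiber (Quotient.mk d.rel) (fun _ _ h => Quotient.sound h) z)
  let σ : Equiv.Perm (Fin k) :=
    (Equiv.sigmaFiberEquiv fun a => Quotient.mk d.rel (Sum.inl a)).symm.trans
      ((Equiv.sigmaCongrRight fun z => (hcard z).some).trans
        (Equiv.sigmaFiberEquiv fun a => Quotient.mk d.rel (Sum.inr a)))
  have hσ : ∀ a, d.rel (Sum.inl a) (Sum.inr (σ a)) := fun a =>
    Quotient.exact ((hcard _).some ⟨a, rfl⟩).2.symm
  refine ⟨σ, ext_top_bot fun a b => ?_⟩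
  rw [ofPerm_mul_rel]
  change _ ↔ (e d.bot).rel (Sum.inl (σ a)) (Sum.inr b)
  rw [e_rel_inl_inr]
  exact ⟨fun h => d.rel.trans' (d.rel.symm' (hσ a)) h, fun h => d.rel.trans' (hσ a) h⟩

/-- The monoid of uniform block permutations is generated by the `s_i` and the `b_i`. -/
theorem closure_generators : Submonoid.closure (generators k) = ⊤ := by
  rw [eq_top_iff]
  intro d _
  obtain ⟨σ, hσ⟩ := d.exists_eq_ofPerm_mul_e
  rw [hσ]
  exact mul_mem (ofPerm_mem_closure _) (e_mem_closure _)

end U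

end Generators

/-! ### The action on uniform tableaux -/

section TableauAction

variable {lam : Index k}

/-- The representation `W^λ` in the coordinates given by the uniform tableaux. -/
noncomputable def tableauRep (lam : Index k) :
    Representation ℂ (U k) (UniformTableau lam →₀ ℂ) where
  toFun d := (uniformBasis lam).repr.conj (W lam d)
  map_one' := by
    rw [map_one]
    exact LinearEquiv.conj_id _
  map_mul' d d' := by
    rw [map_mul]
    exact LinearEquiv.conj_comp _ _ _

theorem tableauRep_repr (d : U k) (w : WSpace lam) :
    tableauRep lam d ((uniformBasis lam).repr w) = (uniformBasis lam).repr (W lam d w) := by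
  change (uniformBasis lam).repr.conj (W lam d) _ = _
  rw [LinearEquiv.conj_apply_apply, LinearEquiv.symm_apply_apply]

theorem repr_fillVec (S : UniformTableau lam) :
    (uniformBasis lam).repr (fillVec S.1) = Finsupp.single S 1 := by
  rw [← uniformBasis_apply, Module.Basis.repr_self]

theorem tableauRep_single (d : U k) (S : UniformTableau lam) :
    tableauRep lam d (Finsupp.single S 1) = (uniformBasis lam).repr (W lam d (fillVec S.1)) := by
  rw [← repr_fillVec, tableauRep_repr]

theorem odot_ofPerm {π : Setoid (Fin k)} (σ : Equiv.Perm (Fin k)) (l : L π) :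
    odot (U.ofPerm σ) l = CL.of ⟨U.ofPerm σ * l.1, (U.ofPerm_mul_bot σ l.1).trans l.2⟩ :=
  dif_pos _

/-- In the product the letter `a` lies above what `σ a` lay above before, so entries are replaced by
their preimages under `σ`. The inverse disappears for the transpositions `s_i`. -/
theorem relabel_fill (σ : Equiv.Perm (Fin k)) (l : L lam.pi) (t : Tableaux lam.pi lam) :
    (fill l t).relabel σ⁻¹ =
      fill ⟨U.ofPerm σ * l.1, (U.ofPerm_mul_bot σ l.1).trans l.2⟩ t := by
  ext i c a
  obtain ⟨b, hb⟩ := (t i c).1.exists_mk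
  rw [mem_fill_entry, ← hb, L.below_eq_mk, U.ofPerm_mul_rel]
  change a ∈ ((fill l t).entry i c).map _ ↔ l.1.rel (Sum.inl (σ a)) (Sum.inr b)
  rw [Finset.mem_map_equiv, mem_fill_entry, ← hb, L.below_eq_mk]
  exact Iff.rfl

theorem W_ofPerm_fillVec (σ : Equiv.Perm (Fin k)) (S : Filling lam) :
    W lam (U.ofPerm σ) (fillVec S) = fillVec (S.relabel σ⁻¹) := by
  obtain ⟨l, t, rfl⟩ := exists_fill_eq S
  rw [relabel_fill, fillVec_fill, fillVec_fill, W_tmul, odot_ofPerm]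

theorem b_eq (i : ℕ) (hi : i + 1 < k) :
    U.b i hi = U.e (U.pair ⟨i, by omega⟩ ⟨i + 1, hi⟩) := rfl

theorem W_b_fillVec_of_mem (i : ℕ) (hi : i + 1 < k) (S : Filling lam)
    (h : ∃ j c, (⟨i, by omega⟩ : Fin k) ∈ S.entry j c ∧ ⟨i + 1, hi⟩ ∈ S.entry j c) :
    W lam (U.b i hi) (fillVec S) = fillVec S := by
  obtain ⟨l, t, rfl⟩ := exists_fill_eq S
  rw [← top_iff_fill] at h
  have h1 : U.b i hi * l.1 = l.1 := by
    rw [b_eq]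
    exact U.e_mul (U.pair_le h)
  have h2 : (U.b i hi * l.1).bot = lam.pi := by rw [h1, l.2]
  rw [fillVec_fill, W_tmul, odot, dif_pos h2]
  congr 2
  exact Subtype.ext h1

theorem W_b_fillVec_of_not_mem (i : ℕ) (hi : i + 1 < k) (S : Filling lam)
    (h : ¬ ∃ j c, (⟨i, by omega⟩ : Fin k) ∈ S.entry j c ∧ ⟨i + 1, hi⟩ ∈ S.entry j c) :
    W lam (U.b i hi) (fillVec S) = 0 := by
  obtain ⟨l, t, rfl⟩ := exists_fill_eq S
  rw [← top_iff_fill] at h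
  rw [fillVec_fill, W_tmul, odot, dif_neg, W.zero_tmul]
  intro h1
  have h2 := bot_le_top_of_mul_bot (h1.trans l.2.symm)
  rw [b_eq, U.e_bot] at h2
  exact h (h2 (U.pair_rel _ _))

theorem isTableauAction_tableauRep (lam : Index k) : IsTableauAction (tableauRep lam) := by
  intro i hi S
  refine ⟨fun h => ?_, fun h => ?_, ?_⟩
  · rw [tableauRep_single, W_b_fillVec_of_mem i hi S.1 h, repr_fillVec]
  · rw [tableauRep_single, W_b_fillVec_of_not_mem i hi S.1 h, map_zero]
  · rw [tableauRep_single, isStraightening_iff, U.s, W_ofPerm_fillVec, Equiv.swap_inv]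

theorem eq_of_isTableauAction {θ θ' : Representation ℂ (U k) (UniformTableau lam →₀ ℂ)}
    (h : IsTableauAction θ) (h' : IsTableauAction θ') : θ = θ' := by
  refine MonoidHom.eq_of_eqOn_denseM U.closure_generators ?_
  rintro d ⟨i, hi, rfl | rfl⟩ <;>
  · apply Finsupp.lhom_ext'
    intro S
    apply LinearMap.ext_ring
    obtain ⟨h1, h2, h3⟩ := h i hi S
    obtain ⟨h1', h2', h3'⟩ := h' i hi S
    change θ _ (Finsupp.single S 1) = θ' _ (Finsupp.single S 1)
    -- For `s_i` the uniqueness of straightening fixes the value; for `b_i` the two cases of the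
    -- rule are exhaustive.
    first
    | exact ((isStraightening_iff _ _).1 h3).trans ((isStraightening_iff _ _).1 h3').symm
    | by_cases hc : ∃ j c, (⟨i, by omega⟩ : Fin k) ∈ S.1.entry j c ∧
          ⟨i + 1, hi⟩ ∈ S.1.entry j c
      · exact (h1 hc).trans (h1' hc).symm
      · exact (h2 hc).trans (h2' hc).symm

end TableauAction

end UBP

/-! ### The main theorem. -/

theorem mainTheorem3 (k : ℕ) (lam : UBP.Index k) :
    -- `W^λ` is irreducible
    (UBP.W lam).IsIrreducible ∧
    -- the elements `ℓ_π^γ ⊗ T` form a basis of `W^λ`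
    (∃ 𝓑 : Module.Basis
        ({γ : Setoid (Fin k) // UBP.type γ = lam.type} × UBP.PiTableau lam.pi lam) ℂ
        (UBP.WSpace lam),
      ∀ γ T, 𝓑 (γ, T) =
        UBP.W.tmul (UBP.CL.of (UBP.ell (γ.2.trans lam.type_pi.symm))) T.vec) ∧
    -- Garnir straightening is well defined
    (∀ S : UBP.Filling lam, ∃! x : UBP.UniformTableau lam →₀ ℂ, UBP.IsStraightening S x) ∧
    -- the action on uniform tableaux is well defined, and `ρ` is an isomorphism of representations
    ∃ θ : Representation ℂ (UBP.U k) (UBP.UniformTableau lam →₀ ℂ),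
      UBP.IsTableauAction θ ∧
      (∀ θ' : Representation ℂ (UBP.U k) (UBP.UniformTableau lam →₀ ℂ),
        UBP.IsTableauAction θ' → θ' = θ) ∧
      ∃ ρ : UBP.WSpace lam ≃ₗ[ℂ] (UBP.UniformTableau lam →₀ ℂ),
        (∀ (γ : Setoid (Fin k)) (hγ : UBP.type γ = lam.type) (T : UBP.PiTableau lam.pi lam),
          ∃ S : UBP.UniformTableau lam,
            S.1.entry = T.replace (hγ.trans lam.type_pi.symm) ∧
            ρ (UBP.W.tmul (UBP.CL.of (UBP.ell (hγ.trans lam.type_pi.symm))) T.vec) =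
              Finsupp.single S 1) ∧
        ∀ (d : UBP.U k) (w : UBP.WSpace lam), ρ (UBP.W lam d w) = θ d (ρ w) := by
  refine ⟨UBP.W_isIrreducible lam, ⟨UBP.wBasis lam, fun γ T => UBP.wBasis_apply γ T⟩,
    fun S => ⟨_, (UBP.isStraightening_iff S _).2 rfl, fun x hx =>
      (UBP.isStraightening_iff S x).1 hx⟩,
    UBP.tableauRep lam, UBP.isTableauAction_tableauRep lam,
    fun θ' h => UBP.eq_of_isTableauAction h (UBP.isTableauAction_tableauRep lam),
    (UBP.uniformBasis lam).repr, fun γ hγ T => ?_, fun d w => (UBP.tableauRep_repr d w).symm⟩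
  refine ⟨UBP.uniformTableauEquiv lam (⟨γ, hγ⟩, T), ?_, ?_⟩
  · funext i c
    exact UBP.fill_ell_entry ⟨γ, hγ⟩ T.tab i c
  · rw [← UBP.repr_fillVec]
    congr 1
    exact (UBP.fillVec_fill (UBP.OfType.ell ⟨γ, hγ⟩) T.tab).symm
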